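/- Fix constants $p,q>0$, $c_U\ge 1$, $c_L>0$, $\kappa\ge 1$; all constants hidden in $O(\cdot)$, $\Omega(\cdot)$ and in the algorithm depend only on these. Let $M:\mathbb R_{\ge 0}\to\mathbb R_{\ge 0}$ be nondecreasing with $M(0)=0$, with $M^{1/p}$ subadditive, and with $$c_L (y/x)^q\le M(y)/M(x)\le c_U (y/x)^p\qquad\text{for all } y>x>0,$$ and for weights $w\ge \mathbf 1$ write $\|z\|_{M,w}=\big(\sum_i w_i M(|z_i|)\big)^{1/p}$ and $\|z\|_M=\|z\|_{M,\mathbf 1}$. Let $A\in\mathbb R^{n\times d}$ with $n\ge 2$, $d\ge 1$, let $b\in\mathbb R^n$ be accessible only through queries to its entries, and let $0<\varepsilon<1/2$. Let $T\ge 1$ be such that a subroutine is available which, for every matrix $B$ with $d$ columns, returns upper bounds on the $\ell_p$ Lewis weights of $B$ that sum to at most $\kappa d$, and which takes time at most $\kappa(\mathrm{nnz}(B)+T)$ if $B$ has at most $n$ rows. **Sensitivity bounds** for the rows in a set $S$ with parameter $\tau$: start with the value $2\tau/|S|$ for every row of $S$; for $r=1,\dots,\lceil\log_2(|S|/\tau)\rceil$,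 repeat $O(\log n)$ times: hash $S$ uniformly into $10\cdot 2^r$ buckets, compute Lewis weight upper bounds $\tilde\omega_i$ of the submatrix of each bucket, and raise the value of each row with $d^{\max\{0,p/2-1\}}\tilde\omega_i\ge\Omega(1)$ to at least $2/2^r$. For weights $w\ge \mathbf 1$ on $S$, do this for each level set $\{i\in S:2^{j-1}\le w_i<2^j\}$ separately and double the values. **Two-round sampling** with oversampling parameter $m$: compute sensitivity bounds $s$ of all rows with $\tau=T$; keep row $i$ independently with probability $p_i=\min\{1,m s_i\}$ and weight $1/p_i$; compute weighted sensitivity bounds of the kept rows with $\tau=d$, and sample again in the same way, dividing the weight of a kept row by its sampling probability. **Algorithm.** (1) Sample rows in two rounds with $m=O(d)$, query $b$ on them, and let $x_c$ be any solution of the sampled weighted problem $\min_x\|Ax-b\|_{M,w'}$ within the factor $\kappa$. (2) With $\varepsilon'=\Theta(\varepsilon)$, sample rows afresh in two rounds with $m=O\big(d\,\varepsilon'^{-(2+p)}\log(1/\varepsilon')\big)$, query $b$ on them, set $b'=b-Ax_c$ on these rows, and let $\bar x$ be any solution of the sampled weighted problem $\min_x\|Ax-b'\|_{M,v'}$ within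 the factor $1+\varepsilon'$. Return $\tilde x=x_c+\bar x$. **Theorem.** The hidden constants of the algorithm can be chosen such that for all such inputs, with probability at least $99/100$, simultaneously $$\|A\tilde x-b\|_M\le(1+\varepsilon)\inf_{x\in\mathbb R^d}\|Ax-b\|_M,$$ the algorithm queries at most $$O\!\left(\frac{d^{\max\{2,\,p/2+1\}}\log^3 n}{\varepsilon^{2+p}}\log\frac1\varepsilon\right)$$ entries of $b$, and its running time, not counting the time spent inside the two calls that (approximately) solve the sampled regression problems, is at most $$O\!\left((\mathrm{nnz}(A)+n)\log^3 n+\frac{\big(T d^{\max\{1,p/2\}}+T^2\big)\log^4 n}{\varepsilon^{2+p}}\log\frac1\varepsilon\right).$$ -/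

import Mathlib

open scoped NNReal ENNReal

noncomputable section

/-! ## Loss functions -/

/-- `M` is polynomially bounded above with degree `p` and constant `c`. -/
def PolyBoundedAbove (M : ℝ≥0 → ℝ≥0) (p c : ℝ) : Prop :=
  ∀ x y : ℝ≥0, 0 < x → x < y → (M y : ℝ) / M x ≤ c * ((y : ℝ) / x) ^ p

/-- `M` is polynomially bounded below with degree `q` and constant `c`.  (For the pair `x`, `y` the
inequality forces `M x ≠ 0`, as the quotient presupposes.) -/
def PolyBoundedBelow (M : ℝ≥0 → ℝ≥0) (q c : ℝ) : Prop :=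
  ∀ x y : ℝ≥0, 0 < x → x < y → c * ((y : ℝ) / x) ^ q ≤ (M y : ℝ) / M x

/-- The standing assumptions on the loss: `M 0 = 0`, `M` is nondecreasing and polynomially bounded
above and below, and `M ^ (1 / p)` is subadditive. -/
structure IsAdmissibleLoss (M : ℝ≥0 → ℝ≥0) (p q cU cL : ℝ) : Prop where
  map_zero : M 0 = 0
  monotone : Monotone M
  above : PolyBoundedAbove M p cU
  below : PolyBoundedBelow M q cL
  subadditive : ∀ x y : ℝ≥0, M (x + y) ^ (1 / p) ≤ M x ^ (1 / p) + M y ^ (1 / p)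

/-- The weighted `M`-norm `(∑ᵢ wᵢ M(|xᵢ|)) ^ (1 / p)`. -/
def mNorm (M : ℝ≥0 → ℝ≥0) (p : ℝ) {ι : Type} [Fintype ι] (w x : ι → ℝ) : ℝ :=
  (∑ i, w i * (M (Real.nnabs (x i)) : ℝ)) ^ (1 / p)

/-! ## Sparsity, sensitivities and Lewis weights -/

/-- Number of nonzero entries of a matrix. -/
def nnz {ι κ : Type} (A : Matrix ι κ ℝ) : ℕ :=
  Set.ncard {e : ι × κ | A e.1 e.2 ≠ 0}

/-- Number of nonzero entries of one row. -/
def rowNnz {ι κ : Type} (A : Matrix ι κ ℝ) (i : ι) : ℕ :=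
  Set.ncard {j : κ | A i j ≠ 0}

/-- The `i`-th `ℓ_p` sensitivity `sup |(Bx)ᵢ|^p / ‖Bx‖_p^p`.  The vectors `x` with `Bx = 0`
contribute the value `0 / 0 = 0`, so they do not affect the supremum of these nonnegative numbers. -/
def lpSensitivity (p : ℝ) {m d : ℕ} (B : Matrix (Fin m) (Fin d) ℝ) (i : Fin m) : ℝ :=
  ⨆ x : Fin d → ℝ, |(B.mulVec x) i| ^ p / ∑ j, |(B.mulVec x) j| ^ p

/-- `w` are the `ℓ_p` Lewis weights of `B`: `wᵢ` is the `i`-th leverage score (`ℓ_2` sensitivity)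
of `W^(1/2 - 1/p) B`.  Nonzero rows have positive weight, so that the negative powers make sense
(a zero row gets leverage score `0`, hence weight `0`). -/
def IsLewisWeights (p : ℝ) {m d : ℕ} (B : Matrix (Fin m) (Fin d) ℝ) (w : Fin m → ℝ) : Prop :=
  (∀ i, 0 ≤ w i) ∧ (∀ i, B i ≠ 0 → 0 < w i) ∧
    ∀ i, w i = lpSensitivity 2 (Matrix.of fun k j => w k ^ (1 / 2 - 1 / p) * B k j) i

/-! ## Subroutines -/

/-- A subroutine for constant factor `ℓ_p` Lewis weight approximation of matrices with `d` columns: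
it returns upper bounds on the Lewis weights that sum to at most `κ d`, and on matrices with at
most `n` rows it takes at most `κ (nnz(B) + T)` steps. -/
structure LewisRoutine (n d : ℕ) (p κ T : ℝ) where
  weights : ∀ {m : ℕ}, Matrix (Fin m) (Fin d) ℝ → Fin m → ℝ
  time : ∀ {m : ℕ}, Matrix (Fin m) (Fin d) ℝ → ℕ
  upper : ∀ {m : ℕ} (B : Matrix (Fin m) (Fin d) ℝ),
    ∃ w : Fin m → ℝ, IsLewisWeights p B w ∧ ∀ i, w i ≤ weights B i
  total : ∀ {m : ℕ} (B : Matrix (Fin m) (Fin d) ℝ), ∑ i, weights B i ≤ κ * d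
  time_le : ∀ {m : ℕ} (B : Matrix (Fin m) (Fin d) ℝ), m ≤ n → (time B : ℝ) ≤ κ * (nnz B + T)

/-- A subroutine that solves weighted `M`-regression with `d` unknowns up to the given factor.
No assumption is made on its running time. -/
structure RegressionRoutine (M : ℝ≥0 → ℝ≥0) (p : ℝ) (d : ℕ) (factor : ℝ) where
  solve : ∀ {m : ℕ}, Matrix (Fin m) (Fin d) ℝ → (Fin m → ℝ) → (Fin m → ℝ) → Fin d → ℝ
  time : ∀ {m : ℕ}, Matrix (Fin m) (Fin d) ℝ → (Fin m → ℝ) → (Fin m → ℝ) → ℕ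
  correct : ∀ {m : ℕ} (B : Matrix (Fin m) (Fin d) ℝ) (w y : Fin m → ℝ), (∀ i, 1 ≤ w i) →
    ∀ x : Fin d → ℝ,
      mNorm M p w (B.mulVec (solve B w y) - y) ≤ factor * mNorm M p w (B.mulVec x - y)

/-! ## Randomized programs with query access to a vector, and their cost -/

/-- Cost of an execution: total number of steps (`time`), the part of it that is spent inside the
regression subroutine (`solverTime`), and the number of queries to the target vector. -/
@[ext] structure Cost where
  time : ℕ
  solverTime : ℕ
  queries : ℕ

instance : Zero Cost := ⟨⟨0, 0, 0⟩⟩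

instance : Add Cost :=
  ⟨fun a b => ⟨a.time + b.time, a.solverTime + b.solverTime, a.queries + b.queries⟩⟩

/-- Randomized programs that return a value of type `α` and can read a vector `b : Fin n → ℝ` only
through queries to single entries. -/
inductive Prog (n : ℕ) (α : Type) : Type where
  | ret (a : α) : Prog n α
  | charge (c : Cost) (next : Prog n α) : Prog n α
  | query (i : Fin n) (next : ℝ → Prog n α) : Prog n α
  | coin (q : ℝ) (next : Bool → Prog n α) : Prog n α
  | draw (k : ℕ+) (next : Fin (k : ℕ) → Prog n α) : Prog n α

namespace Prog

variable {n : ℕ} {α β σ : Type}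

/-- Sequential composition. -/
def bind : Prog n α → (α → Prog n β) → Prog n β
  | ret a, f => f a
  | charge c next, f => charge c (next.bind f)
  | query i next, f => query i fun y => (next y).bind f
  | coin q next, f => coin q fun y => (next y).bind f
  | draw k next, f => draw k fun y => (next y).bind f

instance : Monad (Prog n) where
  pure := ret
  bind := bind

/-- `k` elementary steps. -/
def step (k : ℕ) : Prog n Unit := charge ⟨k, 0, 0⟩ (ret ())

/-- One elementary step (an arithmetic operation, a comparison, a memory access) with result `a`. -/
def prim (a : α) : Prog n α := charge ⟨1, 0, 0⟩ (ret a)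

/-- Read the entry `b i`. -/
def ask (i : Fin n) : Prog n ℝ := query i ret

/-- Toss a coin that shows `true` with probability `q`. -/
def toss (q : ℝ) : Prog n Bool := coin q ret

/-- Draw a uniformly random element of `{0, …, k - 1}`. -/
def uniform (k : ℕ+) : Prog n (Fin (k : ℕ)) := draw k ret

/-- Loop over a list with a state; each iteration costs one step on top of its body. -/
def forEach : List β → σ → (σ → β → Prog n σ) → Prog n σ
  | [], s, _ => pure s
  | a :: l, s, f => do
      step 1
      let t ← f s a
      forEach l t f

/-- The law of a coin that shows `true` with probability `q` (truncated to `[0, 1]`). -/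
def coinLaw (q : ℝ) : PMF Bool :=
  PMF.ofFintype
    (fun y => if y then min (ENNReal.ofReal q) 1 else 1 - min (ENNReal.ofReal q) 1) (by
      simp only [Fintype.sum_bool, if_true, Bool.false_eq_true, if_false]
      exact add_tsub_cancel_of_le (min_le_right _ _))

/-- Execution on the vector `b`: the joint law of the returned value and the cost.  A query costs
one step and one query; a coin toss and a uniform draw cost one step each. -/
def run (b : Fin n → ℝ) : Prog n α → PMF (α × Cost)
  | ret a => PMF.pure (a, 0)
  | charge c next => (run b next).map fun r => (r.1, c + r.2)
  | query i next => (run b (next (b i))).map fun r => (r.1, ⟨1, 0, 1⟩ + r.2)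
  | coin q next => (coinLaw q).bind fun y =>
      (run b (next y)).map fun r => (r.1, ⟨1, 0, 0⟩ + r.2)
  | draw k next =>
      haveI : Nonempty (Fin (k : ℕ)) := Fin.pos_iff_nonempty.mp k.pos
      (PMF.uniformOfFintype (Fin (k : ℕ))).bind fun y =>
        (run b (next y)).map fun r => (r.1, ⟨1, 0, 0⟩ + r.2)

end Prog

open Prog

/-! ## The algorithm -/

/-- The constants that the pseudocode hides in its `O(·)` and `Ω(·)`. -/
structure AlgConstants where
  /-- the hashing is repeated `⌈reps * log n⌉` times -/
  reps : ℝ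
  /-- rows whose bound in their bucket is at least `threshold` are marked -/
  threshold : ℝ
  /-- factor in the oversampling parameters -/
  oversample : ℝ
  /-- the internal accuracy is `ε / scale` -/
  scale : ℝ
  reps_pos : 0 < reps
  threshold_pos : 0 < threshold
  oversample_pos : 0 < oversample
  one_le_scale : 1 ≤ scale

/-- The matrix formed by the listed rows of `A`. -/
def rowsOf {n d : ℕ} (A : Matrix (Fin n) (Fin d) ℝ) (S : List (Fin n)) :
    Matrix (Fin S.length) (Fin d) ℝ :=
  A.submatrix S.get id

/-- Call the Lewis weight subroutine on the listed rows; handing over the rows costs their size. -/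
def callLewis {n d : ℕ} {p κ T : ℝ} (lewis : LewisRoutine n d p κ T)
    (A : Matrix (Fin n) (Fin d) ℝ) (S : List (Fin n)) : Prog n (Fin S.length → ℝ) := do
  step (nnz (rowsOf A S) + S.length + 1)
  step (lewis.time (rowsOf A S))
  pure (lewis.weights (rowsOf A S))

/-- Call a regression subroutine on the listed rows with weights `w` and targets `y`; handing over
the instance costs its size. -/
def callSolver {M : ℝ≥0 → ℝ≥0} {n d : ℕ} {p factor : ℝ} (solver : RegressionRoutine M p d factor)
    (A : Matrix (Fin n) (Fin d) ℝ) (S : List (Fin n)) (w y : Fin n → ℝ) :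
    Prog n (Fin d → ℝ) := do
  step (nnz (rowsOf A S) + 2 * S.length + d + 1)
  let t := solver.time (rowsOf A S) (fun a => w (S.get a)) (fun a => y (S.get a))
  Prog.charge ⟨t, t, 0⟩ (pure ())
  pure (solver.solve (rowsOf A S) (fun a => w (S.get a)) (fun a => y (S.get a)))

/-- Hash the listed rows independently and uniformly into `k` buckets. -/
def hashRows {n : ℕ} (S : List (Fin n)) (k : ℕ+) : Prog n (Fin (k : ℕ) → List (Fin n)) :=
  forEach S (fun _ => []) fun table i => do
    let c ← uniform k
    prim (Function.update table c (i :: table c))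

/-- Upper bounds on the `M`-sensitivities of the matrix formed by the rows in `S`, with parameter
`τ` and `L` repetitions of the hashing. -/
def sensitivityBounds {n d : ℕ} {p κ T : ℝ} (K : AlgConstants) (lewis : LewisRoutine n d p κ T)
    (A : Matrix (Fin n) (Fin d) ℝ) (L : ℕ) (τ : ℝ) (S : List (Fin n)) : Prog n (Fin n → ℝ) := do
  let u ← prim (2 * τ)
  let s₀ ← prim (u / S.length)
  let s ← forEach S (fun _ => 0) fun s i => prim (Function.update s i s₀)
  let z ← prim (S.length / τ)
  let R ← prim ⌈Real.logb 2 z⌉₊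
  let D ← prim ((d : ℝ) ^ max 0 (p / 2 - 1))
  forEach (List.range R) s fun s r₀ => do
    let r := r₀ + 1
    let k : ℕ+ := 10 * 2 ^ r
    step 2
    let v ← prim ((2 : ℝ) / 2 ^ r)
    forEach (List.range L) s fun s _ => do
      let table ← hashRows S k
      forEach (List.finRange k) s fun s c => do
        let w ← callLewis lewis A (table c)
        forEach (List.finRange (table c).length) s fun s a => do
          let i := (table c).get a
          let h ← prim (D * w a)
          let marked ← prim (decide (K.threshold ≤ h))
          if marked then do
            let x ← prim (max v (s i))
            prim (Function.update s i x)
          else pure s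

/-- Upper bounds on the weighted `M`-sensitivities of the rows in `S` with weights `w ≥ 1`:
split the rows into the level sets `2 ^ j ≤ wᵢ < 2 ^ (j + 1)`, and double the unweighted bounds
within each level set. -/
def weightedSensitivityBounds {n d : ℕ} {p κ T : ℝ} (K : AlgConstants)
    (lewis : LewisRoutine n d p κ T) (A : Matrix (Fin n) (Fin d) ℝ) (L : ℕ) (τ : ℝ)
    (S : List (Fin n)) (w : Fin n → ℝ) : Prog n (Fin n → ℝ) := do
  let wmax ← forEach S 0 fun t i => prim (max t (w i))
  let N ← prim ⌈Real.logb 2 (1 + wmax)⌉₊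
  let level ← forEach S (fun _ => ([] : List (Fin n))) fun (level : ℕ → List (Fin n)) i => do
    let j ← prim ⌊Real.logb 2 (w i)⌋₊
    prim (Function.update level j (i :: level j))
  forEach (List.range N) (fun _ => 0) fun acc j => do
    let s ← sensitivityBounds K lewis A L τ (level j)
    forEach (level j) acc fun acc i => do
      let x ← prim (2 * s i)
      prim (Function.update acc i x)

/-- Sensitivity sampling with oversampling parameter `m`: row `i` of `S` is kept with probability
`qᵢ = min 1 (m sᵢ)`, independently, and then gets the weight `wᵢ / qᵢ`.  Returns the list of the
rows that are kept and the new weights (`0` for the other rows). -/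
def sampleRows {n : ℕ} (m : ℝ) (S : List (Fin n)) (w s : Fin n → ℝ) :
    Prog n (List (Fin n) × (Fin n → ℝ)) :=
  forEach S ([], fun _ => 0) fun out i => do
    let x ← prim (m * s i)
    let q ← prim (min 1 x)
    let keep ← toss q
    if keep then do
      let v ← prim (w i / q)
      step 2
      pure (i :: out.1, Function.update out.2 i v)
    else pure out

/-- Two rounds of sensitivity sampling, starting from all rows with weight one: first with
the bounds for `τ = T`, then with the bounds for `τ = d`. -/
def twoRoundSampling {n d : ℕ} {p κ T : ℝ} (K : AlgConstants) (lewis : LewisRoutine n d p κ T)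
    (A : Matrix (Fin n) (Fin d) ℝ) (m : ℝ) : Prog n (List (Fin n) × (Fin n → ℝ)) := do
  let L ← prim ⌈K.reps * Real.log n⌉₊
  let s ← sensitivityBounds K lewis A L T (List.finRange n)
  let first ← sampleRows m (List.finRange n) (fun _ => 1) s
  let t ← weightedSensitivityBounds K lewis A L d first.1 first.2
  sampleRows m first.1 first.2 t

/-- Active regression with a constant factor guarantee. -/
def constantFactorRegression {M : ℝ≥0 → ℝ≥0} {n d : ℕ} {p κ T : ℝ} (K : AlgConstants)
    (lewis : LewisRoutine n d p κ T) (coarse : RegressionRoutine M p d κ)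
    (A : Matrix (Fin n) (Fin d) ℝ) : Prog n (Fin d → ℝ) := do
  let m ← prim (K.oversample * d)
  let rows ← twoRoundSampling K lewis A m
  let y ← forEach rows.1 (fun _ : Fin n => (0 : ℝ)) fun y i => do
    let t ← ask i
    prim (Function.update y i t)
  callSolver coarse A rows.1 rows.2 y

/-- Active regression with a relative error guarantee; `δ` is the internal accuracy.  The residual
`b - A x_c` is only evaluated at the sampled rows. -/
def relativeErrorRegression {M : ℝ≥0 → ℝ≥0} {n d : ℕ} {p κ T : ℝ} (K : AlgConstants) (δ : ℝ)
    (lewis : LewisRoutine n d p κ T) (coarse : RegressionRoutine M p d κ)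
    (fine : RegressionRoutine M p d (1 + δ))
    (A : Matrix (Fin n) (Fin d) ℝ) : Prog n (Fin d → ℝ) := do
  let xc ← constantFactorRegression K lewis coarse A
  -- a fixed number of arithmetic operations for the oversampling parameter
  step 10
  let rows ← twoRoundSampling K lewis A (K.oversample * d / δ ^ (2 + p) * Real.log (1 / δ))
  let y ← forEach rows.1 (fun _ : Fin n => (0 : ℝ)) fun y i => do
    let t ← ask i
    -- one multiplication and one addition for each nonzero entry of the row
    step (2 * rowNnz A i)
    let z ← prim (t - (A.mulVec xc) i)
    prim (Function.update y i z)
  let xbar ← callSolver fine A rows.1 rows.2 y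
  step d
  pure (xc + xbar)

/-! ## The bounds -/

/-- `d^max(2, p/2+1) log³ n · log(1/ε) / ε^(2+p)`. -/
def queryBound (n d : ℕ) (p ε : ℝ) : ℝ :=
  (d : ℝ) ^ max 2 (p / 2 + 1) * Real.log n ^ 3 / ε ^ (2 + p) * Real.log (1 / ε)

/-- `(nnz(A) + n) log³ n + (T d^max(1, p/2) + T²) log⁴ n · log(1/ε) / ε^(2+p)`. -/
def timeBound {n d : ℕ} (A : Matrix (Fin n) (Fin d) ℝ) (p ε T : ℝ) : ℝ :=
  ((nnz A : ℝ) + n) * Real.log n ^ 3 +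
    (T * (d : ℝ) ^ max 1 (p / 2) + T ^ 2) * Real.log n ^ 4 / ε ^ (2 + p) * Real.log (1 / ε)

end

/-!
Write `F_w(z) = ∑ᵢ wᵢ M(|zᵢ|)` for the energy of `z`, the `p`-th power of `‖z‖_{M,w}`, and `V` for the
column space of `A`.

*Sensitivity bounds.* For a row `i` let `y ∈ V` nearly maximize the ratio of `M(|yᵢ|)` and the
energy of `y`, and let `2 ^ (-r)` be about this ratio. It suffices that row `i` gets marked at level
`r`. If the rows are hashed into `10 · 2 ^ r` buckets, the other rows in the bucket of `i` have
expected energy at most `M(|yᵢ|) / 10`. If their energy is at most `M(|yᵢ|)`, the upper polynomial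
bound for `M` shows that the `ℓ_p` sensitivity of row `i` within its bucket is at least
`1 / (1 + cU)`. Lewis weights times `d ^ max 0 (p / 2 - 1)` bound `ℓ_p` sensitivities
(`IsLewisWeights.rpow_abs_le`), so row `i` is marked. A repetition of the hashing therefore fails
for row `i` with probability at most `1 / 10`, and `12 log n` repetitions fail for some row with
probability at most `1 / 1000` (`Prog.failProb_sensitivityBounds_le`). As Lewis weights sum to at
most `κ d`, few rows are marked, which controls the sum of the bounds and with it the size of the
sample.

*One round of sampling.* Energy balls of `V` have nets of size `η ^ (-O(d))`, by comparison of
volumes; `M` need not be homogeneous, but the lower polynomial bound takes the place of homogeneity.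
With valid sensitivity bounds no sampled row contributes much to the energy of a vector in the ball,
and a Chernoff bound controls the energies of the net. For residuals `y - z` the rows on which `z` is
much larger than the vectors in the ball are treated separately. There `y - z` has nearly the same
loss as `z`, so that these rows only contribute a shift that is common to all `y`. This is the notion
`Preserves`, and `Prog.exists_failProb_preserves` is the result. A supremum over the ball is bounded
by the maximum over the net plus a small multiple of itself, which avoids any chaining.

*Regression.* Energies are approximated only for vectors of a bounded energy `ρ`. A vector outside of
the ball is halved until it enters the ball, when its energy is still comparable with `ρ`; hence the
new energy of a vector outside of the ball is at least a constant multiple of `ρ`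
(`IsAdmissibleLoss.energy_le_of_embed`). So the solution of a sampled problem lies within a ball
whose radius is a constant times the optimum. For the first stage this suffices. The second
stage has a target `b - A x_c` whose energy is a constant multiple of the optimum, and there the
residual energies of its solution and of a near-minimizer are compared; the common shift cancels.

*Costs.* Programs are analysed with triples `Prog.Triple`, which state jointly a property of the
result, a bound for the cost, and a bound for the probability that one of them fails; the rules for
sequential composition and loops add up costs and failure probabilities.
-/

/-! ### Expectations over the executions of a program -/
namespace Cost
@[simp] theorem zero_time : (0 : Cost).time = 0 := rfl
@[simp] theorem zero_solverTime : (0 : Cost).solverTime = 0 := rfl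
@[simp] theorem zero_queries : (0 : Cost).queries = 0 := rfl
@[simp] theorem add_time (a b : Cost) : (a + b).time = a.time + b.time := rfl
@[simp] theorem add_solverTime (a b : Cost) :
    (a + b).solverTime = a.solverTime + b.solverTime := rfl
@[simp] theorem add_queries (a b : Cost) : (a + b).queries = a.queries + b.queries := rfl
theorem zero_add' (a : Cost) : 0 + a = a := by ext <;> simp
theorem add_assoc' (a b c : Cost) : a + b + c = a + (b + c) := by ext <;> simp [Nat.add_assoc]
/-- The cost `c` consists of at most `t` steps outside the regression subroutine and of at most `k`
queries. -/
def Within (c : Cost) (t k : ℝ) : Prop :=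
  (c.time : ℝ) ≤ t + c.solverTime ∧ (c.queries : ℝ) ≤ k
theorem Within.add {c c' : Cost} {t t' k k' : ℝ} (h : c.Within t k) (h' : c'.Within t' k') :
    (c + c').Within (t + t') (k + k') := by
  obtain ⟨h1, h2⟩ := h
  obtain ⟨h3, h4⟩ := h'
  constructor <;> push_cast [add_time, add_solverTime, add_queries] <;> linarith
theorem Within.mono {c : Cost} {t t' k k' : ℝ} (h : c.Within t k) (ht : t ≤ t') (hk : k ≤ k') :
    c.Within t' k' :=
  ⟨h.1.trans (by linarith), h.2.trans hk⟩
end Cost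
namespace Prog
variable {n : ℕ} {α β σ : Type}
/-- The expectation of `g` (a function of the returned value and the cost) over the executions of a
program on the vector `b`. As programs branch finitely, it is a finite sum at every node. -/
noncomputable def expect (b : Fin n → ℝ) : Prog n α → (α → Cost → ℝ≥0∞) → ℝ≥0∞
  | ret a, g => g a 0
  | charge c next, g => expect b next fun a c' => g a (c + c')
  | query i next, g => expect b (next (b i)) fun a c' => g a (⟨1, 0, 1⟩ + c')
  | coin q next, g => ∑ y, coinLaw q y * expect b (next y) fun a c' => g a (⟨1, 0, 0⟩ + c')
  | draw k next, g =>
      ∑ y, ((k : ℕ) : ℝ≥0∞)⁻¹ * expect b (next y) fun a c' => g a (⟨1, 0, 0⟩ + c')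
variable (b : Fin n → ℝ)
theorem toOuterMeasure_run (P : Prog n α) (s : Set (α × Cost)) :
    (run b P).toOuterMeasure s = expect b P fun a c => s.indicator 1 (a, c) := by
  induction P generalizing s with
  | ret a =>
    classical
    simp [run, expect, PMF.toOuterMeasure_pure_apply, Set.indicator_apply]
  | charge c next ih =>
    rw [run, expect, PMF.toOuterMeasure_map_apply, ih]; rfl
  | query i next ih =>
    rw [run, expect, PMF.toOuterMeasure_map_apply, ih]; rfl
  | coin q next ih =>
    rw [run, expect, PMF.toOuterMeasure_bind_apply, tsum_fintype]
    refine Finset.sum_congr rfl fun y _ => ?_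
    rw [PMF.toOuterMeasure_map_apply, ih]; rfl
  | draw k next ih =>
    rw [run, expect, PMF.toOuterMeasure_bind_apply, tsum_fintype]
    refine Finset.sum_congr rfl fun y _ => ?_
    rw [PMF.toOuterMeasure_map_apply, ih, PMF.uniformOfFintype_apply, Fintype.card_fin]; rfl
theorem expect_bind (P : Prog n α) (f : α → Prog n β) (g : β → Cost → ℝ≥0∞) :
    expect b (P >>= f) g =
      expect b P fun a c => expect b (f a) fun a' c' => g a' (c + c') := by
  change expect b (P.bind f) g = _
  induction P generalizing g with
  | ret a => simp [Prog.bind, expect, Cost.zero_add']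
  | charge c next ih => simp [Prog.bind, expect, ih, Cost.add_assoc']
  | query i next ih => simp [Prog.bind, expect, ih, Cost.add_assoc']
  | coin q next ih => simp only [Prog.bind, expect, ih, Cost.add_assoc']
  | draw k next ih => simp only [Prog.bind, expect, ih, Cost.add_assoc']
variable {b}
theorem expect_mono (P : Prog n α) {g g' : α → Cost → ℝ≥0∞} (h : ∀ a c, g a c ≤ g' a c) :
    expect b P g ≤ expect b P g' := by
  induction P generalizing g g' with
  | ret a => exact h _ _
  | charge c next ih => exact ih fun _ _ => h _ _
  | query i next ih => exact ih _ fun _ _ => h _ _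
  | coin q next ih =>
    exact Finset.sum_le_sum fun y _ => mul_le_mul_right (ih _ fun _ _ => h _ _) _
  | draw k next ih =>
    exact Finset.sum_le_sum fun y _ => mul_le_mul_right (ih _ fun _ _ => h _ _) _
theorem expect_add (P : Prog n α) (g g' : α → Cost → ℝ≥0∞) :
    expect b P (fun a c => g a c + g' a c) = expect b P g + expect b P g' := by
  induction P generalizing g g' with
  | ret a => rfl
  | charge c next ih => exact ih _ _
  | query i next ih => exact ih _ _ _
  | coin q next ih => simp only [expect, ih, mul_add, Finset.sum_add_distrib]
  | draw k next ih => simp only [expect, ih, mul_add, Finset.sum_add_distrib]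
theorem expect_const_mul (P : Prog n α) (x : ℝ≥0∞) (g : α → Cost → ℝ≥0∞) :
    expect b P (fun a c => x * g a c) = x * expect b P g := by
  induction P generalizing g with
  | ret a => rfl
  | charge c next ih => exact ih _
  | query i next ih => exact ih _ _
  | coin q next ih => simp only [expect, ih, Finset.mul_sum, mul_left_comm x]
  | draw k next ih => simp only [expect, ih, Finset.mul_sum, mul_left_comm x]
theorem expect_const (P : Prog n α) (x : ℝ≥0∞) : expect b P (fun _ _ => x) = x := by
  induction P with
  | ret a => rfl
  | charge c next ih => exact ih
  | query i next ih => exact ih _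
  | coin q next ih =>
    have h : ∑ y, coinLaw q y = 1 := by rw [← tsum_fintype (L := .unconditional _)]; exact (coinLaw q).tsum_coe
    simp only [expect, ih, ← Finset.sum_mul, h, one_mul]
  | draw k next ih =>
    have hk : ((k : ℕ) : ℝ≥0∞) ≠ 0 := by exact_mod_cast k.ne_zero
    simp only [expect, ih, Finset.sum_const, Finset.card_univ, Fintype.card_fin, nsmul_eq_mul]
    rw [← mul_assoc, ENNReal.mul_inv_cancel hk (ENNReal.natCast_ne_top _), one_mul]
variable (b)
/-- The expectation of a function of the returned value. -/
noncomputable def ev (P : Prog n α) (g : α → ℝ≥0∞) : ℝ≥0∞ := expect b P fun a _ => g a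
variable {b}
@[simp] theorem ev_bind (P : Prog n α) (f : α → Prog n β) (g : β → ℝ≥0∞) :
    ev b (P >>= f) g = ev b P fun a => ev b (f a) g := expect_bind b P f _
@[simp] theorem ev_pure (a : α) (g : α → ℝ≥0∞) : ev b (pure a) g = g a := rfl
@[simp] theorem ev_prim (a : α) (g : α → ℝ≥0∞) : ev b (prim a) g = g a := rfl
@[simp] theorem ev_step (k : ℕ) (g : Unit → ℝ≥0∞) : ev b (step k) g = g () := rfl
theorem ev_toss {q : ℝ} (h0 : 0 ≤ q) (h1 : q ≤ 1) (g : Bool → ℝ≥0∞) :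
    ev b (toss q) g = ENNReal.ofReal q * g true + ENNReal.ofReal (1 - q) * g false := by
  have h : ENNReal.ofReal q ≤ 1 := ENNReal.ofReal_le_one.2 h1
  have h' : (1 : ℝ≥0∞) - ENNReal.ofReal q = ENNReal.ofReal (1 - q) := by
    rw [ENNReal.ofReal_sub _ h0, ENNReal.ofReal_one]
  simp [ev, toss, expect, coinLaw, PMF.ofFintype_apply, min_eq_left h, h']
theorem ev_uniform (k : ℕ+) (g : Fin (k : ℕ) → ℝ≥0∞) :
    ev b (uniform k) g = ∑ y, ((k : ℕ) : ℝ≥0∞)⁻¹ * g y := rfl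
theorem ev_mono (P : Prog n α) {g g' : α → ℝ≥0∞} (h : ∀ a, g a ≤ g' a) : ev b P g ≤ ev b P g' :=
  expect_mono P fun a _ => h a
theorem ev_add (P : Prog n α) (g g' : α → ℝ≥0∞) :
    ev b P (fun a => g a + g' a) = ev b P g + ev b P g' := expect_add P _ _
theorem ev_const_mul (P : Prog n α) (x : ℝ≥0∞) (g : α → ℝ≥0∞) :
    ev b P (fun a => x * g a) = x * ev b P g := expect_const_mul P _ _
theorem ev_const (P : Prog n α) (x : ℝ≥0∞) : ev b P (fun _ => x) = x := expect_const P _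
theorem ev_sum {ι : Type*} (s : Finset ι) (P : Prog n α) (g : ι → α → ℝ≥0∞) :
    ev b P (fun a => ∑ i ∈ s, g i a) = ∑ i ∈ s, ev b P (g i) := by
  classical
  induction s using Finset.induction_on with
  | empty => simp [ev_const]
  | insert i s hi ih => simp only [Finset.sum_insert hi, ev_add, ih]
open Classical in
/-- The probability that the returned value does not satisfy `Q`. -/
noncomputable def failProb (b : Fin n → ℝ) (P : Prog n α) (Q : α → Prop) : ℝ≥0∞ :=
  ev b P fun a => if Q a then 0 else 1
theorem failProb_mono (P : Prog n α) {Q Q' : α → Prop} (h : ∀ a, Q a → Q' a) :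
    failProb b P Q' ≤ failProb b P Q := by
  refine ev_mono P fun a => ?_
  by_cases h1 : Q a
  · simp [h1, h a h1]
  · by_cases h2 : Q' a <;> simp [h1, h2]
theorem failProb_and_le (P : Prog n α) (Q Q' : α → Prop) :
    failProb b P (fun a => Q a ∧ Q' a) ≤ failProb b P Q + failProb b P Q' := by
  rw [failProb, failProb, failProb, ← ev_add]
  refine ev_mono P fun a => ?_
  by_cases h1 : Q a <;> by_cases h2 : Q' a <;> simp [h1, h2]
theorem failProb_forall_le {ι : Type*} (s : Finset ι) (P : Prog n α) (Q : ι → α → Prop) :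
    failProb b P (fun a => ∀ i ∈ s, Q i a) ≤ ∑ i ∈ s, failProb b P (Q i) := by
  classical
  simp only [failProb]
  rw [← ev_sum]
  refine ev_mono P fun a => ?_
  split_ifs with h
  · exact zero_le
  · push Not at h
    obtain ⟨i, hi, h⟩ := h
    refine le_trans ?_ (Finset.single_le_sum (fun _ _ => zero_le) hi)
    simp [h]
/-- Markov's inequality. -/
theorem failProb_le_of_ev_le (P : Prog n α) (Q : α → Prop) (g : α → ℝ≥0∞) {x y : ℝ≥0∞}
    (h : ∀ a, ¬Q a → 1 ≤ x * g a) (hy : ev b P g ≤ y) : failProb b P Q ≤ x * y := by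
  refine le_trans ?_ (mul_le_mul_right hy x)
  rw [← ev_const_mul]
  refine ev_mono P fun a => ?_
  split_ifs with h1
  · exact zero_le
  · exact h a h1
/-! ### Hoare triples with failure probabilities and costs -/
open Classical in
/-- With probability at least `1 - φ`, the returned value satisfies `Q`, and the execution takes at
most `t` steps outside the regression subroutine and at most `k` queries. -/
def Triple (b : Fin n → ℝ) (P : Prog n α) (φ : ℝ≥0∞) (t k : ℝ) (Q : α → Prop) : Prop :=
  expect b P (fun a c => if Q a ∧ c.Within t k then 0 else 1) ≤ φ
theorem Triple.mono {P : Prog n α} {φ φ' : ℝ≥0∞} {t t' k k' : ℝ} {Q Q' : α → Prop}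
    (h : Triple b P φ t k Q) (hφ : φ ≤ φ') (ht : t ≤ t') (hk : k ≤ k') (hQ : ∀ a, Q a → Q' a) :
    Triple b P φ' t' k' Q' := by
  refine (expect_mono P fun a c => ?_).trans (h.trans hφ)
  by_cases h1 : Q a ∧ c.Within t k
  · rw [if_pos ⟨hQ a h1.1, h1.2.mono ht hk⟩]; exact zero_le
  · rw [if_neg h1]; split_ifs <;> simp
theorem Triple.failProb_le {P : Prog n α} {φ : ℝ≥0∞} {t k : ℝ} {Q : α → Prop}
    (h : Triple b P φ t k Q) : failProb b P Q ≤ φ := by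
  refine (expect_mono P fun a c => ?_).trans h
  by_cases h1 : Q a
  · simp [h1]
  · simp [h1]
/-- Almost sure properties may be used when bounding an expectation. -/
theorem ev_mono_of_failProb {P : Prog n α} {Q : α → Prop} (h : failProb b P Q ≤ 0)
    {g g' : α → ℝ≥0∞} (hg : ∀ a, Q a → g a ≤ g' a) : ev b P g ≤ ev b P g' := by
  classical
  have h0 : failProb b P Q = 0 := le_antisymm h zero_le
  have h1 : ev b P (fun a => g' a + ⊤ * (if Q a then 0 else 1)) = ev b P g' := by
    rw [ev_add, ev_const_mul]
    change _ + ⊤ * failProb b P Q = _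
    rw [h0, mul_zero, add_zero]
  rw [← h1]
  refine ev_mono P fun a => ?_
  by_cases h2 : Q a
  · simpa [h2] using hg a h2
  · simp [h2]
theorem Triple.and {P : Prog n α} {φ φ' : ℝ≥0∞} {t k : ℝ} {Q Q' : α → Prop}
    (h : Triple b P φ t k Q) (h' : failProb b P Q' ≤ φ') :
    Triple b P (φ + φ') t k (fun a => Q a ∧ Q' a) := by
  refine le_trans ?_ (add_le_add h h')
  rw [failProb, ev, ← expect_add]
  refine expect_mono P fun a c => ?_
  by_cases h1 : Q a <;> by_cases h2 : Q' a <;> by_cases h3 : c.Within t k <;> simp [h1, h2, h3]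
theorem Triple.bind {P : Prog n α} {f : α → Prog n β} {φ φ' : ℝ≥0∞} {t t' k k' : ℝ}
    {Q : α → Prop} {Q' : β → Prop} (h : Triple b P φ t k Q)
    (h' : ∀ a, Q a → Triple b (f a) φ' t' k' Q') :
    Triple b (P >>= f) (φ + φ') (t + t') (k + k') Q' := by
  classical
  rw [Triple, expect_bind]
  have h1 : expect b P (fun _ _ => φ') = φ' := expect_const P _
  refine le_trans ?_ (add_le_add h h1.le)
  rw [← expect_add]
  refine expect_mono P fun a c => ?_
  by_cases h2 : Q a ∧ c.Within t k
  · rw [if_pos h2, zero_add]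
    refine le_trans (expect_mono _ fun a' c' => ?_) (h' a h2.1)
    by_cases h3 : Q' a' ∧ c'.Within t' k'
    · rw [if_pos ⟨h3.1, h2.2.add h3.2⟩]; exact zero_le
    · rw [if_neg h3]; split_ifs <;> simp
  · rw [if_neg h2]
    refine le_trans (expect_mono (g' := fun _ _ => 1) _ fun a' c' => ?_) ?_
    · split_ifs <;> simp
    · rw [expect_const]; exact le_self_add
theorem Triple.pure {a : α} {φ : ℝ≥0∞} {t k : ℝ} {Q : α → Prop} (ht : 0 ≤ t) (hk : 0 ≤ k)
    (h : Q a) : Triple b (pure a) φ t k Q := by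
  have : (0 : Cost).Within t k := ⟨by simpa using ht, by simpa using hk⟩
  change expect b (ret a) _ ≤ φ
  simp [expect, h, this]
theorem Triple.charge_bind {c : Cost} {f : Unit → Prog n β} {φ : ℝ≥0∞} {t t' k : ℝ} {Q : β → Prop}
    (hc : c.Within t' 0) (h : Triple b (f ()) φ (t - t') k Q) :
    Triple b (Prog.charge c (Pure.pure ()) >>= f) φ t k Q := by
  have : Triple b (Prog.charge c (Pure.pure ())) 0 t' 0 (fun _ => True) := by
    have h2 : (c + 0).Within t' 0 := ⟨by simpa using hc.1, by simpa using hc.2⟩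
    change expect b (Prog.charge c (ret ())) _ ≤ 0
    simp [expect, h2]
  exact (this.bind (f := f) fun _ _ => h).mono (by simp) (by linarith) (by linarith) fun _ h => h
theorem Triple.step_bind {m : ℕ} {f : Unit → Prog n β} {φ : ℝ≥0∞} {t k : ℝ} {Q : β → Prop}
    (h : Triple b (f ()) φ (t - m) k Q) : Triple b (step m >>= f) φ t k Q :=
  Triple.charge_bind (t' := m) ⟨by simp, by simp⟩ h
theorem Triple.prim {a : α} {φ : ℝ≥0∞} {t k : ℝ} {Q : α → Prop} (ht : 1 ≤ t) (hk : 0 ≤ k)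
    (h : Q a) : Triple b (prim a) φ t k Q := by
  have : ((⟨1, 0, 0⟩ : Cost) + 0).Within t k := ⟨by simpa using ht, by simpa using hk⟩
  change expect b (Prog.charge ⟨1, 0, 0⟩ (ret a)) _ ≤ φ
  simp [expect, h, this]
theorem Triple.prim_bind {a : α} {f : α → Prog n β} {φ : ℝ≥0∞} {t k : ℝ} {Q : β → Prop}
    (h : Triple b (f a) φ (t - 1) k Q) : Triple b (Prog.prim a >>= f) φ t k Q :=
  ((Triple.prim (a := a) (φ := 0) (t := 1) (k := 0) (Q := fun x => x = a) le_rfl le_rfl rfl).bind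
    (f := f) (fun x hx => by subst hx; exact h)).mono (by simp) (by linarith) (by linarith)
    fun _ h => h
theorem Triple.uniform_bind {m : ℕ+} {f : Fin (m : ℕ) → Prog n β} {φ : ℝ≥0∞} {t k : ℝ}
    {Q : β → Prop} (h : ∀ y, Triple b (f y) φ (t - 1) k Q) :
    Triple b (uniform m >>= f) φ t k Q := by
  have : Triple b (uniform m) 0 1 0 (fun _ => True) := by
    have h2 : ((⟨1, 0, 0⟩ : Cost) + 0).Within 1 0 := ⟨by simp, by simp⟩
    simp [Triple, uniform, expect, h2]
  exact (this.bind (f := f) fun y _ => h y).mono (by simp) (by linarith) (by linarith) fun _ h => h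
theorem Triple.toss_bind {q : ℝ} {f : Bool → Prog n β} {φ : ℝ≥0∞} {t k : ℝ}
    {Q : β → Prop} (h : ∀ y, Triple b (f y) φ (t - 1) k Q) :
    Triple b (toss q >>= f) φ t k Q := by
  have : Triple b (toss q) 0 1 0 (fun _ => True) := by
    have h2 : ((⟨1, 0, 0⟩ : Cost) + 0).Within 1 0 := ⟨by simp, by simp⟩
    simp [Triple, toss, expect, h2]
  exact (this.bind (f := f) fun y _ => h y).mono (by simp) (by linarith) (by linarith) fun _ h => h
theorem Triple.ask_bind {i : Fin n} {f : ℝ → Prog n β} {φ : ℝ≥0∞} {t k : ℝ}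
    {Q : β → Prop} (h : Triple b (f (b i)) φ (t - 1) (k - 1) Q) :
    Triple b (ask i >>= f) φ t k Q := by
  have : Triple b (ask i) 0 1 1 (fun y => y = b i) := by
    have h2 : ((⟨1, 0, 1⟩ : Cost) + 0).Within 1 1 := ⟨by simp, by simp⟩
    simp [Triple, ask, expect, h2]
  exact (this.bind (f := f) fun y hy => by subst hy; exact h).mono (by simp) (by linarith)
    (by linarith) fun _ h => h
/-- The loop rule: `I l s` is an invariant relating the state `s` to the list `l` of the elements
that have been processed. -/
theorem Triple.forEach {f : σ → β → Prog n σ} (I : List β → σ → Prop) (φ : β → ℝ≥0∞)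
    (t k : β → ℝ) (l : List β) (s : σ) (h0 : I [] s)
    (h : ∀ (p : List β) (a : β) (r : List β) (s : σ), l = p ++ a :: r → I p s →
      Triple b (f s a) (φ a) (t a) (k a) (fun s' => I (p ++ [a]) s')) :
    Triple b (forEach l s f) (l.map φ).sum (l.map fun a => 1 + t a).sum (l.map k).sum
      (fun s' => I l s') := by
  suffices H : ∀ (r p : List β) (s : σ), l = p ++ r → I p s →
      Triple b (Prog.forEach r s f) (r.map φ).sum (r.map fun a => 1 + t a).sum (r.map k).sum
        (fun s' => I l s') from H l [] s rfl h0
  intro r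
  induction r with
  | nil =>
    intro p s hl hI
    simp only [List.append_nil] at hl
    subst hl
    exact Triple.pure (by simp) (by simp) hI
  | cons a r ih =>
    intro p s hl hI
    simp only [Prog.forEach, List.map_cons, List.sum_cons]
    refine Triple.step_bind ?_
    refine ((h p a r s hl hI).bind (fun s' hs' => ih (p ++ [a]) s' (by simp [hl]) hs')).mono
      le_rfl (by push_cast; linarith) le_rfl fun _ h => h
/-- The loop rule for loops that cannot fail and make no queries. -/
theorem Triple.forEach_sure {f : σ → β → Prog n σ} (I : List β → σ → Prop)
    (t : β → ℝ) (l : List β) (s : σ) (h0 : I [] s)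
    (h : ∀ (p : List β) (a : β) (r : List β) (s : σ), l = p ++ a :: r → I p s →
      Triple b (f s a) 0 (t a) 0 (fun s' => I (p ++ [a]) s')) :
    Triple b (Prog.forEach l s f) 0 (l.map fun a => 1 + t a).sum 0 (fun s' => I l s') := by
  have := Triple.forEach I (fun _ => 0) t (fun _ => 0) l s h0 h
  simpa using this
theorem ev_forEach_nil (s : σ) (f : σ → β → Prog n σ) (g : σ → ℝ≥0∞) :
    ev b (forEach [] s f) g = g s := rfl
theorem ev_forEach_cons (a : β) (l : List β) (s : σ) (f : σ → β → Prog n σ) (g : σ → ℝ≥0∞) :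
    ev b (forEach (a :: l) s f) g = ev b (f s a) fun s' => ev b (forEach l s' f) g := by
  simp [Prog.forEach]
/-- A potential function that contracts in expectation contracts geometrically along a loop; `I` is
an invariant of the loop. -/
theorem ev_forEach_le (I : σ → Prop) (x : β → ℝ≥0∞) (g : σ → ℝ≥0∞) (f : σ → β → Prog n σ)
    (l : List β) (hI : ∀ s, I s → ∀ a ∈ l, failProb b (f s a) I ≤ 0)
    (h : ∀ s, I s → ∀ a ∈ l, ev b (f s a) g ≤ x a * g s) (s : σ) (hs : I s) :
    ev b (forEach l s f) g ≤ (l.map x).prod * g s := by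
  induction l generalizing s with
  | nil => simp [ev_forEach_nil]
  | cons a l ih =>
    rw [ev_forEach_cons]
    refine (ev_mono_of_failProb (hI s hs a List.mem_cons_self) fun s' hs' =>
      ih (fun s hs a ha => hI s hs a (List.mem_cons_of_mem _ ha))
        (fun s hs a ha => h s hs a (List.mem_cons_of_mem _ ha)) s' hs').trans ?_
    rw [ev_const_mul, List.map_cons, List.prod_cons, mul_comm (x a), mul_assoc]
    exact mul_le_mul_right (h s hs a List.mem_cons_self) _
end Prog

/-! ### The loss and its weighted sums -/
/-- The loss of a real number, `M(|t|)`. -/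
noncomputable def loss (M : ℝ≥0 → ℝ≥0) (t : ℝ) : ℝ := M (Real.nnabs t)
/-- The weighted sum `∑ᵢ wᵢ M(|zᵢ|)`, that is, `‖z‖_{M,w} ^ p`. -/
noncomputable def energy (M : ℝ≥0 → ℝ≥0) {ι : Type} [Fintype ι] (w z : ι → ℝ) : ℝ :=
  ∑ i, w i * loss M (z i)
theorem mNorm_eq (M : ℝ≥0 → ℝ≥0) (p : ℝ) {ι : Type} [Fintype ι] (w z : ι → ℝ) :
    mNorm M p w z = energy M w z ^ (1 / p) := rfl
theorem loss_nonneg (M : ℝ≥0 → ℝ≥0) (t : ℝ) : 0 ≤ loss M t := NNReal.coe_nonneg _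
@[simp] theorem loss_neg (M : ℝ≥0 → ℝ≥0) (t : ℝ) : loss M (-t) = loss M t := by
  have : Real.nnabs (-t) = Real.nnabs t := by ext; simp
  rw [loss, this, loss]
theorem abs_rpow_sub_rpow_le {a a' c P : ℝ} (ha : 0 ≤ a) (ha' : 0 ≤ a') (hc : a ≤ c) (hc' : a' ≤ c)
    (hP : 1 ≤ P) : |a ^ P - a' ^ P| ≤ P * c ^ (P - 1) * |a - a'| := by
  wlog h : a' ≤ a generalizing a a'
  · rw [abs_sub_comm, abs_sub_comm a]
    exact this ha' ha hc' hc (le_of_not_ge h)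
  rw [abs_of_nonneg (sub_nonneg.2 (Real.rpow_le_rpow ha' h (by linarith))),
    abs_of_nonneg (sub_nonneg.2 h)]
  rcases ha.eq_or_lt with rfl | h0
  · obtain rfl : a' = 0 := le_antisymm h ha'
    simp
  have h1 := one_add_mul_self_le_rpow_one_add (s := a' / a - 1) (by
    have := div_nonneg ha' ha; linarith) hP
  have h2 : (1 + (a' / a - 1)) = a' / a := by ring
  rw [h2, Real.div_rpow ha' ha, le_div_iff₀ (Real.rpow_pos_of_pos h0 P)] at h1
  have h3 : a ^ P = a ^ (P - 1) * a := by
    rw [← Real.rpow_add_one h0.ne']; congr 1; ring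
  have h4 : (1 + P * (a' / a - 1)) * a ^ P = a ^ P - P * a ^ (P - 1) * (a - a') := by
    rw [h3]; field_simp; ring
  have h5 : a ^ (P - 1) ≤ c ^ (P - 1) := Real.rpow_le_rpow ha hc (by linarith)
  have h6 : P * a ^ (P - 1) * (a - a') ≤ P * c ^ (P - 1) * (a - a') :=
    mul_le_mul_of_nonneg_right (mul_le_mul_of_nonneg_left h5 (by linarith)) (by linarith)
  linarith
section
variable {M : ℝ≥0 → ℝ≥0} {p q cU cL : ℝ}
namespace IsAdmissibleLoss
variable (hM : IsAdmissibleLoss M p q cU cL)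
include hM
theorem loss_zero : loss M 0 = 0 := by simp [loss, hM.map_zero]
theorem loss_mono {s t : ℝ} (h : |s| ≤ |t|) : loss M s ≤ loss M t := by
  refine NNReal.coe_le_coe.2 (hM.monotone ?_)
  rw [← NNReal.coe_le_coe]; simpa using h
theorem loss_pos (hcL : 0 < cL) {t : ℝ} (ht : t ≠ 0) : 0 < loss M t := by
  have hx : 0 < Real.nnabs t := by
    rw [← NNReal.coe_pos]; simpa using ht
  have h := hM.below (Real.nnabs t) (2 * Real.nnabs t) hx (by
    rw [two_mul]; exact lt_add_of_pos_right _ hx)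
  refine lt_of_le_of_ne (loss_nonneg M t) fun h0 => ?_
  rw [show ((M (Real.nnabs t) : ℝ≥0) : ℝ) = 0 from h0.symm, div_zero] at h
  have h1 : (0 : ℝ) < ((2 * Real.nnabs t : ℝ≥0) : ℝ) / (Real.nnabs t : ℝ) := by
    have : (0 : ℝ) < (Real.nnabs t : ℝ) := hx
    push_cast; positivity
  exact absurd h (not_le.2 (mul_pos hcL (Real.rpow_pos_of_pos h1 q)))
/-- Shrinking the argument shrinks the loss, by the lower polynomial bound. -/
theorem loss_mul_le (hcL : 0 < cL) {η : ℝ} (h0 : 0 < η) (h1 : η < 1) (t : ℝ) :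
    loss M (η * t) ≤ η ^ q / cL * loss M t := by
  rcases eq_or_ne t 0 with rfl | ht
  · simp [hM.loss_zero]
  have hy : 0 < |t| := abs_pos.2 ht
  have hc : (Real.nnabs (η * t) : ℝ) = η * |t| := by
    rw [Real.coe_nnabs, abs_mul, abs_of_pos h0]
  have h := hM.below (Real.nnabs (η * t)) (Real.nnabs t)
    (by rw [← NNReal.coe_pos, hc]; positivity)
    (by rw [← NNReal.coe_lt_coe, hc, Real.coe_nnabs]; nlinarith)
  have hpos := hM.loss_pos hcL (mul_ne_zero h0.ne' ht)
  change cL * _ ≤ loss M t / loss M (η * t) at h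
  rw [hc, Real.coe_nnabs, show |t| / (η * |t|) = η⁻¹ by field_simp, le_div_iff₀ hpos,
    Real.inv_rpow h0.le] at h
  have h2 : 0 < η ^ q := Real.rpow_pos_of_pos h0 q
  calc loss M (η * t) = η ^ q / cL * (cL * (η ^ q)⁻¹ * loss M (η * t)) := by field_simp
    _ ≤ _ := mul_le_mul_of_nonneg_left h (by positivity)
/-- The upper polynomial bound without quotients, so that `s = 0` is allowed. -/
theorem abs_rpow_mul_loss_le (hp : 0 < p) (hcU : 1 ≤ cU) (hcL : 0 < cL) {s t : ℝ}
    (h : |s| ≤ |t|) : |s| ^ p * loss M t ≤ cU * |t| ^ p * loss M s := by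
  rcases eq_or_ne s 0 with rfl | hs
  · simp [Real.zero_rpow hp.ne', hM.loss_zero]
  have hs' : 0 < |s| := abs_pos.2 hs
  rcases h.eq_or_lt with h | h
  · have : loss M s = loss M t := le_antisymm (hM.loss_mono h.le) (hM.loss_mono h.ge)
    rw [h, this, mul_assoc]
    exact le_mul_of_one_le_left (mul_nonneg (Real.rpow_nonneg (abs_nonneg _) _)
      (loss_nonneg _ _)) hcU
  · have h1 := hM.above (Real.nnabs s) (Real.nnabs t)
      (by rw [← NNReal.coe_pos]; simpa using hs) (by rw [← NNReal.coe_lt_coe]; simpa using h)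
    change loss M t / loss M s ≤ _ at h1
    rw [div_le_iff₀ (hM.loss_pos hcL hs), Real.coe_nnabs, Real.coe_nnabs,
      Real.div_rpow (abs_nonneg _) (abs_nonneg _)] at h1
    have h2 : 0 < |s| ^ p := Real.rpow_pos_of_pos hs' p
    calc |s| ^ p * loss M t ≤ |s| ^ p * (cU * (|t| ^ p / |s| ^ p) * loss M s) :=
          mul_le_mul_of_nonneg_left h1 h2.le
      _ = _ := by field_simp
theorem loss_le_half (hp : 0 < p) (hcU : 1 ≤ cU) (hcL : 0 < cL) (t : ℝ) :
    loss M t ≤ cU * 2 ^ p * loss M (1 / 2 * t) := by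
  rcases eq_or_ne t 0 with rfl | ht
  · simp [hM.loss_zero]
  have ht' : 0 < |t| ^ p := Real.rpow_pos_of_pos (abs_pos.2 ht) p
  have h := hM.abs_rpow_mul_loss_le hp hcU hcL (s := 1 / 2 * t) (t := t) (by
    rw [abs_mul, abs_of_pos (by norm_num : (0 : ℝ) < 1 / 2)]; linarith [abs_nonneg t])
  rw [abs_mul, abs_of_pos (by norm_num : (0 : ℝ) < 1 / 2), Real.mul_rpow (by norm_num)
    (abs_nonneg _), one_div, Real.inv_rpow (by norm_num)] at h
  have h2 : (0 : ℝ) < 2 ^ p := Real.rpow_pos_of_pos (by norm_num) p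
  rw [one_div]
  refine le_of_mul_le_mul_left ?_ ht'
  calc |t| ^ p * loss M t = 2 ^ p * ((2 ^ p)⁻¹ * |t| ^ p * loss M t) := by field_simp
    _ ≤ 2 ^ p * (cU * |t| ^ p * loss M (2⁻¹ * t)) := mul_le_mul_of_nonneg_left h h2.le
    _ = _ := by ring
theorem loss_rpow_add_le (hp : 0 < p) (s t : ℝ) :
    loss M (s + t) ^ (1 / p) ≤ loss M s ^ (1 / p) + loss M t ^ (1 / p) := by
  have h1 : M (Real.nnabs (s + t)) ≤ M (Real.nnabs s + Real.nnabs t) := by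
    refine hM.monotone ?_
    rw [← NNReal.coe_le_coe]; simpa using abs_add_le s t
  have h2 := (NNReal.rpow_le_rpow h1 (one_div_pos.2 hp).le).trans (hM.subadditive _ _)
  simpa [loss] using NNReal.coe_le_coe.2 h2
theorem loss_add_le (hp : 0 < p) (s t : ℝ) :
    loss M (s + t) ≤ (loss M s ^ (1 / p) + loss M t ^ (1 / p)) ^ p := by
  have h := Real.rpow_le_rpow (by positivity [loss_nonneg M (s + t)])
    (hM.loss_rpow_add_le hp s t) hp.le
  rwa [← Real.rpow_mul (loss_nonneg _ _), one_div_mul_cancel hp.ne', Real.rpow_one] at h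
/-- With the exponent `max 1 p` instead of `p`, Minkowski's inequality is available for all `p`. -/
theorem loss_rpow_max_add_le (hp : 0 < p) (s t : ℝ) :
    loss M (s + t) ^ (1 / max 1 p) ≤ loss M s ^ (1 / max 1 p) + loss M t ^ (1 / max 1 p) := by
  rcases le_total 1 p with h | h
  · rw [max_eq_right h]; exact hM.loss_rpow_add_le hp s t
  · rw [max_eq_left h]
    simp only [div_one, Real.rpow_one]
    refine (hM.loss_add_le hp s t).trans ?_
    have h1 := Real.rpow_add_le_add_rpow (Real.rpow_nonneg (loss_nonneg M s) (1 / p))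
      (Real.rpow_nonneg (loss_nonneg M t) (1 / p)) hp.le h
    rwa [← Real.rpow_mul (loss_nonneg _ _), ← Real.rpow_mul (loss_nonneg _ _),
      one_div_mul_cancel hp.ne', Real.rpow_one, Real.rpow_one] at h1
/-- Subtracting a number of relatively small loss changes the loss by a small factor. -/
theorem abs_loss_sub_le (hp : 0 < p) {ε : ℝ} (h0 : 0 < ε) (h1 : ε ≤ 1 / 2) {s t : ℝ}
    (h : loss M s ≤ ε ^ p * loss M t) :
    |loss M (s - t) - loss M t| ≤ 2 * p * Real.exp p * ε * loss M t := by
  have hp' : 0 < 1 / p := one_div_pos.2 hp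
  set a := loss M t ^ (1 / p) with ha
  have ha0 : 0 ≤ a := Real.rpow_nonneg (loss_nonneg _ _) _
  have hap : a ^ p = loss M t := by
    rw [ha, ← Real.rpow_mul (loss_nonneg _ _), one_div_mul_cancel hp.ne', Real.rpow_one]
  have hs : loss M s ^ (1 / p) ≤ ε * a := by
    have := Real.rpow_le_rpow (loss_nonneg _ _) h hp'.le
    rwa [Real.mul_rpow (by positivity) (loss_nonneg _ _), ← Real.rpow_mul h0.le,
      mul_one_div_cancel hp.ne', Real.rpow_one] at this
  have hu : loss M (s - t) ≤ ((1 + ε) * a) ^ p := by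
    have := hM.loss_add_le hp s (-t)
    rw [loss_neg, ← sub_eq_add_neg] at this
    exact this.trans (Real.rpow_le_rpow (by positivity [Real.rpow_nonneg (loss_nonneg M s) (1 / p)])
      (by linarith) hp.le)
  have hl : ((1 - ε) * a) ^ p ≤ loss M (s - t) := by
    have h2 := hM.loss_rpow_add_le hp s (-(s - t))
    rw [loss_neg, show s + -(s - t) = t by ring] at h2
    have h3 := Real.rpow_le_rpow (z := p) (mul_nonneg (by linarith) ha0)
      (show (1 - ε) * a ≤ loss M (s - t) ^ (1 / p) by linarith) hp.le
    rwa [← Real.rpow_mul (loss_nonneg _ _), one_div_mul_cancel hp.ne', Real.rpow_one] at h3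
  rw [Real.mul_rpow (by linarith) ha0, hap] at hu hl
  have hL := loss_nonneg M t
  have e1 : (1 + ε) ^ p ≤ 1 + 2 * p * Real.exp p * ε := by
    have h2 : (1 + ε) ^ p ≤ Real.exp (p * ε) := by
      rw [mul_comm p, Real.exp_mul]
      exact Real.rpow_le_rpow (by linarith) (by linarith [Real.add_one_le_exp ε]) hp.le
    have h3 : 1 - p * ε ≤ Real.exp (-(p * ε)) := Real.one_sub_le_exp_neg _
    have h4 : Real.exp (-(p * ε)) * Real.exp (p * ε) = 1 := by rw [← Real.exp_add]; simp
    have h5 : Real.exp (p * ε) ≤ Real.exp p := Real.exp_le_exp.2 (by nlinarith)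
    have h6 : Real.exp (p * ε) ≤ 1 + p * ε * Real.exp (p * ε) := by
      nlinarith [Real.exp_pos (p * ε)]
    have h7 : p * ε * Real.exp (p * ε) ≤ p * ε * Real.exp p :=
      mul_le_mul_of_nonneg_left h5 (by positivity)
    have : 0 ≤ p * ε * Real.exp p := by positivity
    nlinarith
  have e2 : 1 - 2 * p * Real.exp p * ε ≤ (1 - ε) ^ p := by
    have h2 : Real.exp (-(2 * ε)) ≤ 1 - ε := by
      have h3 : 1 ≤ (1 - ε) * Real.exp (2 * ε) := by
        have := Real.add_one_le_exp (2 * ε)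
        nlinarith
      have h4 : Real.exp (-(2 * ε)) * Real.exp (2 * ε) = 1 := by rw [← Real.exp_add]; simp
      exact le_of_mul_le_mul_right (by linarith) (Real.exp_pos (2 * ε))
    have h3 : Real.exp (-(2 * ε) * p) ≤ (1 - ε) ^ p := by
      rw [Real.exp_mul]
      exact Real.rpow_le_rpow (Real.exp_pos _).le h2 hp.le
    have h4 := Real.add_one_le_exp (-(2 * ε) * p)
    have h5 : 1 ≤ Real.exp p := Real.one_le_exp hp.le
    have : 2 * p * ε * 1 ≤ 2 * p * ε * Real.exp p := mul_le_mul_of_nonneg_left h5 (by positivity)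
    nlinarith
  have e1' := mul_le_mul_of_nonneg_right e1 hL
  have e2' := mul_le_mul_of_nonneg_right e2 hL
  rw [abs_le]
  constructor <;> nlinarith
end IsAdmissibleLoss
section energy
variable {ι : Type} [Fintype ι] {w : ι → ℝ}
theorem energy_nonneg (hw : ∀ i, 0 ≤ w i) (z : ι → ℝ) : 0 ≤ energy M w z :=
  Finset.sum_nonneg fun i _ => mul_nonneg (hw i) (loss_nonneg _ _)
theorem energy_neg (z : ι → ℝ) : energy M w (-z) = energy M w z := by simp [energy]
theorem energy_sub_comm (y z : ι → ℝ) : energy M w (y - z) = energy M w (z - y) := by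
  rw [← energy_neg, neg_sub]
theorem energy_mono_weights {w' : ι → ℝ} (h : ∀ i, w i ≤ w' i) (z : ι → ℝ) :
    energy M w z ≤ energy M w' z :=
  Finset.sum_le_sum fun i _ => mul_le_mul_of_nonneg_right (h i) (loss_nonneg _ _)
theorem mul_loss_le_energy (hw : ∀ i, 0 ≤ w i) (z : ι → ℝ) (i : ι) :
    w i * loss M (z i) ≤ energy M w z :=
  Finset.single_le_sum (f := fun i => w i * loss M (z i))
    (fun i _ => mul_nonneg (hw i) (loss_nonneg _ _)) (Finset.mem_univ i)
namespace IsAdmissibleLoss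
variable (hM : IsAdmissibleLoss M p q cU cL)
include hM
theorem energy_zero : energy M w 0 = 0 := by simp [energy, hM.loss_zero]
theorem energy_mono (hw : ∀ i, 0 ≤ w i) {y z : ι → ℝ} (h : ∀ i, |y i| ≤ |z i|) :
    energy M w y ≤ energy M w z :=
  Finset.sum_le_sum fun i _ => mul_le_mul_of_nonneg_left (hM.loss_mono (h i)) (hw i)
theorem energy_smul_le (hw : ∀ i, 0 ≤ w i) (hcL : 0 < cL) {η : ℝ} (h0 : 0 < η) (h1 : η < 1)
    (z : ι → ℝ) : energy M w (η • z) ≤ η ^ q / cL * energy M w z := by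
  rw [energy, energy, Finset.mul_sum]
  refine Finset.sum_le_sum fun i _ => ?_
  rw [mul_left_comm]
  exact mul_le_mul_of_nonneg_left (hM.loss_mul_le hcL h0 h1 _) (hw i)
theorem energy_le_half (hw : ∀ i, 0 ≤ w i) (hp : 0 < p) (hcU : 1 ≤ cU) (hcL : 0 < cL)
    (z : ι → ℝ) : energy M w z ≤ cU * 2 ^ p * energy M w ((1 / 2 : ℝ) • z) := by
  rw [energy, energy, Finset.mul_sum]
  refine Finset.sum_le_sum fun i _ => ?_
  rw [mul_left_comm]
  exact mul_le_mul_of_nonneg_left (hM.loss_le_half hp hcU hcL _) (hw i)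
theorem energy_rpow_add_le (hw : ∀ i, 0 ≤ w i) (hp : 0 < p) (y z : ι → ℝ) :
    energy M w (y + z) ^ (1 / max 1 p) ≤
      energy M w y ^ (1 / max 1 p) + energy M w z ^ (1 / max 1 p) := by
  set P := max 1 p with hP
  have hP1 : 1 ≤ P := le_max_left _ _
  have hP0 : 0 < P := by linarith
  have key : ∀ (v : ι → ℝ) i, (w i ^ (1 / P) * loss M (v i) ^ (1 / P)) ^ P = w i * loss M (v i) := by
    intro v i
    rw [← Real.mul_rpow (hw i) (loss_nonneg _ _), ← Real.rpow_mul (mul_nonneg (hw i)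
      (loss_nonneg _ _)), one_div_mul_cancel hP0.ne', Real.rpow_one]
  have hnn : ∀ (v : ι → ℝ) i, 0 ≤ w i ^ (1 / P) * loss M (v i) ^ (1 / P) := fun v i =>
    mul_nonneg (Real.rpow_nonneg (hw i) _) (Real.rpow_nonneg (loss_nonneg _ _) _)
  have h := Real.Lp_add_le_of_nonneg Finset.univ hP1 (f := fun i => w i ^ (1 / P) *
    loss M (y i) ^ (1 / P)) (g := fun i => w i ^ (1 / P) * loss M (z i) ^ (1 / P))
    (fun i _ => hnn y i) (fun i _ => hnn z i)
  simp only [key] at h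
  refine le_trans (Real.rpow_le_rpow (energy_nonneg hw _) (Finset.sum_le_sum fun i _ => ?_)
    (by positivity)) h
  rw [← key, ← mul_add]
  refine Real.rpow_le_rpow (hnn _ i) ?_ hP0.le
  exact mul_le_mul_of_nonneg_left (hM.loss_rpow_max_add_le hp _ _) (Real.rpow_nonneg (hw i) _)
theorem energy_add_le (hw : ∀ i, 0 ≤ w i) (hp : 0 < p) (y z : ι → ℝ) {x : ℝ}
    (hy : energy M w y ≤ x) (hz : energy M w z ≤ x) :
    energy M w (y + z) ≤ 2 ^ max 1 p * x := by
  set P := max 1 p with hP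
  have hP1 : 1 ≤ P := le_max_left _ _
  have hP0 : 0 < P := by linarith
  have hx : 0 ≤ x := (energy_nonneg hw y).trans hy
  have h := hM.energy_rpow_add_le hw hp y z
  rw [← hP] at h
  have h1 := Real.rpow_le_rpow (energy_nonneg hw _) hy (one_div_pos.2 hP0).le
  have h2 := Real.rpow_le_rpow (energy_nonneg hw _) hz (one_div_pos.2 hP0).le
  have h3 := Real.rpow_le_rpow (Real.rpow_nonneg (energy_nonneg hw _) _)
    (show energy M w (y + z) ^ (1 / P) ≤ 2 * x ^ (1 / P) by linarith) hP0.le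
  rwa [← Real.rpow_mul (energy_nonneg hw _), one_div_mul_cancel hP0.ne', Real.rpow_one,
    Real.mul_rpow (by norm_num) (by positivity), ← Real.rpow_mul hx, one_div_mul_cancel hP0.ne',
    Real.rpow_one] at h3
theorem energy_sub_le (hw : ∀ i, 0 ≤ w i) (hp : 0 < p) (y z : ι → ℝ) {x : ℝ}
    (hy : energy M w y ≤ x) (hz : energy M w z ≤ x) :
    energy M w (y - z) ≤ 2 ^ max 1 p * x := by
  rw [sub_eq_add_neg]
  exact hM.energy_add_le hw hp y (-z) hy (by rwa [energy_neg])
/-- Quantitative continuity of the energy. -/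
theorem abs_energy_sub_le (hw : ∀ i, 0 ≤ w i) (hp : 0 < p) (y z : ι → ℝ) {x e : ℝ}
    (hy : energy M w y ≤ x) (hz : energy M w z ≤ x) (h : energy M w (y - z) ≤ e ^ max 1 p * x)
    (he : 0 ≤ e) : |energy M w y - energy M w z| ≤ max 1 p * e * x := by
  set P := max 1 p with hP
  have hP1 : 1 ≤ P := le_max_left _ _
  have hP0 : 0 < P := by linarith
  have hx : 0 ≤ x := (energy_nonneg hw y).trans hy
  have hr : ∀ v, (energy M w v ^ (1 / P)) ^ P = energy M w v := fun v => by
    rw [← Real.rpow_mul (energy_nonneg hw _), one_div_mul_cancel hP0.ne', Real.rpow_one]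
  have h0 : ∀ v, 0 ≤ energy M w v ^ (1 / P) := fun v => Real.rpow_nonneg (energy_nonneg hw _) _
  have h1 := Real.rpow_le_rpow (energy_nonneg hw _) hy (one_div_pos.2 hP0).le
  have h2 := Real.rpow_le_rpow (energy_nonneg hw _) hz (one_div_pos.2 hP0).le
  have h3 := Real.rpow_le_rpow (energy_nonneg hw _) h (one_div_pos.2 hP0).le
  rw [Real.mul_rpow (by positivity) hx, ← Real.rpow_mul he, mul_one_div_cancel hP0.ne',
    Real.rpow_one] at h3
  have h4 : |energy M w y ^ (1 / P) - energy M w z ^ (1 / P)| ≤ e * x ^ (1 / P) := by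
    have t1 := hM.energy_rpow_add_le hw hp (y - z) z
    have t2 := hM.energy_rpow_add_le hw hp (z - y) y
    rw [energy_sub_comm z y] at t2
    rw [sub_add_cancel, ← hP] at t1 t2
    rw [abs_le]; constructor <;> linarith
  have h5 := abs_rpow_sub_rpow_le (h0 y) (h0 z) h1 h2 hP1
  rw [hr, hr] at h5
  refine h5.trans ((mul_le_mul_of_nonneg_left h4 (by positivity)).trans_eq ?_)
  have h6 : (x ^ (1 / P)) ^ (P - 1) * x ^ (1 / P) = x := by
    rcases hx.eq_or_lt with rfl | hx
    · rw [Real.zero_rpow (by positivity), mul_zero]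
    · rw [← Real.rpow_add_one (by positivity), sub_add_cancel, ← Real.rpow_mul hx.le,
        one_div_mul_cancel hP0.ne', Real.rpow_one]
  calc _ = P * e * ((x ^ (1 / P)) ^ (P - 1) * x ^ (1 / P)) := by ring
    _ = _ := by rw [h6]
end IsAdmissibleLoss
end energy
end

/-! ### Nets of energy balls -/
section packing
variable {E : Type*} [NormedAddCommGroup E] [NormedSpace ℝ E] [FiniteDimensional ℝ E]
  [MeasurableSpace E] [BorelSpace E]
open MeasureTheory in
open scoped Pointwise in
/-- Volume bound for separated subsets of a symmetric star-shaped body `B` with `B - B ⊆ σ B`;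
convexity of `B` is not needed. -/
theorem card_le_of_separated {B : Set E} (hmeas : MeasurableSet B) (hnhds : B ∈ nhds (0 : E))
    (hbdd : Bornology.IsBounded B) {σ η : ℝ} (hσ : 1 ≤ σ) (hη0 : 0 < η) (hη1 : η ≤ 1)
    (hneg : ∀ y ∈ B, -y ∈ B) (hstar : ∀ t : ℝ, 0 < t → t ≤ 1 → ∀ y ∈ B, t • y ∈ B)
    (hsub : ∀ y ∈ B, ∀ z ∈ B, σ⁻¹ • (y - z) ∈ B) {d : ℕ} (hd : Module.finrank ℝ E ≤ d)
    (N : Finset E) (hN : ∀ y ∈ N, y ∈ B)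
    (hsep : ∀ y ∈ N, ∀ z ∈ N, y ≠ z → η⁻¹ • (y - z) ∉ B) :
    (N.card : ℝ) ≤ (σ ^ 2 / η) ^ d := by
  have hσ0 : 0 < σ := by linarith
  set k := Module.finrank ℝ E with hk
  set μ : Measure E := Measure.addHaar with hμ
  have hpos : μ B ≠ 0 := (Measure.measure_pos_of_mem_nhds μ hnhds).ne'
  have hfin : μ B ≠ ⊤ := hbdd.measure_lt_top.ne
  have hr : 0 < η / σ := div_pos hη0 hσ0
  have hr1 : η / σ ≤ 1 := (div_le_one hσ0).2 (by linarith)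
  have hdisj : Set.PairwiseDisjoint (N : Set E) fun y => y +ᵥ ((η / σ) • B) := by
    intro y hy z hz hyz
    refine Set.disjoint_left.2 ?_
    rintro x ⟨_, ⟨u, hu, rfl⟩, rfl⟩ ⟨_, ⟨v, hv, rfl⟩, hx⟩
    refine hsep y hy z hz hyz ?_
    have h1 : y - z = (η / σ) • (v - u) := by
      have : z + (η / σ) • v = y + (η / σ) • u := hx
      rw [smul_sub, sub_eq_sub_iff_add_eq_add, add_comm ((η / σ) • v), this]
    have h2 : η⁻¹ • (y - z) = σ⁻¹ • (v - u) := by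
      rw [h1, smul_smul]; congr 1; field_simp
    rw [h2]
    exact hsub v hv u hu
  have hmeas' : ∀ y ∈ N, MeasurableSet (y +ᵥ ((η / σ) • B)) := fun y _ =>
    (hmeas.const_smul₀ _).const_vadd y
  have hU : (⋃ y ∈ N, y +ᵥ ((η / σ) • B)) ⊆ σ • B := by
    refine Set.iUnion₂_subset fun y hy => ?_
    rintro x ⟨_, ⟨u, hu, rfl⟩, rfl⟩
    refine ⟨σ⁻¹ • (y - (-((η / σ) • u))), hsub _ (hN y hy) _ (hneg _ (hstar _ hr hr1 u hu)), ?_⟩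
    simp [smul_smul, hσ0.ne']
  have h1 := measure_mono (μ := μ) hU
  rw [measure_biUnion_finset hdisj hmeas'] at h1
  simp only [measure_vadd, Measure.addHaar_smul, Finset.sum_const, nsmul_eq_mul] at h1
  rw [← mul_assoc, ENNReal.mul_le_mul_iff_left hpos hfin, abs_of_pos (pow_pos hr _),
    abs_of_pos (pow_pos hσ0 _), ← ENNReal.ofReal_natCast, ← ENNReal.ofReal_mul (by positivity),
    ENNReal.ofReal_le_ofReal_iff (by positivity)] at h1
  calc (N.card : ℝ) ≤ σ ^ k / (η / σ) ^ k := by rwa [le_div_iff₀ (pow_pos hr _)]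
    _ = (σ ^ 2 / η) ^ k := by rw [← div_pow]; congr 1; field_simp
    _ ≤ _ := pow_le_pow_right₀ (by rw [le_div_iff₀ hη0]; nlinarith) hd
/-- A maximal `η`-separated subset of the body is a net. -/
theorem exists_finset_net {B : Set E} (hmeas : MeasurableSet B) (hnhds : B ∈ nhds (0 : E))
    (hbdd : Bornology.IsBounded B) {σ η : ℝ} (hσ : 1 ≤ σ) (hη0 : 0 < η) (hη1 : η ≤ 1)
    (hneg : ∀ y ∈ B, -y ∈ B) (hstar : ∀ t : ℝ, 0 < t → t ≤ 1 → ∀ y ∈ B, t • y ∈ B)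
    (hsub : ∀ y ∈ B, ∀ z ∈ B, σ⁻¹ • (y - z) ∈ B) {d : ℕ} (hd : Module.finrank ℝ E ≤ d) :
    ∃ N : Finset E, (∀ y ∈ N, y ∈ B) ∧ (N.card : ℝ) ≤ (σ ^ 2 / η) ^ d ∧
      ∀ y ∈ B, ∃ z ∈ N, η⁻¹ • (y - z) ∈ B := by
  classical
  have hcard := card_le_of_separated hmeas hnhds hbdd hσ hη0 hη1 hneg hstar hsub hd
  by_contra! H
  -- otherwise separated sets could be extended forever
  have key : ∀ k : ℕ, ∃ N : Finset E, N.card = k ∧ (∀ y ∈ N, y ∈ B) ∧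
      ∀ y ∈ N, ∀ z ∈ N, y ≠ z → η⁻¹ • (y - z) ∉ B := by
    intro k
    induction k with
    | zero => exact ⟨∅, by simp⟩
    | succ k ih =>
      obtain ⟨N, hk, hN, hsep⟩ := ih
      obtain ⟨y, hy, hfar⟩ := H N hN (hcard N hN hsep)
      have hyN : y ∉ N := fun h => hfar y h (by simpa using mem_of_mem_nhds hnhds)
      refine ⟨insert y N, by rw [Finset.card_insert_of_notMem hyN, hk], ?_, ?_⟩
      · simpa [hy] using hN
      · intro u hu v hv huv
        rw [Finset.mem_insert] at hu hv
        rcases hu with rfl | hu <;> rcases hv with rfl | hv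
        · exact absurd rfl huv
        · exact hfar v hv
        · intro h
          refine hfar u hu ?_
          have := hneg _ h
          rwa [← smul_neg, neg_sub] at this
        · exact hsep u hu v hv huv
  obtain ⟨k, hk⟩ := exists_nat_gt ((σ ^ 2 / η) ^ d)
  obtain ⟨N, hNk, hN, hsep⟩ := key k
  have := hcard N hN hsep
  rw [hNk] at this
  linarith
end packing
section
variable {M : ℝ≥0 → ℝ≥0} {p q cU cL : ℝ}
namespace IsAdmissibleLoss
variable (hM : IsAdmissibleLoss M p q cU cL)
include hM
theorem measurable_loss : Measurable (loss M) := by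
  have h : Measurable (Real.nnabs : ℝ → ℝ≥0) := by
    have : (Real.nnabs : ℝ → ℝ≥0) = fun t => ‖t‖₊ := by ext; simp
    rw [this]; exact measurable_nnnorm
  exact measurable_subtype_coe.comp (hM.monotone.measurable.comp h)
theorem exists_abs_le_of_loss_le (hq : 0 < q) (hcL : 0 < cL) (x : ℝ) :
    ∃ R, 0 ≤ R ∧ ∀ t, loss M t ≤ x → |t| ≤ R := by
  have h1 := hM.loss_pos hcL one_ne_zero
  refine ⟨max 1 ((x / (cL * loss M 1)) ^ (1 / q)), by positivity, fun t ht => ?_⟩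
  by_contra! hlt
  rw [max_lt_iff] at hlt
  have ht0 : 0 < |t| := by linarith
  have h2 := hM.loss_mul_le hcL (η := |t|⁻¹) (by positivity) (inv_lt_one_of_one_lt₀ hlt.1) t
  have h3 : loss M (|t|⁻¹ * t) = loss M 1 := by
    refine le_antisymm (hM.loss_mono ?_) (hM.loss_mono ?_) <;>
      rw [abs_mul, abs_inv, abs_abs, inv_mul_cancel₀ ht0.ne', abs_one]
  rw [h3, Real.inv_rpow ht0.le] at h2
  have h4 : 0 < |t| ^ q := Real.rpow_pos_of_pos ht0 q
  have h5 : |t| ^ q ≤ x / (cL * loss M 1) := by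
    rw [le_div_iff₀ (by positivity)]
    calc |t| ^ q * (cL * loss M 1) ≤ |t| ^ q * (cL * ((|t| ^ q)⁻¹ / cL * loss M t)) := by gcongr
      _ = loss M t := by field_simp
      _ ≤ x := ht
  have h6 := Real.rpow_le_rpow h4.le h5 (one_div_pos.2 hq).le
  rw [← Real.rpow_mul ht0.le, mul_one_div_cancel hq.ne', Real.rpow_one] at h6
  linarith [hlt.2]
theorem exists_loss_le_of_abs_le (hq : 0 < q) (hcL : 0 < cL) {x : ℝ} (hx : 0 < x) :
    ∃ r, 0 < r ∧ ∀ t, |t| ≤ r → loss M t ≤ x := by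
  have h1 := hM.loss_pos hcL one_ne_zero
  set u := (x * cL / loss M 1) ^ (1 / q) with hu
  have hu0 : 0 < u := by positivity
  refine ⟨min u (1 / 2), by positivity, fun t ht => ?_⟩
  have h0 : 0 < min u (1 / 2) := by positivity
  have h2 := hM.loss_mul_le hcL h0 ((min_le_right _ _).trans_lt (by norm_num)) 1
  have h3 : min u (1 / 2) ^ q ≤ x * cL / loss M 1 := by
    refine (Real.rpow_le_rpow h0.le (min_le_left _ _) hq.le).trans_eq ?_
    rw [hu, ← Real.rpow_mul (by positivity), one_div_mul_cancel hq.ne', Real.rpow_one]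
  calc loss M t ≤ loss M (min u (1 / 2) * 1) :=
        hM.loss_mono (by rwa [mul_one, abs_of_pos h0])
    _ ≤ _ := h2
    _ ≤ (x * cL / loss M 1) / cL * loss M 1 := by gcongr
    _ = x := by field_simp
/-- Energy balls in a subspace of dimension at most `d` have nets of size exponential in `d`. The
net is fine with respect to scaling, so that it works for all weights at once that have bounded
energy on the ball. -/
theorem exists_energy_net (hp : 0 < p) (hq : 0 < q) (hcL : 0 < cL) {ι : Type} [Fintype ι]
    {w : ι → ℝ} (hw : ∀ i, 0 ≤ w i) (V : Submodule ℝ (ι → ℝ)) {d : ℕ}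
    (hd : Module.finrank ℝ V ≤ d) {ρ : ℝ} (hρ : 0 < ρ) {σ η : ℝ} (hσ1 : 1 < σ)
    (hσ : 2 ^ max 1 p ≤ cL * σ ^ q) (hη0 : 0 < η) (hη1 : η ≤ 1) :
    ∃ N : Finset (ι → ℝ), (∀ y ∈ N, y ∈ V ∧ energy M w y ≤ ρ) ∧
      (N.card : ℝ) ≤ (σ ^ 2 / η) ^ d ∧
      ∀ y ∈ V, energy M w y ≤ ρ → ∃ z ∈ N, energy M w (η⁻¹ • (y - z)) ≤ ρ := by
  classical
  -- coordinates of weight zero are erased, which makes the energy ball bounded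
  let mask : (ι → ℝ) →ₗ[ℝ] (ι → ℝ) :=
    LinearMap.pi fun i => (if w i = 0 then (0 : ℝ) else 1) • LinearMap.proj i
  have hmask : ∀ y i, mask y i = if w i = 0 then 0 else y i := by
    intro y i
    simp only [mask, LinearMap.pi_apply, LinearMap.smul_apply, LinearMap.proj_apply]
    split_ifs <;> simp
  have hemask : ∀ y, energy M w (mask y) = energy M w y := by
    intro y
    refine Finset.sum_congr rfl fun i _ => ?_
    rw [hmask]; split_ifs with h <;> simp [h]
  let W : Submodule ℝ (ι → ℝ) := V.map mask
  have hW0 : ∀ y ∈ W, ∀ i, w i = 0 → y i = 0 := by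
    rintro _ ⟨v, -, rfl⟩ i hi
    rw [hmask, if_pos hi]
  have hWd : Module.finrank ℝ W ≤ d := (Submodule.finrank_map_le mask V).trans hd
  let B : Set W := {y | energy M w (y : ι → ℝ) ≤ ρ}
  have hmeas : MeasurableSet B := by
    refine measurableSet_le ?_ measurable_const
    refine Finset.measurable_sum _ fun i _ => ?_
    exact (hM.measurable_loss.comp ((measurable_pi_apply i).comp measurable_subtype_coe)).const_mul _
  have hwsum : 0 ≤ ∑ i, w i := Finset.sum_nonneg fun i _ => hw i
  have hnhds : B ∈ nhds (0 : W) := by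
    obtain ⟨r, hr0, hr⟩ := hM.exists_loss_le_of_abs_le hq hcL
      (show 0 < ρ / (∑ i, w i + 1) by positivity)
    refine Metric.mem_nhds_iff.2 ⟨r, hr0, fun y hy => ?_⟩
    rw [mem_ball_zero_iff] at hy
    have hy' : ∀ i, |(y : ι → ℝ) i| ≤ r := fun i =>
      (norm_le_pi_norm (y : ι → ℝ) i).trans hy.le
    calc energy M w (y : ι → ℝ) ≤ ∑ i, w i * (ρ / (∑ i, w i + 1)) :=
          Finset.sum_le_sum fun i _ => mul_le_mul_of_nonneg_left (hr _ (hy' i)) (hw i)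
      _ = ρ * (∑ i, w i) / (∑ i, w i + 1) := by rw [← Finset.sum_mul]; ring
      _ ≤ ρ := by rw [div_le_iff₀ (by positivity)]; nlinarith
  have hbdd : Bornology.IsBounded B := by
    choose R hR0 hR using fun i : ι => hM.exists_abs_le_of_loss_le hq hcL (ρ / w i)
    refine isBounded_iff_forall_norm_le.2 ⟨∑ i, R i, fun y hy => ?_⟩
    refine (pi_norm_le_iff_of_nonneg (Finset.sum_nonneg fun i _ => hR0 i)).2 fun i => ?_
    refine le_trans ?_ (Finset.single_le_sum (fun i _ => hR0 i) (Finset.mem_univ i))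
    change |(y : ι → ℝ) i| ≤ R i
    rcases (hw i).eq_or_lt with h | h
    · rw [hW0 _ y.2 i h.symm, abs_zero]; exact hR0 i
    · refine hR i _ ((le_div_iff₀' h).2 ?_)
      exact (mul_loss_le_energy hw _ i).trans hy
  have hneg : ∀ y ∈ B, -y ∈ B := fun y hy => by
    change energy M w (-(y : ι → ℝ)) ≤ ρ
    rw [energy_neg]; exact hy
  have hstar : ∀ t : ℝ, 0 < t → t ≤ 1 → ∀ y ∈ B, t • y ∈ B := fun t h0 h1 y hy => by
    refine (hM.energy_mono hw fun i => ?_).trans hy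
    change |t * (y : ι → ℝ) i| ≤ _
    rw [abs_mul, abs_of_pos h0]
    exact mul_le_of_le_one_left (abs_nonneg _) h1
  have hσ0 : 0 < σ := by linarith
  have hsub : ∀ y ∈ B, ∀ z ∈ B, σ⁻¹ • (y - z) ∈ B := fun y hy z hz => by
    change energy M w (σ⁻¹ • ((y : ι → ℝ) - z)) ≤ ρ
    have h1 := hM.energy_sub_le hw hp (y : ι → ℝ) z hy hz
    have h2 : 0 < σ ^ q := Real.rpow_pos_of_pos hσ0 q
    refine (hM.energy_smul_le hw hcL (by positivity) (inv_lt_one_of_one_lt₀ hσ1) _).trans ?_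
    rw [Real.inv_rpow hσ0.le]
    calc (σ ^ q)⁻¹ / cL * energy M w (↑y - ↑z) ≤ (σ ^ q)⁻¹ / cL * (2 ^ max 1 p * ρ) := by gcongr
      _ ≤ (σ ^ q)⁻¹ / cL * (cL * σ ^ q * ρ) := by gcongr
      _ = ρ := by field_simp
  obtain ⟨N, hNB, hNc, hN⟩ := exists_finset_net hmeas hnhds hbdd hσ1.le hη0 hη1 hneg hstar hsub hWd
  have hlift : ∀ y : W, ∃ v ∈ V, mask v = y := fun y => y.2
  choose lift hliftV hlift using hlift
  refine ⟨N.image lift, ?_, ?_, ?_⟩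
  · intro v hv
    obtain ⟨y, hy, rfl⟩ := Finset.mem_image.1 hv
    refine ⟨hliftV y, ?_⟩
    rw [← hemask, hlift]
    exact hNB y hy
  · exact (Nat.cast_le.2 Finset.card_image_le).trans hNc
  · intro y hyV hy
    obtain ⟨z, hz, h⟩ := hN ⟨mask y, y, hyV, rfl⟩ (by change energy M w (mask y) ≤ ρ; rwa [hemask])
    refine ⟨lift z, Finset.mem_image_of_mem _ hz, ?_⟩
    rw [← hemask, map_smul, map_sub, hlift]
    exact h
end IsAdmissibleLoss
end

/-! ### Lewis weights bound the sensitivities -/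
theorem lpSensitivity_bddAbove {p : ℝ} {m d : ℕ} (B : Matrix (Fin m) (Fin d) ℝ) (i : Fin m) :
    BddAbove (Set.range fun x : Fin d → ℝ => |(B.mulVec x) i| ^ p / ∑ j, |(B.mulVec x) j| ^ p) := by
  refine ⟨1, ?_⟩
  rintro _ ⟨x, rfl⟩
  refine div_le_one_of_le₀ ?_ (Finset.sum_nonneg fun j _ => Real.rpow_nonneg (abs_nonneg _) _)
  exact Finset.single_le_sum (f := fun j => |(B.mulVec x) j| ^ p)
    (fun j _ => Real.rpow_nonneg (abs_nonneg _) _) (Finset.mem_univ i)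
theorem sq_le_lpSensitivity_two_mul {m d : ℕ} (B : Matrix (Fin m) (Fin d) ℝ) (i : Fin m)
    (x : Fin d → ℝ) :
    (B.mulVec x) i ^ 2 ≤ lpSensitivity 2 B i * ∑ j, (B.mulVec x) j ^ 2 := by
  have h := le_ciSup (lpSensitivity_bddAbove (p := 2) B i) x
  simp only [Real.rpow_two, sq_abs] at h
  have h0 : 0 ≤ ∑ j, (B.mulVec x) j ^ 2 := Finset.sum_nonneg fun j _ => sq_nonneg _
  have h1 : (B.mulVec x) i ^ 2 ≤ ∑ j, (B.mulVec x) j ^ 2 :=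
    Finset.single_le_sum (f := fun j => (B.mulVec x) j ^ 2) (fun j _ => sq_nonneg _)
      (Finset.mem_univ i)
  rcases h0.eq_or_lt with h2 | h2
  · rw [← h2] at h1 ⊢; simpa using h1
  · rw [lpSensitivity]
    simp only [Real.rpow_two, sq_abs]
    exact (div_le_iff₀ h2).1 h
/-- The leverage scores of a matrix with `d` columns sum to at most `d`. -/
theorem sum_lpSensitivity_two_le {m d : ℕ} (B : Matrix (Fin m) (Fin d) ℝ) :
    ∑ i, lpSensitivity 2 B i ≤ d := by
  let L : (Fin d → ℝ) →ₗ[ℝ] EuclideanSpace ℝ (Fin m) :=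
    (WithLp.linearEquiv 2 ℝ (Fin m → ℝ)).symm.toLinearMap ∘ₗ B.mulVecLin
  have hL : ∀ x i, L x i = (B.mulVec x) i := fun x i => rfl
  let V := LinearMap.range L
  let u := stdOrthonormalBasis ℝ V
  have hV : Module.finrank ℝ V ≤ d := by
    simpa using LinearMap.finrank_range_le L
  have hle : ∀ i, lpSensitivity 2 B i ≤ ∑ l, (u l : EuclideanSpace ℝ (Fin m)) i ^ 2 := by
    intro i
    refine ciSup_le fun x => ?_
    simp only [Real.rpow_two, sq_abs]
    have hnn : 0 ≤ ∑ l, (u l : EuclideanSpace ℝ (Fin m)) i ^ 2 :=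
      Finset.sum_nonneg fun _ _ => sq_nonneg _
    refine div_le_of_le_mul₀ (Finset.sum_nonneg fun _ _ => sq_nonneg _) hnn ?_
    let y : V := ⟨L x, x, rfl⟩
    have h1 : (B.mulVec x) i = ∑ l, u.repr y l * (u l : EuclideanSpace ℝ (Fin m)) i := by
      have := congrArg (fun z : V => (z : EuclideanSpace ℝ (Fin m)) i) (u.sum_repr y)
      simp only [Submodule.coe_sum, Submodule.coe_smul] at this
      rw [← hL, show L x i = (y : EuclideanSpace ℝ (Fin m)) i from rfl, ← this]
      simp
    have h2 : ∑ j, (B.mulVec x) j ^ 2 = ∑ l, u.repr y l ^ 2 := by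
      have e1 : ‖u.repr y‖ ^ 2 = ‖(y : EuclideanSpace ℝ (Fin m))‖ ^ 2 := by
        rw [LinearIsometryEquiv.norm_map]; rfl
      rw [EuclideanSpace.norm_sq_eq, EuclideanSpace.norm_sq_eq] at e1
      simp only [Real.norm_eq_abs, sq_abs] at e1
      exact e1.symm
    rw [h1, h2, mul_comm]
    exact Finset.sum_mul_sq_le_sq_mul_sq _ _ _
  refine (Finset.sum_le_sum fun i _ => hle i).trans ?_
  rw [Finset.sum_comm]
  have h3 : ∀ l, ∑ i, (u l : EuclideanSpace ℝ (Fin m)) i ^ 2 = 1 := by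
    intro l
    have h4 : ‖(u l : EuclideanSpace ℝ (Fin m))‖ ^ 2 = 1 := by
      have : ‖u l‖ = 1 := u.orthonormal.1 l
      rw [show ‖(u l : EuclideanSpace ℝ (Fin m))‖ = ‖u l‖ from rfl, this, one_pow]
    rw [EuclideanSpace.norm_sq_eq] at h4
    simpa [sq_abs] using h4
  simp only [h3, Finset.sum_const, Finset.card_univ, Fintype.card_fin, nsmul_eq_mul, mul_one]
  exact_mod_cast hV
/-- A weighted `ℓ_2`-to-`ℓ_∞` bound with weights of total mass at most `d` turns into an
`ℓ_p`-to-`ℓ_∞` bound: for `p ≤ 2` by interpolation, for `p > 2` by Hölder's inequality. -/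
theorem rpow_le_of_sq_le_sum {ι : Type*} [Fintype ι] {p d : ℝ} (hp : 0 < p) {w z : ι → ℝ}
    (hw : ∀ i, 0 ≤ w i) (hz : ∀ i, 0 ≤ z i) (hd : ∑ i, w i ≤ d)
    (h : ∀ i, z i ^ 2 ≤ ∑ j, w j * z j ^ 2) (i : ι) :
    z i ^ p ≤ d ^ max 0 (p / 2 - 1) * ∑ j, w j * z j ^ p := by
  set Z := ∑ j, w j * z j ^ 2 with hZ
  have hZ0 : 0 ≤ Z := Finset.sum_nonneg fun j _ => mul_nonneg (hw j) (sq_nonneg _)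
  have hsum0 : 0 ≤ ∑ j, w j * z j ^ p :=
    Finset.sum_nonneg fun j _ => mul_nonneg (hw j) (Real.rpow_nonneg (hz j) _)
  have hsq : ∀ j (s : ℝ), (z j ^ 2) ^ s = z j ^ (2 * s) := fun j s => by
    rw [← Real.rpow_two, ← Real.rpow_mul (hz j)]
  have hip : z i ^ p ≤ Z ^ (p / 2) := by
    have := Real.rpow_le_rpow (sq_nonneg _) (h i) (show 0 ≤ p / 2 by positivity)
    rwa [hsq, mul_div_cancel₀ _ (two_ne_zero)] at this
  refine hip.trans ?_
  rcases hZ0.eq_or_lt with h0 | h0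
  · rw [← h0, Real.zero_rpow (by positivity)]
    have hd0 : 0 ≤ d := (Finset.sum_nonneg fun i _ => hw i).trans hd
    positivity
  rcases le_total p 2 with h2 | h2
  · rw [max_eq_left (by linarith), Real.rpow_zero, one_mul]
    have h3 : Z ≤ Z ^ (1 - p / 2) * ∑ j, w j * z j ^ p := by
      conv_lhs => rw [hZ]
      rw [Finset.mul_sum]
      refine Finset.sum_le_sum fun j _ => ?_
      rw [mul_left_comm]
      refine mul_le_mul_of_nonneg_left ?_ (hw j)
      have h4 := Real.rpow_le_rpow (sq_nonneg _) (h j) (show 0 ≤ 1 - p / 2 by linarith)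
      rw [hsq] at h4
      calc z j ^ 2 = z j ^ (2 * (1 - p / 2)) * z j ^ p := by
            rw [← Real.rpow_add' (hz j) (by ring_nf; norm_num), ← Real.rpow_two]; congr 1; ring
        _ ≤ _ := mul_le_mul_of_nonneg_right h4 (Real.rpow_nonneg (hz j) _)
    have h5 : Z = Z ^ (1 - p / 2) * Z ^ (p / 2) := by
      rw [← Real.rpow_add h0]; simp
    exact le_of_mul_le_mul_left (by rwa [← h5]) (Real.rpow_pos_of_pos h0 (1 - p / 2))
  · rw [max_eq_right (by linarith)]
    have h3 := Real.inner_le_weight_mul_Lp_of_nonneg Finset.univ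
      (show 1 ≤ p / 2 by linarith) w (fun j => z j ^ 2) hw (fun j => sq_nonneg _)
    rw [← hZ] at h3
    simp only [hsq, mul_div_cancel₀ p (two_ne_zero' ℝ)] at h3
    have hws : 0 ≤ ∑ i, w i := Finset.sum_nonneg fun i _ => hw i
    have h4 := Real.rpow_le_rpow hZ0 h3 (show 0 ≤ p / 2 by positivity)
    rw [Real.mul_rpow (by positivity) (by positivity), ← Real.rpow_mul hws,
      ← Real.rpow_mul hsum0, inv_mul_cancel₀ (by positivity), Real.rpow_one,
      show (1 - (p / 2)⁻¹) * (p / 2) = p / 2 - 1 by field_simp] at h4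
    refine h4.trans (mul_le_mul_of_nonneg_right ?_ hsum0)
    exact Real.rpow_le_rpow hws hd (by linarith)
theorem IsLewisWeights.sum_le {p : ℝ} {m d : ℕ} {B : Matrix (Fin m) (Fin d) ℝ} {w : Fin m → ℝ}
    (h : IsLewisWeights p B w) : ∑ i, w i ≤ d := by
  rw [Finset.sum_congr rfl fun i _ => h.2.2 i]
  exact sum_lpSensitivity_two_le _
/-- Lewis weights bound the `ℓ_p` sensitivities up to the factor `d ^ max(0, p/2 - 1)`. -/
theorem IsLewisWeights.rpow_abs_le {p : ℝ} (hp : 0 < p) {m d : ℕ} {B : Matrix (Fin m) (Fin d) ℝ}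
    {w : Fin m → ℝ} (h : IsLewisWeights p B w) (x : Fin d → ℝ) (i : Fin m) :
    |(B.mulVec x) i| ^ p ≤
      (d : ℝ) ^ max 0 (p / 2 - 1) * w i * ∑ j, |(B.mulVec x) j| ^ p := by
  set y := B.mulVec x with hy
  have hw := h.1
  have hy0 : ∀ j, w j = 0 → y j = 0 := by
    intro j hj
    have hB : B j = 0 := by
      by_contra hB
      exact (h.2.1 j hB).ne' hj
    simp [hy, Matrix.mulVec, hB]
  set z : Fin m → ℝ := fun j => |y j| * w j ^ (-(1 / p)) with hz
  have hz0 : ∀ j, 0 ≤ z j := fun j => mul_nonneg (abs_nonneg _) (Real.rpow_nonneg (hw j) _)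
  have hzp : ∀ j, w j * z j ^ p = |y j| ^ p := by
    intro j
    rcases (hw j).eq_or_lt with h0 | h0
    · rw [hy0 j h0.symm, ← h0]; simp [Real.zero_rpow hp.ne']
    · rw [hz]
      simp only
      rw [Real.mul_rpow (abs_nonneg _) (by positivity), ← Real.rpow_mul h0.le,
        show -(1 / p) * p = -1 by field_simp, Real.rpow_neg_one]
      field_simp
  have hv : ∀ j, (Matrix.of fun k l => w k ^ (1 / 2 - 1 / p) * B k l).mulVec x j =
      w j ^ (1 / 2 - 1 / p) * y j := by
    intro j
    simp [hy, Matrix.mulVec, dotProduct, Finset.mul_sum, mul_assoc]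
  have hz2 : ∀ j, (w j ^ (1 / 2 - 1 / p) * y j) ^ 2 = w j * z j ^ 2 := by
    intro j
    rcases (hw j).eq_or_lt with h0 | h0
    · rw [hy0 j h0.symm, ← h0]; simp
    · have e : w j ^ (1 / 2 - 1 / p) = w j ^ (1 / 2 : ℝ) * w j ^ (-(1 / p)) := by
        rw [← Real.rpow_add h0]; congr 1
      have e2 : (w j ^ (1 / 2 : ℝ)) ^ 2 = w j := by
        rw [← Real.rpow_natCast, ← Real.rpow_mul h0.le]; norm_num
      rw [e, hz]
      simp only
      rw [mul_pow, mul_pow, mul_pow, sq_abs, e2]; ring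
  have hle : ∀ j, z j ^ 2 ≤ ∑ l, w l * z l ^ 2 := by
    intro j
    rcases (hw j).eq_or_lt with h0 | h0
    · have h1 : z j = 0 := by simp [hz, hy0 j h0.symm]
      rw [h1, zero_pow two_ne_zero]
      exact Finset.sum_nonneg fun l _ => mul_nonneg (hw l) (sq_nonneg (z l))
    · have h1 := sq_le_lpSensitivity_two_mul
        (Matrix.of fun k l => w k ^ (1 / 2 - 1 / p) * B k l) j x
      rw [← h.2.2 j] at h1
      simp only [hv, hz2] at h1
      exact le_of_mul_le_mul_left h1 h0
  have h1 := rpow_le_of_sq_le_sum hp hw hz0 h.sum_le hle i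
  simp only [hzp] at h1
  calc |y i| ^ p = w i * z i ^ p := (hzp i).symm
    _ ≤ w i * (d ^ max 0 (p / 2 - 1) * ∑ j, |y j| ^ p) := mul_le_mul_of_nonneg_left h1 (hw i)
    _ = _ := by ring

/-! ### Sensitivity sampling: laws and concentration -/
namespace Prog
variable {n : ℕ} {b : Fin n → ℝ}
/-- The probability with which a row is kept. -/
noncomputable def keepProb (m : ℝ) (s : Fin n → ℝ) (i : Fin n) : ℝ := min 1 (m * s i)
/-- One iteration of the loop of `sampleRows`. -/
noncomputable def sampleBody (m : ℝ) (w s : Fin n → ℝ) (out : List (Fin n) × (Fin n → ℝ))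
    (i : Fin n) : Prog n (List (Fin n) × (Fin n → ℝ)) := do
  let x ← prim (m * s i)
  let q ← prim (min 1 x)
  let keep ← toss q
  if keep then do
    let v ← prim (w i / q)
    step 2
    pure (i :: out.1, Function.update out.2 i v)
  else pure out
theorem sampleRows_eq (m : ℝ) (S : List (Fin n)) (w s : Fin n → ℝ) :
    sampleRows m S w s = forEach S ([], fun _ => 0) (sampleBody m w s) := rfl
theorem keepProb_le_one (m : ℝ) (s : Fin n → ℝ) (i : Fin n) : keepProb m s i ≤ 1 := min_le_left _ _
theorem keepProb_pos {m : ℝ} {s : Fin n → ℝ} {i : Fin n} (h : 0 < m * s i) : 0 < keepProb m s i :=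
  lt_min one_pos h
theorem ev_sampleBody {m : ℝ} {w s : Fin n → ℝ} (out : List (Fin n) × (Fin n → ℝ))
    {i : Fin n} (h : 0 < m * s i) (g : List (Fin n) × (Fin n → ℝ) → ℝ≥0∞) :
    ev b (sampleBody m w s out i) g =
      ENNReal.ofReal (keepProb m s i) *
        g (i :: out.1, Function.update out.2 i (w i / keepProb m s i)) +
      ENNReal.ofReal (1 - keepProb m s i) * g out := by
  simp only [sampleBody, ev_bind, ev_prim]
  change ev b (toss (keepProb m s i)) _ = _
  rw [ev_toss (keepProb_pos h).le (keepProb_le_one m s i)]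
  simp [keepProb]
/-- Structural properties of the outcome of `sampleRows`. -/
structure IsSample (m : ℝ) (S : List (Fin n)) (w s : Fin n → ℝ)
    (out : List (Fin n) × (Fin n → ℝ)) : Prop where
  nodup : out.1.Nodup
  subset : ∀ i ∈ out.1, i ∈ S
  weight : ∀ i ∈ out.1, out.2 i = w i / keepProb m s i
  weight_zero : ∀ i, i ∉ out.1 → out.2 i = 0
theorem triple_sampleRows (m : ℝ) {S : List (Fin n)} (hS : S.Nodup) (w s : Fin n → ℝ) :
    Triple b (sampleRows m S w s) 0 (7 * S.length) 0 (IsSample m S w s) := by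
  rw [sampleRows_eq]
  have := Triple.forEach_sure (b := b) (f := sampleBody m w s)
    (fun l out => IsSample m l w s out) (fun _ => 6) S ([], fun _ => 0)
    ⟨by simp, by simp, by simp, by simp⟩ ?_
  · exact this.mono le_rfl (by simp; linarith) le_rfl fun _ h => h
  · rintro l i r out rfl ⟨h1, h2, h3, h4⟩
    have hi : i ∉ out.1 := fun h => by
      have := h2 i h
      rw [List.nodup_append] at hS
      exact hS.2.2 i this i (by simp) rfl
    refine Triple.prim_bind (Triple.prim_bind (Triple.toss_bind fun keep => ?_))
    cases keep
    · refine Triple.pure (by norm_num) (by norm_num) ⟨h1, fun j hj => ?_, h3, h4⟩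
      simp [h2 j hj]
    · refine Triple.prim_bind (Triple.step_bind (Triple.pure (by norm_num) le_rfl ⟨?_, ?_, ?_, ?_⟩))
      · exact List.nodup_cons.2 ⟨hi, h1⟩
      · intro j hj
        rcases List.mem_cons.1 hj with rfl | hj
        · simp
        · simp [h2 j hj]
      · intro j hj
        rcases List.mem_cons.1 hj with rfl | hj
        · simp [keepProb]
        · simp only
          rw [Function.update_of_ne (ne_of_mem_of_not_mem hj hi), h3 j hj]
      · intro j hj
        rw [List.mem_cons, not_or] at hj
        simp only
        rw [Function.update_of_ne hj.1, h4 j hj.2]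
theorem ev_length_sampleRows_le {m : ℝ} {S : List (Fin n)} {w s : Fin n → ℝ}
    (hs : ∀ i ∈ S, 0 < m * s i) :
    ev b (sampleRows m S w s) (fun out => (out.1.length : ℝ≥0∞)) ≤
      (S.map fun i => ENNReal.ofReal (m * s i)).sum := by
  rw [sampleRows_eq]
  suffices H : ∀ out : List (Fin n) × (Fin n → ℝ),
      ev b (forEach S out (sampleBody m w s)) (fun out => (out.1.length : ℝ≥0∞)) ≤
        out.1.length + (S.map fun i => ENNReal.ofReal (m * s i)).sum by simpa using H ([], fun _ => 0)
  induction S with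
  | nil => intro out; simp [ev_forEach_nil]
  | cons i S ih =>
    intro out
    have hi := hs i List.mem_cons_self
    rw [ev_forEach_cons, ev_sampleBody out hi]
    have ih' := ih fun j hj => hs j (List.mem_cons_of_mem _ hj)
    refine (add_le_add (mul_le_mul_right (ih' _) _) (mul_le_mul_right (ih' _) _)).trans ?_
    have e : ENNReal.ofReal (keepProb m s i) + ENNReal.ofReal (1 - keepProb m s i) = 1 := by
      rw [← ENNReal.ofReal_add (keepProb_pos hi).le (by linarith [keepProb_le_one m s i])]; simp
    have e2 : ENNReal.ofReal (keepProb m s i) ≤ ENNReal.ofReal (m * s i) :=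
      ENNReal.ofReal_le_ofReal (min_le_right _ _)
    simp only [List.length_cons, List.map_cons, List.sum_cons, Nat.cast_add, Nat.cast_one]
    set x := (out.1.length : ℝ≥0∞)
    set y := (S.map fun i => ENNReal.ofReal (m * s i)).sum
    calc ENNReal.ofReal (keepProb m s i) * (x + 1 + y) + ENNReal.ofReal (1 - keepProb m s i) * (x + y)
        = ENNReal.ofReal (keepProb m s i) + (ENNReal.ofReal (keepProb m s i) +
          ENNReal.ofReal (1 - keepProb m s i)) * (x + y) := by ring
      _ ≤ ENNReal.ofReal (m * s i) + 1 * (x + y) := by rw [e]; gcongr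
      _ = _ := by ring
theorem ev_sum_sampleRows_le {m : ℝ} {S : List (Fin n)} (hS : S.Nodup) {w s a : Fin n → ℝ}
    (hs : ∀ i ∈ S, 0 < m * s i) :
    ev b (sampleRows m S w s) (fun out => ∑ i, ENNReal.ofReal (out.2 i * a i)) ≤
      (S.map fun i => ENNReal.ofReal (w i * a i)).sum := by
  rw [sampleRows_eq]
  suffices H : ∀ out : List (Fin n) × (Fin n → ℝ), (∀ i ∈ S, out.2 i = 0) →
      ev b (forEach S out (sampleBody m w s)) (fun out => ∑ i, ENNReal.ofReal (out.2 i * a i)) ≤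
        ∑ i, ENNReal.ofReal (out.2 i * a i) + (S.map fun i => ENNReal.ofReal (w i * a i)).sum by
    simpa using H ([], fun _ => 0) (by simp)
  induction S with
  | nil => intro out _; simp [ev_forEach_nil]
  | cons i S ih =>
    intro out hout
    have hi := hs i List.mem_cons_self
    have hiS : i ∉ S := (List.nodup_cons.1 hS).1
    rw [ev_forEach_cons, ev_sampleBody out hi]
    have ih' := ih (List.nodup_cons.1 hS).2 fun j hj => hs j (List.mem_cons_of_mem _ hj)
    refine (add_le_add (mul_le_mul_right (ih' _ fun j hj => ?_) _)
      (mul_le_mul_right (ih' _ fun j hj => ?_) _)).trans ?_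
    · simp only
      rw [Function.update_of_ne (by rintro rfl; exact hiS hj), hout j (List.mem_cons_of_mem _ hj)]
    · exact hout j (List.mem_cons_of_mem _ hj)
    set κ := keepProb m s i with hκ
    have hκ0 : 0 < κ := keepProb_pos hi
    have e : ENNReal.ofReal κ + ENNReal.ofReal (1 - κ) = 1 := by
      rw [← ENNReal.ofReal_add hκ0.le (by linarith [keepProb_le_one m s i])]; simp
    have hsum : ∑ j, ENNReal.ofReal (Function.update out.2 i (w i / κ) j * a j) =
        ENNReal.ofReal (w i / κ * a i) + ∑ j, ENNReal.ofReal (out.2 j * a j) := by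
      have h1 : ∀ v : Fin n → ℝ, ∑ j, ENNReal.ofReal (v j * a j) =
          ENNReal.ofReal (v i * a i) + ∑ j ∈ Finset.univ.erase i, ENNReal.ofReal (v j * a j) :=
        fun v => (Finset.add_sum_erase _ (fun j => ENNReal.ofReal (v j * a j))
          (Finset.mem_univ i)).symm
      rw [h1, h1 out.2, Function.update_self, hout i List.mem_cons_self]
      simp only [zero_mul, ENNReal.ofReal_zero, zero_add]
      congr 1
      refine Finset.sum_congr rfl fun j hj => ?_
      rw [Function.update_of_ne (Finset.ne_of_mem_erase hj)]
    simp only [List.map_cons, List.sum_cons]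
    rw [hsum]
    set x := ∑ j, ENNReal.ofReal (out.2 j * a j)
    set y := (S.map fun i => ENNReal.ofReal (w i * a i)).sum
    have e2 : ENNReal.ofReal κ * ENNReal.ofReal (w i / κ * a i) = ENNReal.ofReal (w i * a i) := by
      rw [← ENNReal.ofReal_mul hκ0.le]; congr 1; field_simp
    calc _ = ENNReal.ofReal κ * ENNReal.ofReal (w i / κ * a i) +
          (ENNReal.ofReal κ + ENNReal.ofReal (1 - κ)) * (x + y) := by ring
      _ = x + (ENNReal.ofReal (w i * a i) + y) := by rw [e, e2]; ring
      _ ≤ _ := le_rfl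
/-- Moment generating functions of weighted sums over the sample factorize over the rows. -/
theorem ev_exp_sampleRows_le {m : ℝ} {S : List (Fin n)} (hS : S.Nodup) {w s a c : Fin n → ℝ}
    (hs : ∀ i ∈ S, 0 < m * s i)
    (hc : ∀ i ∈ S, keepProb m s i * Real.exp (w i / keepProb m s i * a i) +
      (1 - keepProb m s i) ≤ Real.exp (c i)) :
    ev b (sampleRows m S w s) (fun out => ENNReal.ofReal (Real.exp (∑ i, out.2 i * a i))) ≤
      ENNReal.ofReal (Real.exp (S.map c).sum) := by
  rw [sampleRows_eq]
  suffices H : ∀ out : List (Fin n) × (Fin n → ℝ), (∀ i ∈ S, out.2 i = 0) →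
      ev b (forEach S out (sampleBody m w s))
        (fun out => ENNReal.ofReal (Real.exp (∑ i, out.2 i * a i))) ≤
        ENNReal.ofReal (Real.exp (∑ i, out.2 i * a i + (S.map c).sum)) by
    simpa using H ([], fun _ => 0) (by simp)
  induction S with
  | nil => intro out _; simp [ev_forEach_nil]
  | cons i S ih =>
    intro out hout
    have hi := hs i List.mem_cons_self
    have hiS : i ∉ S := (List.nodup_cons.1 hS).1
    rw [ev_forEach_cons, ev_sampleBody out hi]
    have ih' := ih (List.nodup_cons.1 hS).2 (fun j hj => hs j (List.mem_cons_of_mem _ hj))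
      (fun j hj => hc j (List.mem_cons_of_mem _ hj))
    refine (add_le_add (mul_le_mul_right (ih' _ fun j hj => ?_) _)
      (mul_le_mul_right (ih' _ fun j hj => ?_) _)).trans ?_
    · simp only
      rw [Function.update_of_ne (by rintro rfl; exact hiS hj), hout j (List.mem_cons_of_mem _ hj)]
    · exact hout j (List.mem_cons_of_mem _ hj)
    have hci := hc i List.mem_cons_self
    set κ := keepProb m s i with hκ
    have hκ0 : 0 < κ := keepProb_pos hi
    have hκ1 : 0 ≤ 1 - κ := by linarith [keepProb_le_one m s i]
    have hsum : ∑ j, Function.update out.2 i (w i / κ) j * a j =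
        w i / κ * a i + ∑ j, out.2 j * a j := by
      have h1 : ∀ v : Fin n → ℝ, ∑ j, v j * a j =
          v i * a i + ∑ j ∈ Finset.univ.erase i, v j * a j :=
        fun v => (Finset.add_sum_erase _ (fun j => v j * a j) (Finset.mem_univ i)).symm
      rw [h1, h1 out.2, Function.update_self, hout i List.mem_cons_self]
      simp only [zero_mul, zero_add]
      congr 1
      refine Finset.sum_congr rfl fun j hj => ?_
      rw [Function.update_of_ne (Finset.ne_of_mem_erase hj)]
    simp only [List.map_cons, List.sum_cons]
    rw [hsum, ← ENNReal.ofReal_mul hκ0.le, ← ENNReal.ofReal_mul hκ1,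
      ← ENNReal.ofReal_add (by positivity) (by positivity)]
    refine ENNReal.ofReal_le_ofReal ?_
    set x := ∑ j, out.2 j * a j
    set y := (S.map c).sum
    calc κ * Real.exp (w i / κ * a i + x + y) + (1 - κ) * Real.exp (x + y)
        = (κ * Real.exp (w i / κ * a i) + (1 - κ)) * Real.exp (x + y) := by
          rw [add_assoc, Real.exp_add]; ring
      _ ≤ Real.exp (c i) * Real.exp (x + y) :=
          mul_le_mul_of_nonneg_right hci (Real.exp_pos _).le
      _ = _ := by rw [← Real.exp_add]; congr 1; ring
/-- One factor of the moment generating function; `a` is the contribution of a row that is kept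
with probability `κ` and then reweighted by `1 / κ`. -/
theorem mgf_factor_le {κ a l Δ : ℝ} (hκ0 : 0 < κ) (hκ1 : κ ≤ 1) (ha : 0 ≤ a)
    (hΔ : 0 ≤ Δ) (h : κ < 1 → a ≤ Δ * κ) (hl : |l| * Δ ≤ 1) :
    κ * Real.exp (l * (a / κ)) + (1 - κ) ≤ Real.exp (l * a + l ^ 2 * a * Δ) := by
  rcases hκ1.eq_or_lt with rfl | hlt
  · simp only [div_one, one_mul, sub_self, add_zero]
    exact Real.exp_le_exp.2 (le_add_of_nonneg_right (by positivity))
  · have h1 := h hlt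
    have h2 : a / κ ≤ Δ := (div_le_iff₀ hκ0).2 h1
    have h3 : |l * (a / κ)| ≤ 1 := by
      rw [abs_mul, abs_of_nonneg (by positivity : 0 ≤ a / κ)]
      exact (mul_le_mul_of_nonneg_left h2 (abs_nonneg _)).trans hl
    have h4 := (abs_le.1 (Real.abs_exp_sub_one_sub_id_le h3)).2
    have h5 : κ * (l * (a / κ)) ^ 2 ≤ l ^ 2 * a * Δ := by
      have : κ * (l * (a / κ)) ^ 2 = l ^ 2 * a * (a / κ) := by field_simp
      rw [this]; gcongr
    have h6 : κ * (l * (a / κ)) = l * a := by field_simp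
    calc κ * Real.exp (l * (a / κ)) + (1 - κ)
        ≤ κ * (1 + l * (a / κ) + (l * (a / κ)) ^ 2) + (1 - κ) := by
          gcongr; linarith
      _ ≤ l * a + l ^ 2 * a * Δ + 1 := by nlinarith
      _ ≤ _ := Real.add_one_le_exp _
/-- A Bernstein-type bound for weighted sums over the sample. -/
theorem failProb_sampleRows_le {m : ℝ} {S : List (Fin n)} (hS : S.Nodup) {w s a : Fin n → ℝ}
    (hs : ∀ i ∈ S, 0 < m * s i) (hw : ∀ i, 0 ≤ w i) (hwS : ∀ i, i ∉ S → w i = 0)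
    (ha : ∀ i, 0 ≤ a i) {Δ μ t : ℝ} (hΔ : 0 < Δ)
    (h : ∀ i ∈ S, w i * a i ≤ Δ * (m * s i)) (hμ : ∑ i, w i * a i ≤ μ) (ht0 : 0 < t)
    (ht : t ≤ 2 * μ) :
    failProb b (sampleRows m S w s) (fun out => |∑ i, out.2 i * a i - ∑ i, w i * a i| ≤ t) ≤
      ENNReal.ofReal (2 * Real.exp (-(t ^ 2 / (4 * μ * Δ)))) := by
  have hμ0 : 0 < μ := by linarith
  set l := t / (2 * μ * Δ) with hl
  have hl0 : 0 < l := by positivity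
  have hlΔ : l * Δ ≤ 1 := by
    rw [hl, div_mul_eq_mul_div, div_le_one (by positivity)]
    nlinarith
  have hsum : (S.map fun i => w i * a i).sum = ∑ i, w i * a i := by
    rw [← List.sum_toFinset _ hS]
    refine Finset.sum_subset (Finset.subset_univ _) fun i _ hi => ?_
    rw [hwS i (by simpa using hi), zero_mul]
  -- both tails are bounded with the parameters `l` and `-l`
  have key : ∀ r : ℝ, |r| = l →
      ev b (sampleRows m S w s) (fun out => ENNReal.ofReal (Real.exp (∑ i, out.2 i * (r * a i)))) ≤
        ENNReal.ofReal (Real.exp (r * ∑ i, w i * a i + l ^ 2 * Δ * μ)) := by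
    intro r hr
    refine (ev_exp_sampleRows_le hS (c := fun i => r * (w i * a i) + r ^ 2 * (w i * a i) * Δ) hs
      fun i hi => ?_).trans (ENNReal.ofReal_le_ofReal (Real.exp_le_exp.2 ?_))
    · have := mgf_factor_le (l := r) (keepProb_pos (hs i hi)) (keepProb_le_one m s i)
        (mul_nonneg (hw i) (ha i)) hΔ.le (fun hlt => ?_) (by rw [hr]; exact hlΔ)
      · convert this using 4; ring
      · have : keepProb m s i = m * s i := by
          rcases min_choice 1 (m * s i) with h1 | h1
          · exact absurd h1 hlt.ne
          · exact h1
        rw [this]; exact h i hi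
    · have e : (S.map fun i => r * (w i * a i) + r ^ 2 * (w i * a i) * Δ).sum =
          r * (S.map fun i => w i * a i).sum + r ^ 2 * Δ * (S.map fun i => w i * a i).sum := by
        rw [← List.sum_toFinset _ hS, ← List.sum_toFinset _ hS, Finset.mul_sum, Finset.mul_sum,
          ← Finset.sum_add_distrib]
        exact Finset.sum_congr rfl fun i _ => by ring
      rw [e, hsum, show r ^ 2 = l ^ 2 by rw [← hr, sq_abs]]
      gcongr
  have hexp : l ^ 2 * Δ * μ - l * t = -(t ^ 2 / (4 * μ * Δ)) := by
    rw [hl]; field_simp; ring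
  set X := ∑ i, w i * a i with hX
  have hr : ∀ (r : ℝ) (out : List (Fin n) × (Fin n → ℝ)),
      ∑ i, out.2 i * (r * a i) = r * ∑ i, out.2 i * a i := by
    intro r out
    rw [Finset.mul_sum]
    exact Finset.sum_congr rfl fun i _ => by ring
  have tail : ∀ r : ℝ, |r| = l → failProb b (sampleRows m S w s)
      (fun out => r * (∑ i, out.2 i * a i - X) ≤ l * t) ≤
        ENNReal.ofReal (Real.exp (-(t ^ 2 / (4 * μ * Δ)))) := by
    intro r hrl
    refine (failProb_le_of_ev_le _ _ (fun out => ENNReal.ofReal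
      (Real.exp (∑ i, out.2 i * (r * a i)))) (x := ENNReal.ofReal (Real.exp (-(r * X) - l * t)))
      (fun out hout => ?_) (key r hrl)).trans ?_
    · rw [← ENNReal.ofReal_mul (Real.exp_pos _).le, ← Real.exp_add, ← ENNReal.ofReal_one, hr]
      refine ENNReal.ofReal_le_ofReal (Real.one_le_exp ?_)
      push Not at hout
      nlinarith
    · rw [← ENNReal.ofReal_mul (Real.exp_pos _).le, ← Real.exp_add, ← hexp]
      exact ENNReal.ofReal_le_ofReal (Real.exp_le_exp.2 (by linarith))
  refine (failProb_mono _ (Q := fun out => l * (∑ i, out.2 i * a i - X) ≤ l * t ∧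
    -l * (∑ i, out.2 i * a i - X) ≤ l * t) fun out hout => ?_).trans
    ((failProb_and_le _ _ _).trans ((add_le_add (tail l (abs_of_pos hl0))
      (tail (-l) (by rw [abs_neg, abs_of_pos hl0]))).trans_eq ?_))
  · rw [abs_le]
    constructor
    · have := hout.2
      by_contra hc
      push Not at hc
      nlinarith
    · exact le_of_mul_le_mul_left hout.1 hl0
  · rw [← ENNReal.ofReal_add (Real.exp_pos _).le (Real.exp_pos _).le, two_mul]
end Prog

/-! ### One round of sampling preserves energies -/
section
variable {M : ℝ≥0 → ℝ≥0} {p q cU cL : ℝ}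
/-- Replacing the weights `w` by `w'` preserves the energy on `V` at scale `ρ`: the energies of the
vectors `y ∈ V` up to an additive error `e ρ`, the energies of the residuals `y - z` up to such an
error and a shift `ζ` that is common to all `y`, and the energy of `z` up to the factor `H`. The
shift cannot be avoided, since `z` may have large entries on few rows. -/
structure Preserves (M : ℝ≥0 → ℝ≥0) {ι : Type} [Fintype ι] (V : Submodule ℝ (ι → ℝ))
    (w w' z : ι → ℝ) (β ρ e H : ℝ) : Prop where
  embed : ∀ y ∈ V, energy M w y ≤ ρ → |energy M w' y - energy M w y| ≤ e * ρ
  residual : ∃ ζ : ℝ, ∀ y ∈ V, energy M w y ≤ ρ →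
    |energy M w' (y - z) - energy M w (y - z) - ζ| ≤ e * ρ
  target : energy M w' z ≤ H * β
theorem energy_indicator_add {ι : Type} [Fintype ι] (w z : ι → ℝ) (G : Set ι) :
    energy M (G.indicator w) z + energy M (Gᶜ.indicator w) z = energy M w z := by
  rw [energy, energy, ← Finset.sum_add_distrib]
  refine Finset.sum_congr rfl fun i _ => ?_
  rw [← add_mul, ← Pi.add_apply, Set.indicator_self_add_compl]
theorem indicator_nonneg' {ι : Type} {w : ι → ℝ} (hw : ∀ i, 0 ≤ w i) (G : Set ι) (i : ι) :
    0 ≤ G.indicator w i := Set.indicator_nonneg (fun i _ => hw i) i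
theorem energy_indicator_le {ι : Type} [Fintype ι] {w : ι → ℝ} (hw : ∀ i, 0 ≤ w i) (z : ι → ℝ)
    (G : Set ι) : energy M (G.indicator w) z ≤ energy M w z :=
  energy_mono_weights (fun i => Set.indicator_le_self' (fun i _ => hw i) i) z
namespace IsAdmissibleLoss
variable (hM : IsAdmissibleLoss M p q cU cL)
include hM
/-- New weights that are under control on a net are under control on the whole energy ball: the
supremum over the ball is at most the maximum over the net plus a small multiple of itself. -/
theorem energy_le_of_net (hp : 0 < p) (hcL : 0 < cL) {ι : Type} [Fintype ι] {w w' : ι → ℝ}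
    (hw : ∀ i, 0 ≤ w i) (hw' : ∀ i, 0 ≤ w' i) {W : ℝ} (hW : ∀ i, w' i ≤ W * w i)
    (V : Submodule ℝ (ι → ℝ)) {ρ η : ℝ} (hρ : 0 ≤ ρ) (hη0 : 0 < η) (hη1 : η < 1)
    (hη : η ^ q / cL ≤ (1 / 2) ^ max 1 p) (N : Finset (ι → ℝ)) (hNV : ∀ z ∈ N, z ∈ V)
    (hN : ∀ y ∈ V, energy M w y ≤ ρ → ∃ z ∈ N, energy M w (η⁻¹ • (y - z)) ≤ ρ)
    (hb : ∀ y ∈ N, energy M w' y ≤ 2 * ρ) (y : ι → ℝ) (hyV : y ∈ V) (hy : energy M w y ≤ ρ) :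
    energy M w' y ≤ 2 ^ (max 1 p + 1) * ρ := by
  set P := max 1 p with hP
  have hP1 : 1 ≤ P := le_max_left _ _
  have hP0 : 0 < P := by linarith
  have hP' : 0 < 1 / P := one_div_pos.2 hP0
  have claim : ∀ k : ℕ, ∀ y ∈ V, energy M w y ≤ ρ →
      energy M w' y ^ (1 / P) ≤ 2 * (2 * ρ) ^ (1 / P) + (1 / 2) ^ k * (|W| * ρ) ^ (1 / P) := by
    intro k
    induction k with
    | zero =>
      intro y _ hy
      have h1 : energy M w' y ≤ |W| * ρ := by
        calc energy M w' y ≤ energy M (fun i => |W| * w i) y :=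
              energy_mono_weights (fun i => (hW i).trans
                (mul_le_mul_of_nonneg_right (le_abs_self W) (hw i))) y
          _ = |W| * energy M w y := by simp only [energy, Finset.mul_sum, mul_assoc]
          _ ≤ _ := mul_le_mul_of_nonneg_left hy (abs_nonneg W)
      have h2 := Real.rpow_le_rpow (energy_nonneg hw' y) h1 hP'.le
      have h3 : 0 ≤ (2 * ρ) ^ (1 / P) := by positivity
      linarith
    | succ k ih =>
      intro y hyV hy
      obtain ⟨z, hzN, hz⟩ := hN y hyV hy
      set u := η⁻¹ • (y - z) with hu
      have hyz : y = η • u + z := by rw [hu, smul_smul, mul_inv_cancel₀ hη0.ne', one_smul]; simp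
      have huV : u ∈ V := V.smul_mem _ (V.sub_mem hyV (hNV z hzN))
      have h1 := ih u huV hz
      have h2 := hM.energy_rpow_add_le hw' hp (η • u) z
      rw [← hyz, ← hP] at h2
      have h3 := Real.rpow_le_rpow (energy_nonneg hw' z) (hb z hzN) hP'.le
      have h4 : energy M w' (η • u) ^ (1 / P) ≤ 1 / 2 * energy M w' u ^ (1 / P) := by
        have h5 : energy M w' (η • u) ≤ (1 / 2) ^ P * energy M w' u :=
          (hM.energy_smul_le hw' hcL hη0 hη1 u).trans
            (mul_le_mul_of_nonneg_right hη (energy_nonneg hw' u))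
        have h6 := Real.rpow_le_rpow (energy_nonneg hw' _) h5 hP'.le
        rwa [Real.mul_rpow (by positivity) (energy_nonneg hw' u), ← Real.rpow_mul (by norm_num),
          mul_one_div_cancel hP0.ne', Real.rpow_one] at h6
      rw [pow_succ]
      linarith
  have hlim : Filter.Tendsto (fun k : ℕ => 2 * (2 * ρ) ^ (1 / P) +
      (1 / 2 : ℝ) ^ k * (|W| * ρ) ^ (1 / P)) Filter.atTop
      (nhds (2 * (2 * ρ) ^ (1 / P) + 0 * (|W| * ρ) ^ (1 / P))) :=
    ((tendsto_pow_atTop_nhds_zero_of_lt_one (by norm_num) (by norm_num)).mul_const _).const_add _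
  have h1 := ge_of_tendsto' hlim fun k => claim k y hyV hy
  rw [zero_mul, add_zero] at h1
  have h2 := Real.rpow_le_rpow (Real.rpow_nonneg (energy_nonneg hw' _) _) h1 hP0.le
  rwa [← Real.rpow_mul (energy_nonneg hw' _), one_div_mul_cancel hP0.ne', Real.rpow_one,
    Real.mul_rpow (by norm_num) (by positivity), ← Real.rpow_mul (by positivity),
    one_div_mul_cancel hP0.ne', Real.rpow_one, ← mul_assoc, ← Real.rpow_add_one (by norm_num)] at h2
/-- The error constant of one round of sampling. -/
noncomputable def _root_.roundConst (p H : ℝ) : ℝ :=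
  1 + max 1 p * 2 ^ max 1 p + max 1 p * (2 ^ max 1 p * (2 ^ (max 1 p + 1) + H)) +
    2 * p * Real.exp p * (1 + H)
/-- The deterministic part of the analysis of one round: it suffices to control the new weights on
a net, and there only on a set `G` of rows; on the other rows, the entries of `z` dominate those of
the vectors in the energy ball. -/
theorem residual_of_net (hp : 0 < p) (hcL : 0 < cL) {ι : Type} [Fintype ι] {w w' : ι → ℝ}
    (hw : ∀ i, 0 ≤ w i) (hw' : ∀ i, 0 ≤ w' i) {W : ℝ} (hW : ∀ i, w' i ≤ W * w i)
    (V : Submodule ℝ (ι → ℝ)) {ρ η ε H : ℝ} (hρ : 0 ≤ ρ) (hη0 : 0 < η) (hη1 : η < 1)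
    (hε0 : 0 < ε) (hε : ε ≤ 1 / 2) (hη : η ^ q / cL ≤ (ε / 2) ^ max 1 p)
    (N : Finset (ι → ℝ)) (hNV : ∀ z ∈ N, z ∈ V ∧ energy M w z ≤ ρ)
    (hN : ∀ y ∈ V, energy M w y ≤ ρ → ∃ z ∈ N, energy M w (η⁻¹ • (y - z)) ≤ ρ)
    (hb : ∀ y ∈ N, energy M w' y ≤ 2 * ρ) (z : ι → ℝ) (G : Set ι)
    (hG : ∀ y ∈ N, |energy M (G.indicator w') (y - z) - energy M (G.indicator w) (y - z)| ≤ ε * ρ)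
    (hGc : ∀ i ∉ G, w i ≠ 0 → ∀ y ∈ V, energy M w y ≤ ρ → loss M (y i) ≤ ε ^ p * loss M (z i))
    (hzw : energy M w z ≤ ρ) (hH : 0 ≤ H) (hzw' : energy M w' z ≤ H * ρ) :
    ∃ ζ : ℝ, ∀ y ∈ V, energy M w y ≤ ρ →
      |energy M w' (y - z) - energy M w (y - z) - ζ| ≤ roundConst p H * ε * ρ := by
  set P := max 1 p with hP
  have hP1 : 1 ≤ P := le_max_left _ _
  have hP0 : 0 < P := by linarith
  have hηhalf : η ^ q / cL ≤ (1 / 2) ^ P :=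
    hη.trans (Real.rpow_le_rpow (by positivity) (by linarith) hP0.le)
  have hball := hM.energy_le_of_net hp hcL hw hw' hW V hρ hη0 hη1 hηhalf N
    (fun z hz => (hNV z hz).1) hN hb
  rw [← hP] at hball
  have h2P : 1 ≤ (2 : ℝ) ^ P := Real.one_le_rpow (by norm_num) hP0.le
  have hεP : (ε / 2) ^ P ≤ ε ^ P := Real.rpow_le_rpow (by positivity) (by linarith) hP0.le
  have hεP0 : 0 ≤ ε ^ P := by positivity
  -- rows outside of `G`
  have hbad : ∀ v : ι → ℝ, (∀ i, 0 ≤ v i) → (∀ i, w i = 0 → v i = 0) → ∀ y ∈ V,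
      energy M w y ≤ ρ → |energy M (Gᶜ.indicator v) (y - z) - energy M (Gᶜ.indicator v) z| ≤
        2 * p * Real.exp p * ε * energy M v z := by
    intro v hv0 hvw y hyV hy
    refine le_trans ?_ (mul_le_mul_of_nonneg_left (energy_indicator_le hv0 z Gᶜ) (by positivity))
    simp only [energy]
    rw [← Finset.sum_sub_distrib, Finset.mul_sum]
    refine (Finset.abs_sum_le_sum_abs _ _).trans (Finset.sum_le_sum fun i _ => ?_)
    by_cases hi : i ∈ G
    · simp [hi]
    by_cases hwi : w i = 0
    · have h0 : Gᶜ.indicator v i = 0 := by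
        rw [Set.indicator_of_mem (show i ∈ Gᶜ from hi), hvw i hwi]
      simp [h0]
    rw [Set.indicator_of_mem (show i ∈ Gᶜ from hi), ← mul_sub, abs_mul, abs_of_nonneg (hv0 i),
      mul_left_comm]
    exact mul_le_mul_of_nonneg_left (hM.abs_loss_sub_le hp hε0 hε (hGc i hi hwi y hyV hy)) (hv0 i)
  have hw'0 : ∀ i, w i = 0 → w' i = 0 := fun i hi =>
    le_antisymm (by simpa [hi] using hW i) (hw' i)
  refine ⟨energy M (Gᶜ.indicator w') z - energy M (Gᶜ.indicator w) z, fun y hyV hy => ?_⟩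
  obtain ⟨y', hy'N, hu⟩ := hN y hyV hy
  obtain ⟨hy'V, hy'⟩ := hNV y' hy'N
  set u := η⁻¹ • (y - y') with hudef
  have huV : u ∈ V := V.smul_mem _ (V.sub_mem hyV hy'V)
  have hdiff : y - z - (y' - z) = η • u := by
    rw [hudef, smul_smul, mul_inv_cancel₀ hη0.ne', one_smul]; abel
  -- passing from `y` to the net point `y'` on the rows in `G`, for the old weights
  have h1 : |energy M (G.indicator w) (y - z) - energy M (G.indicator w) (y' - z)| ≤
      P * ε * (2 ^ P * ρ) := by
    refine hM.abs_energy_sub_le (indicator_nonneg' hw G) hp _ _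
      ((energy_indicator_le hw _ G).trans (hM.energy_sub_le hw hp y z hy hzw))
      ((energy_indicator_le hw _ G).trans (hM.energy_sub_le hw hp y' z hy' hzw)) ?_ hε0.le
    rw [hdiff, ← hP]
    refine (energy_indicator_le hw _ G).trans ((hM.energy_smul_le hw hcL hη0 hη1 u).trans ?_)
    calc η ^ q / cL * energy M w u ≤ ε ^ P * ρ :=
          mul_le_mul (hη.trans hεP) hu (energy_nonneg hw u) hεP0
      _ ≤ ε ^ P * (2 ^ P * ρ) := by
          refine mul_le_mul_of_nonneg_left ?_ hεP0
          nlinarith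
  -- the same for the new weights
  have h2 : |energy M (G.indicator w') (y - z) - energy M (G.indicator w') (y' - z)| ≤
      P * ε * (2 ^ P * ((2 ^ (P + 1) + H) * ρ)) := by
    have hX : ∀ v ∈ V, energy M w v ≤ ρ → energy M w' v ≤ (2 ^ (P + 1) + H) * ρ :=
      fun v hvV hv => (hball v hvV hv).trans (by nlinarith)
    have hz' : energy M w' z ≤ (2 ^ (P + 1) + H) * ρ := hzw'.trans (by
      have : 0 ≤ (2 : ℝ) ^ (P + 1) * ρ := by positivity
      nlinarith)
    have hX0 : 0 ≤ (2 ^ (P + 1) + H) * ρ := by positivity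
    refine hM.abs_energy_sub_le (indicator_nonneg' hw' G) hp _ _
      ((energy_indicator_le hw' _ G).trans (hM.energy_sub_le hw' hp y z (hX y hyV hy) hz'))
      ((energy_indicator_le hw' _ G).trans (hM.energy_sub_le hw' hp y' z (hX y' hy'V hy') hz'))
      ?_ hε0.le
    rw [hdiff, ← hP]
    refine (energy_indicator_le hw' _ G).trans ((hM.energy_smul_le hw' hcL hη0 hη1 u).trans ?_)
    calc η ^ q / cL * energy M w' u ≤ ε ^ P * ((2 ^ (P + 1) + H) * ρ) :=
          mul_le_mul (hη.trans hεP) (hX u huV hu) (energy_nonneg hw' u) hεP0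
      _ ≤ _ := by
          refine mul_le_mul_of_nonneg_left ?_ hεP0
          nlinarith
  have h3 := hG y' hy'N
  have h4 := hbad w hw (fun i h => h) y hyV hy
  have h5 := hbad w' hw' hw'0 y hyV hy
  have h6 : 2 * p * Real.exp p * ε * energy M w z ≤ 2 * p * Real.exp p * ε * ρ :=
    mul_le_mul_of_nonneg_left hzw (by positivity)
  have h7 : 2 * p * Real.exp p * ε * energy M w' z ≤ 2 * p * Real.exp p * ε * (H * ρ) :=
    mul_le_mul_of_nonneg_left hzw' (by positivity)
  rw [← energy_indicator_add w' (y - z) G, ← energy_indicator_add w (y - z) G]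
  have htot : roundConst p H * ε * ρ = ε * ρ + P * ε * (2 ^ P * ρ) +
      P * ε * (2 ^ P * ((2 ^ (P + 1) + H) * ρ)) + 2 * p * Real.exp p * ε * ρ +
      2 * p * Real.exp p * ε * (H * ρ) := by
    rw [roundConst, ← hP]; ring
  rw [htot]
  rw [abs_le] at h1 h2 h3 h4 h5 ⊢
  constructor <;> linarith [h1.1, h1.2, h2.1, h2.2, h3.1, h3.2, h4.1, h4.2, h5.1, h5.2]
end IsAdmissibleLoss
end

open Prog
theorem ofReal_sum_le {ι : Type*} (s : Finset ι) (f : ι → ℝ) :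
    ENNReal.ofReal (∑ i ∈ s, f i) ≤ ∑ i ∈ s, ENNReal.ofReal (f i) := by
  classical
  induction s using Finset.induction_on with
  | empty => simp
  | insert i s hi ih =>
    rw [Finset.sum_insert hi, Finset.sum_insert hi]
    exact ENNReal.ofReal_add_le.trans (add_le_add le_rfl ih)
theorem energy_indicator_eq (M : ℝ≥0 → ℝ≥0) {ι : Type} [Fintype ι] (v x : ι → ℝ) (G : Set ι) :
    energy M (G.indicator v) x = ∑ i, v i * G.indicator (fun i => loss M (x i)) i := by
  refine Finset.sum_congr rfl fun i _ => ?_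
  by_cases hi : i ∈ G <;> simp [hi]
theorem list_sum_ofReal_le {n : ℕ} {S : List (Fin n)} (hS : S.Nodup) {f : Fin n → ℝ}
    (hf : ∀ i, 0 ≤ f i) : (S.map fun i => ENNReal.ofReal (f i)).sum ≤ ENNReal.ofReal (∑ i, f i) := by
  rw [← List.sum_toFinset _ hS, ENNReal.ofReal_sum_of_nonneg fun i _ => hf i]
  exact Finset.sum_le_sum_of_subset (Finset.subset_univ _)
section
variable {n : ℕ} {b : Fin n → ℝ} {m : ℝ} {S : List (Fin n)} {w s : Fin n → ℝ}
theorem Prog.IsSample.nonneg {out : List (Fin n) × (Fin n → ℝ)} (h : IsSample m S w s out)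
    (hw : ∀ i, 0 ≤ w i) (hs : ∀ i ∈ S, 0 < m * s i) (i : Fin n) : 0 ≤ out.2 i := by
  by_cases hi : i ∈ out.1
  · rw [h.weight i hi]
    exact div_nonneg (hw i) (keepProb_pos (hs i (h.subset i hi))).le
  · rw [h.weight_zero i hi]
theorem Prog.IsSample.le_mul {out : List (Fin n) × (Fin n → ℝ)} (h : IsSample m S w s out)
    (hw : ∀ i, 0 ≤ w i) (i : Fin n) : out.2 i ≤ (∑ j, |(keepProb m s j)⁻¹|) * w i := by
  have h0 : 0 ≤ ∑ j, |(keepProb m s j)⁻¹| := Finset.sum_nonneg fun j _ => abs_nonneg _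
  by_cases hi : i ∈ out.1
  · rw [h.weight i hi, div_eq_inv_mul]
    refine mul_le_mul_of_nonneg_right ((le_abs_self _).trans ?_) (hw i)
    exact Finset.single_le_sum (f := fun j => |(keepProb m s j)⁻¹|) (fun j _ => abs_nonneg _)
      (Finset.mem_univ i)
  · rw [h.weight_zero i hi]; exact mul_nonneg h0 (hw i)
variable {M : ℝ≥0 → ℝ≥0}
/-- Sampling does not increase the energy of a fixed vector by much, by Markov's inequality. -/
theorem failProb_energy_le (hS : S.Nodup) (hs : ∀ i ∈ S, 0 < m * s i) (hw : ∀ i, 0 ≤ w i)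
    (z : Fin n → ℝ) {β H : ℝ} (hβ0 : 0 < β) (hH : 0 < H) (hβ : energy M w z ≤ β) :
    failProb b (sampleRows m S w s) (fun out => energy M out.2 z ≤ H * β) ≤
      ENNReal.ofReal (1 / H) := by
  refine (failProb_le_of_ev_le _ _ (fun out => ∑ i, ENNReal.ofReal (out.2 i * loss M (z i)))
    (x := ENNReal.ofReal (1 / (H * β))) (y := ENNReal.ofReal β) (fun out hout => ?_) ?_).trans_eq ?_
  · refine le_trans ?_ (mul_le_mul_right (ofReal_sum_le _ _) _)
    rw [← ENNReal.ofReal_mul (by positivity), ← ENNReal.ofReal_one]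
    refine ENNReal.ofReal_le_ofReal ?_
    push Not at hout
    rw [one_div, inv_mul_eq_div, le_div_iff₀ (by positivity), one_mul]
    exact hout.le
  · refine (ev_sum_sampleRows_le hS hs).trans ((list_sum_ofReal_le hS fun i =>
      mul_nonneg (hw i) (loss_nonneg _ _)).trans (ENNReal.ofReal_le_ofReal hβ))
  · rw [← ENNReal.ofReal_mul (by positivity)]
    congr 1; field_simp
theorem failProb_length_le {Q H : ℝ} (hs : ∀ i ∈ S, 0 < m * s i) (hQ : 0 < Q) (hH : 0 < H)
    (h : (S.map fun i => m * s i).sum ≤ Q) :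
    failProb b (sampleRows m S w s) (fun out => (out.1.length : ℝ) ≤ H * Q) ≤
      ENNReal.ofReal (1 / H) := by
  refine (failProb_le_of_ev_le _ _ (fun out => (out.1.length : ℝ≥0∞))
    (x := ENNReal.ofReal (1 / (H * Q))) (y := ENNReal.ofReal Q) (fun out hout => ?_) ?_).trans_eq ?_
  · rw [← ENNReal.ofReal_natCast, ← ENNReal.ofReal_mul (by positivity), ← ENNReal.ofReal_one]
    refine ENNReal.ofReal_le_ofReal ?_
    push Not at hout
    rw [one_div, inv_mul_eq_div, le_div_iff₀ (by positivity), one_mul]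
    exact hout.le
  · refine (ev_length_sampleRows_le hs).trans (le_trans (le_of_eq ?_)
      (ENNReal.ofReal_le_ofReal h))
    clear h
    induction S with
    | nil => simp
    | cons i S ih =>
      have hsum : 0 ≤ (S.map fun i => m * s i).sum := List.sum_nonneg (by
        intro x hx
        obtain ⟨j, hj, rfl⟩ := List.mem_map.1 hx
        exact (hs j (List.mem_cons_of_mem _ hj)).le)
      simp only [List.map_cons, List.sum_cons]
      rw [ENNReal.ofReal_add (hs i List.mem_cons_self).le hsum,
        ih fun j hj => hs j (List.mem_cons_of_mem _ hj)]
  · rw [← ENNReal.ofReal_mul (by positivity)]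
    congr 1; field_simp
end
/-- Parameters of the net: `σ` as in `exists_energy_net`, and a fineness `η`, polynomial in `ε`, for
which moving a vector of the energy ball to its net point costs a factor `1 + O(ε)`. -/
theorem exists_net_parameters (p q cL : ℝ) (hq : 0 < q) (hcL : 0 < cL) :
    ∃ σ C₁ : ℝ, 1 < σ ∧ 0 < C₁ ∧ 2 ^ max 1 p ≤ cL * σ ^ q ∧ ∀ ε : ℝ, 0 < ε → ε ≤ 1 / 2 →
      ∃ η : ℝ, 0 < η ∧ η < 1 ∧ η ^ q / cL ≤ (ε / 2) ^ max 1 p ∧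
        σ ^ 2 / η ≤ Real.exp (C₁ * Real.log (1 / ε)) := by
  set P := max 1 p with hP
  have hP1 : 1 ≤ P := le_max_left _ _
  have hP0 : 0 < P := by linarith
  set σ := max 2 ((2 ^ P / cL) ^ (1 / q)) with hσ
  have hσ2 : 2 ≤ σ := le_max_left _ _
  set η₀ := min (1 / 2) ((cL / 2 ^ P) ^ (1 / q)) with hη₀
  have hη₀0 : 0 < η₀ := by positivity
  have hη₀1 : η₀ ≤ 1 / 2 := min_le_left _ _
  have hr : 1 ≤ σ ^ 2 / η₀ := by
    rw [le_div_iff₀ hη₀0]; nlinarith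
  have hlog2 : 0 < Real.log 2 := Real.log_pos (by norm_num)
  refine ⟨σ, Real.log (σ ^ 2 / η₀) / Real.log 2 + P / q, by linarith, ?_, ?_, ?_⟩
  · have := Real.log_nonneg hr
    positivity
  · have h1 := Real.rpow_le_rpow (by positivity) (le_max_right 2 ((2 ^ P / cL) ^ (1 / q))) hq.le
    rw [← Real.rpow_mul (by positivity), one_div_mul_cancel hq.ne', Real.rpow_one,
      div_le_iff₀' hcL] at h1
    exact h1
  · intro ε hε0 hε
    have hℓ : Real.log 2 ≤ Real.log (1 / ε) :=
      Real.log_le_log (by norm_num) (by rw [le_div_iff₀ hε0]; linarith)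
    have hεq0 : 0 < ε ^ (P / q) := by positivity
    have hεq1 : ε ^ (P / q) ≤ 1 := Real.rpow_le_one hε0.le (by linarith) (by positivity)
    refine ⟨η₀ * ε ^ (P / q), by positivity, by nlinarith, ?_, ?_⟩
    · have h1 := Real.rpow_le_rpow hη₀0.le (min_le_right (1 / 2) ((cL / 2 ^ P) ^ (1 / q))) hq.le
      rw [← Real.rpow_mul (by positivity), one_div_mul_cancel hq.ne', Real.rpow_one] at h1
      rw [Real.mul_rpow hη₀0.le hεq0.le, ← Real.rpow_mul hε0.le, div_mul_cancel₀ _ hq.ne',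
        Real.div_rpow hε0.le (by norm_num), div_le_iff₀ hcL]
      calc η₀ ^ q * ε ^ P ≤ cL / 2 ^ P * ε ^ P := by gcongr
        _ = _ := by ring
    · have e1 : ε ^ (P / q) = (Real.exp (P / q * Real.log (1 / ε)))⁻¹ := by
        rw [Real.rpow_def_of_pos hε0, ← Real.exp_neg, one_div, Real.log_inv]
        congr 1; ring
      rw [add_mul, Real.exp_add, e1, ← div_div, div_inv_eq_mul]
      refine mul_le_mul_of_nonneg_right ?_ (Real.exp_pos _).le
      calc σ ^ 2 / η₀ = Real.exp (Real.log (σ ^ 2 / η₀)) := (Real.exp_log (by linarith)).symm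
        _ ≤ _ := Real.exp_le_exp.2 (by
          rw [div_mul_eq_mul_div, le_div_iff₀ hlog2]
          exact mul_le_mul_of_nonneg_left hℓ (Real.log_nonneg hr))
theorem exp_neg_le_small {x : ℝ} (hx : Real.log 2 ≤ x) :
    4 * Real.exp (-(20 * x)) ≤ 1 / 4000 := by
  have h1 : Real.exp (-(20 * x)) ≤ Real.exp (-(20 * Real.log 2)) :=
    Real.exp_le_exp.2 (by linarith)
  have h2 : Real.exp (-(20 * Real.log 2)) = (2 ^ 20)⁻¹ := by
    rw [Real.exp_neg, show (20 : ℝ) = ((20 : ℕ) : ℝ) by norm_num, Real.exp_nat_mul,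
      Real.exp_log (by norm_num)]
  rw [h2] at h1
  norm_num at h1 ⊢
  linarith
/-- One round of sampling preserves the energies of residuals, up to a common shift. The rows are
split by the size of the entries of the target `z` relative to the sensitivity bounds: on rows with
small entries, all contributions are small enough for a Bernstein bound and a union bound over a
net; on the others, the energy of `y - z` hardly depends on `y`. -/
theorem exists_failProb_residual (p q cL : ℝ) (hp : 0 < p) (hq : 0 < q) (hcL : 0 < cL) :
    ∃ K : ℝ, 0 < K ∧ ∀ (cU : ℝ) (M : ℝ≥0 → ℝ≥0), IsAdmissibleLoss M p q cU cL →
      ∀ (n d : ℕ), 1 ≤ d → ∀ (b : Fin n → ℝ) (S : List (Fin n)), S.Nodup →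
      ∀ (w s : Fin n → ℝ), (∀ i, 0 ≤ w i) → (∀ i, i ∉ S → w i = 0) → (∀ i ∈ S, 0 < s i) →
      ∀ V : Submodule ℝ (Fin n → ℝ), Module.finrank ℝ V ≤ d →
      (∀ i ∈ S, ∀ y ∈ V, w i * loss M (y i) ≤ s i * energy M w y) →
      ∀ ε m : ℝ, 0 < ε → ε ≤ 1 / 2 → K * d * Real.log (1 / ε) / ε ^ (2 + p) ≤ m →
      ∀ (z : Fin n → ℝ) (β ρ : ℝ), 0 < β → β ≤ ρ → energy M w z ≤ β →
        failProb b (sampleRows m S w s) (fun out =>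
          (∃ ζ : ℝ, ∀ y ∈ V, energy M w y ≤ ρ →
            |energy M out.2 (y - z) - energy M w (y - z) - ζ| ≤ roundConst p 4000 * ε * ρ) ∧
          energy M out.2 z ≤ 4000 * β) ≤ ENNReal.ofReal (1 / 2000) := by
  obtain ⟨σ, C₁, hσ1, hC₁, hσ, hη⟩ := exists_net_parameters p q cL hq hcL
  set P := max 1 p with hP
  have hP1 : 1 ≤ P := le_max_left _ _
  have hP0 : 0 < P := by linarith
  refine ⟨4 ^ (P + 1) * (C₁ + 20), by positivity, ?_⟩
  intro cU M hM n d hd b S hS w s hw hwS hs V hV hsens ε m hε0 hε hm z β ρ hβ0 hβρ hzβ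
  obtain ⟨η, hη0, hη1, hηε, hησ⟩ := hη ε hε0 hε
  have hρ : 0 < ρ := by linarith
  have hd1 : (1 : ℝ) ≤ d := by exact_mod_cast hd
  set ℓ := Real.log (1 / ε) with hℓ
  have hlog2 : 0 < Real.log 2 := Real.log_pos (by norm_num)
  have hℓ2 : Real.log 2 ≤ ℓ :=
    Real.log_le_log (by norm_num) (by rw [le_div_iff₀ hε0]; linarith)
  have hℓ0 : 0 < ℓ := by linarith
  have hm0 : 0 < m := lt_of_lt_of_le (by positivity) hm
  have hms : ∀ i ∈ S, 0 < m * s i := fun i hi => mul_pos hm0 (hs i hi)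
  have h2P : 1 ≤ (2 : ℝ) ^ P := Real.one_le_rpow (by norm_num) hP0.le
  have hεp0 : 0 < ε ^ p := by positivity
  have hεp1 : ε ^ p ≤ 1 := Real.rpow_le_one hε0.le (by linarith) hp.le
  obtain ⟨N, hNV, hNc, hN⟩ := hM.exists_energy_net hp hq hcL hw V hV hρ hσ1 hσ hη0 hη1.le
  set x := ε ^ (2 + p) * m / 4 ^ (P + 1) with hx
  have hxm : (C₁ + 20) * (d * ℓ) ≤ x := by
    rw [div_le_iff₀ (by positivity)] at hm
    rw [hx, le_div_iff₀ (by positivity)]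
    linarith
  -- the union bound over the net
  have hcard : N.card * (2 * Real.exp (-x)) ≤ 1 / 8000 := by
    have h1 : (N.card : ℝ) ≤ Real.exp (C₁ * (d * ℓ)) := by
      refine hNc.trans ((pow_le_pow_left₀ (by positivity) hησ d).trans_eq ?_)
      rw [← Real.exp_nat_mul]; congr 1; ring
    have h2 : Real.exp (C₁ * (d * ℓ)) * Real.exp (-x) ≤ Real.exp (-(20 * (d * ℓ))) := by
      rw [← Real.exp_add]; exact Real.exp_le_exp.2 (by linarith)
    have h3 := exp_neg_le_small (x := d * ℓ) (by nlinarith)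
    have h4 : N.card * Real.exp (-x) ≤ Real.exp (C₁ * (d * ℓ)) * Real.exp (-x) :=
      mul_le_mul_of_nonneg_right h1 (Real.exp_pos _).le
    linarith
  have hunion : ∀ Q : (Fin n → ℝ) → List (Fin n) × (Fin n → ℝ) → Prop,
      (∀ y ∈ N, failProb b (sampleRows m S w s) (Q y) ≤ ENNReal.ofReal (2 * Real.exp (-x))) →
      failProb b (sampleRows m S w s) (fun out => ∀ y ∈ N, Q y out) ≤
        ENNReal.ofReal (1 / 8000) := by
    intro Q hQ
    refine (failProb_forall_le N _ Q).trans ((Finset.sum_le_sum hQ).trans ?_)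
    rw [Finset.sum_const, nsmul_eq_mul, ← ENNReal.ofReal_natCast,
      ← ENNReal.ofReal_mul (by positivity)]
    exact ENNReal.ofReal_le_ofReal hcard
  have hE1 := hunion (fun y out => |∑ i, out.2 i * loss M (y i) - ∑ i, w i * loss M (y i)| ≤ ρ) (by
    intro y hy
    obtain ⟨hyV, hyρ⟩ := hNV y hy
    refine (failProb_sampleRows_le hS hms hw hwS (fun i => loss_nonneg M (y i)) (Δ := ρ / m)
      (by positivity) (fun i hi => ?_) hyρ hρ (by linarith)).trans
      (ENNReal.ofReal_le_ofReal (mul_le_mul_of_nonneg_left (Real.exp_le_exp.2 ?_) (by norm_num)))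
    · have := hsens i hi y hyV
      calc w i * loss M (y i) ≤ s i * energy M w y := this
        _ ≤ s i * ρ := mul_le_mul_of_nonneg_left hyρ (hs i hi).le
        _ = ρ / m * (m * s i) := by field_simp
    · have e : ρ ^ 2 / (4 * ρ * (ρ / m)) = m / 4 := by field_simp
      rw [e, neg_le_neg_iff, hx, div_le_div_iff₀ (by positivity) (by norm_num)]
      have h1 : ε ^ (2 + p) ≤ 1 := Real.rpow_le_one hε0.le (by linarith) (by linarith)
      have h2 : (4 : ℝ) ≤ 4 ^ (P + 1) := by
        conv_lhs => rw [← Real.rpow_one 4]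
        exact Real.rpow_le_rpow_of_exponent_le (by norm_num) (by linarith)
      calc ε ^ (2 + p) * m * 4 ≤ 1 * m * 4 ^ (P + 1) := by gcongr
        _ = _ := by ring)
  -- rows on which `z` is not large compared to the vectors of the energy ball
  let G : Set (Fin n) := {i | w i * loss M (z i) ≤ s i * ρ / ε ^ p}
  have hE2 := hunion (fun y out =>
    |∑ i, out.2 i * G.indicator (fun i => loss M ((y - z) i)) i -
      ∑ i, w i * G.indicator (fun i => loss M ((y - z) i)) i| ≤ ε * ρ) (by
    intro y hy
    obtain ⟨hyV, hyρ⟩ := hNV y hy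
    refine (failProb_sampleRows_le hS hms hw hwS
      (fun i => Set.indicator_nonneg (fun i _ => loss_nonneg M _) i) (Δ := 2 ^ P * ρ / (ε ^ p * m))
      (μ := 2 ^ P * ρ) (by positivity) (fun i hi => ?_) ?_ (by positivity) (by nlinarith)).trans
      (ENNReal.ofReal_le_ofReal (mul_le_mul_of_nonneg_left (Real.exp_le_exp.2 ?_) (by norm_num)))
    · have hsi := hs i hi
      have e : 2 ^ P * ρ / (ε ^ p * m) * (m * s i) = 2 ^ P * (s i * ρ / ε ^ p) := by field_simp
      rw [e]
      by_cases hiG : i ∈ G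
      · rw [Set.indicator_of_mem hiG]
        have hy1 : w i * loss M (y i) ≤ s i * ρ / ε ^ p := by
          calc w i * loss M (y i) ≤ s i * energy M w y := hsens i hi y hyV
            _ ≤ s i * ρ := mul_le_mul_of_nonneg_left hyρ hsi.le
            _ ≤ _ := le_div_self (by positivity) hεp0 hεp1
        have := hM.energy_sub_le (ι := Unit) (w := fun _ => w i) (fun _ => hw i) hp
          (fun _ => y i) (fun _ => z i) (x := s i * ρ / ε ^ p) (by simpa [energy] using hy1)
          (by
            have hiG' : w i * loss M (z i) ≤ s i * ρ / ε ^ p := hiG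
            simpa [energy] using hiG')
        simpa [energy] using this
      · rw [Set.indicator_of_notMem hiG, mul_zero]; positivity
    · rw [← energy_indicator_eq]
      exact (energy_indicator_le hw _ G).trans (hM.energy_sub_le hw hp y z hyρ (hzβ.trans hβρ))
    · have e : (ε * ρ) ^ 2 / (4 * (2 ^ P * ρ) * (2 ^ P * ρ / (ε ^ p * m))) = x := by
        have e1 : (4 : ℝ) ^ (P + 1) = 4 * (2 ^ P * 2 ^ P) := by
          rw [Real.rpow_add_one (by norm_num), ← Real.mul_rpow (by norm_num) (by norm_num)]
          norm_num [mul_comm]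
        have e2 : ε ^ (2 + p) = ε ^ 2 * ε ^ p := by
          rw [Real.rpow_add hε0, Real.rpow_two]
        rw [hx, e1, e2]
        have : (2 : ℝ) ^ P ≠ 0 := by positivity
        field_simp
      rw [e])
  have hE3 := failProb_energy_le (b := b) (M := M) hS hms hw z hβ0 (H := 4000) (by norm_num) hzβ
  have hE0 := (triple_sampleRows (b := b) m hS w s).failProb_le
  refine (failProb_mono _ (Q := fun out => ((_ ∧ _) ∧ _) ∧ _) ?_).trans
    ((failProb_and_le _ _ _).trans ((add_le_add ((failProb_and_le _ _ _).trans (add_le_add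
      ((failProb_and_le _ _ _).trans (add_le_add hE1 hE2)) hE3)) hE0).trans_eq ?_))
  · rintro out ⟨⟨⟨h1, h2⟩, h3⟩, h4⟩
    refine ⟨?_, h3⟩
    refine hM.residual_of_net hp hcL hw (h4.nonneg hw hms) (h4.le_mul hw) V hρ.le hη0 hη1 hε0 hε
      hηε N hNV hN (fun y hy => ?_) z G (fun y hy => ?_) ?_ (hzβ.trans hβρ) (by norm_num)
      (h3.trans (by linarith))
    · have h5 := (abs_le.1 (h1 y hy)).2
      have h6 : ∑ i, w i * loss M (y i) ≤ ρ := (hNV y hy).2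
      change ∑ i, out.2 i * loss M (y i) ≤ 2 * ρ
      linarith
    · rw [energy_indicator_eq, energy_indicator_eq]
      exact h2 y hy
    · intro i hiG hwi y hyV hy
      have hiS : i ∈ S := by
        by_contra hc
        exact hwi (hwS i hc)
      have h5 : s i * ρ / ε ^ p < w i * loss M (z i) := not_le.1 hiG
      rw [div_lt_iff₀ hεp0] at h5
      have h6 : w i * loss M (y i) ≤ s i * ρ :=
        (hsens i hiS y hyV).trans (mul_le_mul_of_nonneg_left hy (hs i hiS).le)
      have hwi0 : 0 < w i := lt_of_le_of_ne (hw i) (Ne.symm hwi)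
      refine le_of_mul_le_mul_left ?_ hwi0
      linarith
  · rw [add_zero, ← ENNReal.ofReal_add (by norm_num) (by norm_num),
      ← ENNReal.ofReal_add (by norm_num) (by norm_num)]
    norm_num
/-- One round of sampling with valid sensitivity bounds preserves energies. -/
theorem exists_failProb_preserves (p q cL : ℝ) (hp : 0 < p) (hq : 0 < q) (hcL : 0 < cL) :
    ∃ K : ℝ, 0 < K ∧ ∀ (cU : ℝ) (M : ℝ≥0 → ℝ≥0), IsAdmissibleLoss M p q cU cL →
      ∀ (n d : ℕ), 1 ≤ d → ∀ (b : Fin n → ℝ) (S : List (Fin n)), S.Nodup →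
      ∀ (w s : Fin n → ℝ), (∀ i, 0 ≤ w i) → (∀ i, i ∉ S → w i = 0) → (∀ i ∈ S, 0 < s i) →
      ∀ V : Submodule ℝ (Fin n → ℝ), Module.finrank ℝ V ≤ d →
      (∀ i ∈ S, ∀ y ∈ V, w i * loss M (y i) ≤ s i * energy M w y) →
      ∀ ε m : ℝ, 0 < ε → ε ≤ 1 / 2 → K * d * Real.log (1 / ε) / ε ^ (2 + p) ≤ m →
      ∀ (z : Fin n → ℝ) (β ρ : ℝ), 0 < β → β ≤ ρ → energy M w z ≤ β →
        failProb b (sampleRows m S w s) (fun out =>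
          Preserves M V w out.2 z β ρ (2 * roundConst p 4000 * ε) 4000) ≤
            ENNReal.ofReal (1 / 1000) := by
  obtain ⟨K, hK, h⟩ := exists_failProb_residual p q cL hp hq hcL
  refine ⟨K, hK, ?_⟩
  intro cU M hM n d hd b S hS w s hw hwS hs V hV hsens ε m hε0 hε hm z β ρ hβ0 hβρ hzβ
  have h1 := h cU M hM n d hd b S hS w s hw hwS hs V hV hsens ε m hε0 hε hm z β ρ hβ0 hβρ hzβ
  have h2 := h cU M hM n d hd b S hS w s hw hwS hs V hV hsens ε m hε0 hε hm 0 β ρ hβ0 hβρ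
    (by rw [hM.energy_zero]; exact hβ0.le)
  refine (failProb_mono _ (Q := fun out => _ ∧ _) ?_).trans ((failProb_and_le _ _ _).trans
    ((add_le_add h1 h2).trans_eq ?_))
  · rintro out ⟨⟨⟨ζ, hζ⟩, h3⟩, ⟨ζ', hζ'⟩, -⟩
    have hρ : 0 < ρ := by linarith
    have hC : 0 ≤ roundConst p 4000 := by unfold roundConst; positivity
    have hCε : 0 ≤ roundConst p 4000 * ε * ρ := by positivity
    refine ⟨fun y hyV hy => ?_, ⟨ζ, fun y hyV hy => (hζ y hyV hy).trans (by linarith)⟩, h3⟩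
    have h4 := hζ' y hyV hy
    have h5 := hζ' 0 V.zero_mem (by rw [hM.energy_zero]; exact hρ.le)
    simp only [sub_zero, hM.energy_zero, zero_sub, abs_neg] at h4 h5
    rw [abs_le] at h4 h5 ⊢
    constructor <;> linarith [h4.1, h4.2, h5.1, h5.2]
  · rw [← ENNReal.ofReal_add (by norm_num) (by norm_num)]
    norm_num

/-! ### Hashing -/
namespace Prog
variable {n : ℕ} {b : Fin n → ℝ}
/-- One iteration of the loop of `hashRows`. -/
noncomputable def hashBody (k : ℕ+) (table : Fin (k : ℕ) → List (Fin n)) (i : Fin n) :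
    Prog n (Fin (k : ℕ) → List (Fin n)) := do
  let c ← uniform k
  prim (Function.update table c (i :: table c))
theorem hashRows_eq (S : List (Fin n)) (k : ℕ+) :
    hashRows S k = forEach S (fun _ => []) (hashBody k) := rfl
/-- The buckets of `table` form a partition of `S`. -/
structure IsHashTable (S : List (Fin n)) {k : ℕ} (table : Fin k → List (Fin n)) : Prop where
  nodup : ∀ c, (table c).Nodup
  subset : ∀ c, ∀ i ∈ table c, i ∈ S
  exists_mem : ∀ i ∈ S, ∃ c, i ∈ table c
  sum_eq : ∀ f : Fin n → ℝ, ∑ c, ((table c).map f).sum = (S.map f).sum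
theorem sum_update_cons {R : Type*} [AddCommMonoid R] {k : ℕ} (table : Fin k → List (Fin n))
    (c : Fin k) (i : Fin n) (f : Fin n → R) :
    ∑ c', ((Function.update table c (i :: table c) c').map f).sum =
      f i + ∑ c', ((table c').map f).sum := by
  have h : ∀ t : Fin k → List (Fin n), ∑ c', ((t c').map f).sum =
      ((t c).map f).sum + ∑ c' ∈ Finset.univ.erase c, ((t c').map f).sum := fun t =>
    (Finset.add_sum_erase _ (fun c' => ((t c').map f).sum) (Finset.mem_univ c)).symm
  rw [h, h table, Function.update_self, List.map_cons, List.sum_cons, add_assoc]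
  congr 2
  refine Finset.sum_congr rfl fun c' hc' => ?_
  rw [Function.update_of_ne (Finset.ne_of_mem_erase hc')]
theorem triple_hashRows {S : List (Fin n)} (hS : S.Nodup) (k : ℕ+) :
    Triple b (hashRows S k) 0 (3 * S.length) 0 (IsHashTable S) := by
  rw [hashRows_eq]
  have := Triple.forEach_sure (b := b) (f := hashBody k)
    (fun l table => IsHashTable l table) (fun _ => 2) S (fun _ => [])
    ⟨by simp, by simp, by simp, by simp⟩ ?_
  · exact this.mono le_rfl (by simp; linarith) le_rfl fun _ h => h
  · rintro l i r table rfl ⟨h1, h2, h3, h4⟩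
    have hi : ∀ c, i ∉ table c := fun c h => by
      have := h2 c i h
      rw [List.nodup_append] at hS
      exact hS.2.2 i this i (by simp) rfl
    refine Triple.uniform_bind fun c => Triple.prim (by norm_num) le_rfl ⟨?_, ?_, ?_, ?_⟩
    · intro c'
      rcases eq_or_ne c' c with rfl | hc
      · rw [Function.update_self]; exact List.nodup_cons.2 ⟨hi _, h1 _⟩
      · rw [Function.update_of_ne hc]; exact h1 _
    · intro c' j hj
      rcases eq_or_ne c' c with rfl | hc
      · rw [Function.update_self] at hj
        rcases List.mem_cons.1 hj with rfl | hj
        · simp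
        · simp [h2 _ j hj]
      · rw [Function.update_of_ne hc] at hj; simp [h2 _ j hj]
    · intro j hj
      rcases List.mem_append.1 hj with hj | hj
      · obtain ⟨c', hc'⟩ := h3 j hj
        refine ⟨c', ?_⟩
        rcases eq_or_ne c' c with rfl | hc
        · rw [Function.update_self]; exact List.mem_cons_of_mem _ hc'
        · rwa [Function.update_of_ne hc]
      · refine ⟨c, ?_⟩
        rw [Function.update_self, List.mem_singleton.1 hj]
        exact List.mem_cons_self
    · intro f
      rw [sum_update_cons, h4]
      simp [add_comm]
open Classical in
/-- The total mass of the bucket that contains `i` (`0` if `i` is not in the table). -/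
noncomputable def bucketMass (a : Fin n → ℝ≥0∞) (i : Fin n) {k : ℕ}
    (table : Fin k → List (Fin n)) : ℝ≥0∞ :=
  ∑ c, if i ∈ table c then ((table c).map a).sum else 0
open Classical in
theorem bucketMass_update_cons (a : Fin n → ℝ≥0∞) {i j : Fin n} (hij : j ≠ i) {k : ℕ}
    (table : Fin k → List (Fin n)) (c : Fin k) :
    bucketMass a i (Function.update table c (j :: table c)) =
      bucketMass a i table + if i ∈ table c then a j else 0 := by
  have h : ∀ t : Fin k → List (Fin n), bucketMass a i t =
      (if i ∈ t c then ((t c).map a).sum else 0) +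
        ∑ c' ∈ Finset.univ.erase c, if i ∈ t c' then ((t c').map a).sum else 0 := fun t =>
    (Finset.add_sum_erase _ (fun c' => if i ∈ t c' then ((t c').map a).sum else 0)
      (Finset.mem_univ c)).symm
  rw [h, h table, Function.update_self]
  have h2 : ∑ c' ∈ Finset.univ.erase c, (if i ∈ Function.update table c (j :: table c) c' then
      ((Function.update table c (j :: table c) c').map a).sum else 0) =
      ∑ c' ∈ Finset.univ.erase c, if i ∈ table c' then ((table c').map a).sum else 0 := by
    refine Finset.sum_congr rfl fun c' hc' => ?_
    rw [Function.update_of_ne (Finset.ne_of_mem_erase hc')]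
  rw [h2]
  by_cases hi : i ∈ table c
  · simp [hi]; ring
  · simp [hi, hij.symm]
theorem ev_hashBody (k : ℕ+) (table : Fin (k : ℕ) → List (Fin n)) (i : Fin n)
    (g : (Fin (k : ℕ) → List (Fin n)) → ℝ≥0∞) :
    ev b (hashBody k table i) g =
      ∑ c, ((k : ℕ) : ℝ≥0∞)⁻¹ * g (Function.update table c (i :: table c)) := by
  simp only [hashBody, ev_bind, ev_prim, ev_uniform]
theorem sum_inv_mul_const (k : ℕ+) (x : ℝ≥0∞) :
    ∑ _c : Fin (k : ℕ), ((k : ℕ) : ℝ≥0∞)⁻¹ * x = x := by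
  have hk : ((k : ℕ) : ℝ≥0∞) ≠ 0 := by exact_mod_cast k.ne_zero
  rw [Finset.sum_const, Finset.card_univ, Fintype.card_fin, nsmul_eq_mul, ← mul_assoc,
    ENNReal.mul_inv_cancel hk (ENNReal.natCast_ne_top _), one_mul]
open Classical in
/-- Every row hashed after `i` lands in the bucket of `i` with probability `1 / k`. -/
theorem ev_bucketMass_of_notMem (k : ℕ+) (a : Fin n → ℝ≥0∞) (i : Fin n) (l : List (Fin n))
    (hi : i ∉ l) (table : Fin (k : ℕ) → List (Fin n)) :
    ev b (forEach l table (hashBody k)) (bucketMass a i) = bucketMass a i table +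
      ((k : ℕ) : ℝ≥0∞)⁻¹ * ((∑ c, if i ∈ table c then 1 else 0) * (l.map a).sum) := by
  induction l generalizing table with
  | nil => simp [ev_forEach_nil]
  | cons j l ih =>
    rw [List.mem_cons, not_or] at hi
    have hcount : ∀ c, (∑ c', if i ∈ Function.update table c (j :: table c) c' then (1 : ℝ≥0∞) else 0) =
        ∑ c', if i ∈ table c' then 1 else 0 := by
      intro c
      refine Finset.sum_congr rfl fun c' _ => ?_
      rcases eq_or_ne c' c with rfl | hc
      · simp [hi.1]
      · rw [Function.update_of_ne hc]
    rw [ev_forEach_cons, ev_hashBody]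
    simp only [ih hi.2, bucketMass_update_cons a (Ne.symm hi.1), hcount, mul_add,
      Finset.sum_add_distrib, sum_inv_mul_const, List.map_cons, List.sum_cons]
    rw [← Finset.mul_sum, add_assoc]
    congr 2
    rw [Finset.sum_mul]
    congr 1
    refine Finset.sum_congr rfl fun c _ => ?_
    split_ifs <;> simp
theorem ev_bucketMass_of_mem (k : ℕ+) (a : Fin n → ℝ≥0∞) (i : Fin n) (ha : a i = 0)
    (l : List (Fin n)) (hl : l.Nodup) (hi : i ∈ l) (table : Fin (k : ℕ) → List (Fin n))
    (htable : ∀ c, i ∉ table c) :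
    ev b (forEach l table (hashBody k)) (bucketMass a i) =
      ((k : ℕ) : ℝ≥0∞)⁻¹ * (∑ c, ((table c).map a).sum + (l.map a).sum) := by
  classical
  induction l generalizing table with
  | nil => simp at hi
  | cons j l ih =>
    rw [ev_forEach_cons, ev_hashBody]
    rw [List.nodup_cons] at hl
    rcases eq_or_ne i j with rfl | hij
    · simp only [ev_bucketMass_of_notMem k a i l hl.1]
      have h1 : ∀ c, (∑ c', if i ∈ Function.update table c (i :: table c) c' then (1 : ℝ≥0∞) else 0) =
          1 := by
        intro c
        rw [Finset.sum_eq_single c]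
        · simp
        · intro c' _ hc'
          rw [Function.update_of_ne hc', if_neg (htable c')]
        · simp
      have h2 : ∀ c, bucketMass a i (Function.update table c (i :: table c)) =
          ((table c).map a).sum := by
        intro c
        rw [bucketMass, Finset.sum_eq_single c]
        · simp [ha]
        · intro c' _ hc'
          rw [Function.update_of_ne hc', if_neg (htable c')]
        · simp
      simp only [h1, h2, one_mul, mul_add, Finset.sum_add_distrib, sum_inv_mul_const,
        List.map_cons, List.sum_cons, ha, zero_add]
      rw [← Finset.mul_sum]
    · have hil : i ∈ l := (List.mem_cons.1 hi).resolve_left hij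
      have h1 : ∀ c, ev b (forEach l (Function.update table c (j :: table c)) (hashBody k))
          (bucketMass a i) = ((k : ℕ) : ℝ≥0∞)⁻¹ *
            (∑ c, ((table c).map a).sum + ((j :: l).map a).sum) := by
        intro c
        rw [ih hl.2 hil, sum_update_cons, List.map_cons, List.sum_cons]
        · congr 1; ring
        · intro c'
          rcases eq_or_ne c' c with rfl | hc
          · rw [Function.update_self, List.mem_cons, not_or]
            exact ⟨hij, htable _⟩
          · rw [Function.update_of_ne hc]; exact htable _
      simp only [h1, sum_inv_mul_const]
open Classical in
/-- If the total mass of the other rows is at most `2 ^ r` times `x`, then among `10 * 2 ^ r` random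
buckets, with probability `9/10`, the one containing `i` has less than `x` mass from other rows. -/
theorem failProb_hashRows_le {S : List (Fin n)} (hS : S.Nodup) (r : ℕ) {i : Fin n} (hi : i ∈ S)
    (f : Fin n → ℝ) (hf : ∀ j, 0 ≤ f j) {x : ℝ} (hx : 0 < x) (h : (S.map f).sum ≤ 2 ^ r * x) :
    failProb b (hashRows S (10 * 2 ^ r)) (fun table =>
      IsHashTable S table ∧ ∃ c, i ∈ table c ∧
        ((table c).map fun j => if j = i then 0 else f j).sum < x) ≤ ENNReal.ofReal (1 / 10) := by
  set a : Fin n → ℝ≥0∞ := fun j => ENNReal.ofReal (if j = i then 0 else f j) with ha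
  have hsum : ∀ l : List (Fin n), (l.map a).sum =
      ENNReal.ofReal (l.map fun j => if j = i then 0 else f j).sum := by
    intro l
    induction l with
    | nil => simp
    | cons j l ih =>
      have h0 : ∀ j, 0 ≤ if j = i then 0 else f j := fun j => by split_ifs; exacts [le_rfl, hf j]
      have : 0 ≤ (l.map fun j => if j = i then 0 else f j).sum := List.sum_nonneg (by
        intro x hx
        obtain ⟨j, -, rfl⟩ := List.mem_map.1 hx
        exact h0 j)
      simp only [List.map_cons, List.sum_cons]
      rw [ENNReal.ofReal_add (h0 j) this, ih]
  have h1 : failProb b (hashRows S (10 * 2 ^ r)) (IsHashTable S) ≤ 0 :=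
    (triple_hashRows (b := b) hS _).failProb_le
  have h2 : failProb b (hashRows S (10 * 2 ^ r)) (fun table => bucketMass a i table < ENNReal.ofReal x) ≤
      ENNReal.ofReal (1 / 10) := by
    refine (failProb_le_of_ev_le _ _ (bucketMass a i) (x := ENNReal.ofReal (1 / x))
      (y := ENNReal.ofReal (x / 10)) (fun table ht => ?_) ?_).trans_eq ?_
    · rw [not_lt] at ht
      refine le_trans ?_ (mul_le_mul_right ht _)
      rw [← ENNReal.ofReal_mul (by positivity), one_div_mul_cancel hx.ne', ENNReal.ofReal_one]
    · rw [hashRows_eq, ev_bucketMass_of_mem _ a i (by simp [ha]) S hS hi _ (by simp)]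
      simp only [List.map_nil, List.sum_nil, Finset.sum_const_zero, zero_add]
      rw [hsum]
      have hk : (((10 * 2 ^ r : ℕ+) : ℕ) : ℝ≥0∞)⁻¹ = ENNReal.ofReal (1 / (10 * 2 ^ r)) := by
        rw [one_div, ENNReal.ofReal_inv_of_pos (by positivity)]
        congr 1
        rw [ENNReal.ofReal_mul (by norm_num), ENNReal.ofReal_pow (by norm_num)]
        simp
      rw [hk, ← ENNReal.ofReal_mul (by positivity)]
      refine ENNReal.ofReal_le_ofReal ?_
      have h3 : (S.map fun j => if j = i then 0 else f j).sum ≤ (S.map f).sum :=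
        List.sum_le_sum fun j _ => by split_ifs; exacts [hf j, le_rfl]
      rw [one_div, inv_mul_eq_div, div_le_div_iff₀ (by positivity) (by norm_num)]
      linarith
    · rw [← ENNReal.ofReal_mul (by positivity)]
      congr 1; field_simp
  refine (failProb_mono _ (Q := fun table => _ ∧ _) ?_).trans ((failProb_and_le _ _ _).trans
    ((add_le_add h1 h2).trans_eq (zero_add _)))
  rintro table ⟨ht, hm⟩
  obtain ⟨c, hc⟩ := ht.exists_mem i hi
  refine ⟨ht, c, hc, ?_⟩
  have h4 : ((table c).map a).sum ≤ bucketMass a i table := by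
    rw [bucketMass]
    refine le_trans ?_ (Finset.single_le_sum (f := fun c => if i ∈ table c then
      ((table c).map a).sum else 0) (fun _ _ => zero_le) (Finset.mem_univ c))
    simp [hc]
  have h5 := h4.trans_lt hm
  rw [hsum] at h5
  exact (ENNReal.ofReal_lt_ofReal_iff hx).1 h5
end Prog

/-! ### Sensitivity bounds -/
section nnz
theorem nnz_eq_sum_rowNnz {m d : ℕ} (A : Matrix (Fin m) (Fin d) ℝ) : nnz A = ∑ i, rowNnz A i := by
  classical
  simp only [nnz, rowNnz, Set.ncard_eq_toFinset_card', Set.toFinset_ofPred]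
  rw [← Finset.univ_product_univ, Finset.card_filter, Finset.sum_product]
  exact Finset.sum_congr rfl fun i _ => (Finset.card_filter _ _).symm
theorem nnz_rowsOf {n d : ℕ} (A : Matrix (Fin n) (Fin d) ℝ) (l : List (Fin n)) :
    (nnz (rowsOf A l) : ℝ) = (l.map fun i => (rowNnz A i : ℝ)).sum := by
  rw [nnz_eq_sum_rowNnz, ← Fin.sum_univ_fun_getElem l fun i => (rowNnz A i : ℝ)]
  push_cast
  exact Finset.sum_congr rfl fun a _ => rfl
theorem sum_rowNnz_le {n d : ℕ} (A : Matrix (Fin n) (Fin d) ℝ) {l : List (Fin n)} (hl : l.Nodup) :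
    (l.map fun i => (rowNnz A i : ℝ)).sum ≤ nnz A := by
  rw [nnz_eq_sum_rowNnz, ← List.sum_toFinset _ hl]
  push_cast
  exact Finset.sum_le_sum_of_subset_of_nonneg (Finset.subset_univ _) fun i _ _ => Nat.cast_nonneg _
theorem sum_rowNnz_nonneg {n d : ℕ} (A : Matrix (Fin n) (Fin d) ℝ) (l : List (Fin n)) :
    0 ≤ (l.map fun i => (rowNnz A i : ℝ)).sum := by
  rw [← nnz_rowsOf]; exact Nat.cast_nonneg _
theorem List.Nodup.length_le {n : ℕ} {l : List (Fin n)} (hl : l.Nodup) : l.length ≤ n := by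
  simpa using hl.length_le_card
end nnz
theorem LewisRoutine.weights_nonneg {n d : ℕ} {p κ T : ℝ} (lewis : LewisRoutine n d p κ T) {m : ℕ}
    (B : Matrix (Fin m) (Fin d) ℝ) (i : Fin m) : 0 ≤ lewis.weights B i := by
  obtain ⟨w, hw, h⟩ := lewis.upper B
  exact (hw.1 i).trans (h i)
/-- In a bucket in which the loss of row `i` exceeds the total loss of the other rows, row `i` has
constant `ℓ_p` sensitivity, so that it is recognized by its Lewis weight. -/
theorem threshold_le_of_heavy {M : ℝ≥0 → ℝ≥0} {p q cU cL κ T : ℝ} (hM : IsAdmissibleLoss M p q cU cL)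
    (hp : 0 < p) (hcU : 1 ≤ cU) (hcL : 0 < cL) {n d : ℕ} (lewis : LewisRoutine n d p κ T)
    (A : Matrix (Fin n) (Fin d) ℝ) {l : List (Fin n)} (hl : l.Nodup) (a : Fin l.length)
    (x : Fin d → ℝ)
    (h : (l.map fun j => if j = l.get a then 0 else loss M (A.mulVec x j)).sum <
      loss M (A.mulVec x (l.get a))) :
    1 / (1 + cU) ≤ (d : ℝ) ^ max 0 (p / 2 - 1) * lewis.weights (rowsOf A l) a := by
  set y := A.mulVec x with hy
  obtain ⟨w, hw, hle⟩ := lewis.upper (rowsOf A l)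
  have hrow : ∀ a', (rowsOf A l).mulVec x a' = y (l.get a') := fun a' => rfl
  set i := l.get a with hi
  have h0 : ∀ j, 0 ≤ if j = i then 0 else loss M (y j) := fun j => by
    split_ifs; exacts [le_rfl, loss_nonneg _ _]
  rw [← Fin.sum_univ_fun_getElem l fun j => if j = i then 0 else loss M (y j)] at h
  change ∑ a' : Fin l.length, (if l.get a' = i then 0 else loss M (y (l.get a'))) < _ at h
  have hyi : 0 < loss M (y i) := lt_of_le_of_lt (Finset.sum_nonneg fun _ _ => h0 _) h
  have hyi0 : y i ≠ 0 := by
    intro h1; rw [h1, hM.loss_zero] at hyi; exact lt_irrefl _ hyi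
  have hpow : 0 < |y i| ^ p := Real.rpow_pos_of_pos (abs_pos.2 hyi0) p
  have hlt : ∀ a', |y (l.get a')| ≤ |y i| := by
    intro a'
    by_contra! hc
    have h1 := hM.loss_mono hc.le
    have h2 : l.get a' ≠ i := by rintro h3; rw [h3] at hc; exact lt_irrefl _ hc
    have h3 := Finset.single_le_sum (f := fun a' => if l.get a' = i then 0 else loss M (y (l.get a')))
      (fun _ _ => h0 _) (Finset.mem_univ a')
    simp only [if_neg h2] at h3
    linarith
  have hsum : ∑ a', |(rowsOf A l).mulVec x a'| ^ p ≤ (1 + cU) * |y i| ^ p := by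
    have h1 : ∀ a', |y (l.get a')| ^ p ≤ (if a' = a then |y i| ^ p else 0) +
        cU * |y i| ^ p / loss M (y i) * (if l.get a' = i then 0 else loss M (y (l.get a'))) := by
      intro a'
      by_cases ha' : a' = a
      · subst ha'; rw [← hi, if_pos rfl, if_pos rfl, mul_zero, add_zero]
      · have h2 : l.get a' ≠ i := fun h3 => ha' (List.nodup_iff_injective_get.1 hl h3)
        rw [if_neg ha', if_neg h2, zero_add, div_mul_eq_mul_div, le_div_iff₀ hyi]
        exact hM.abs_rpow_mul_loss_le hp hcU hcL (hlt a')
    simp only [hrow]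
    refine (Finset.sum_le_sum fun a' _ => h1 a').trans ?_
    rw [Finset.sum_add_distrib, ← Finset.mul_sum, Finset.sum_ite_eq' Finset.univ a,
      if_pos (Finset.mem_univ a), add_mul, one_mul]
    refine add_le_add le_rfl ?_
    rw [div_mul_eq_mul_div, div_le_iff₀ hyi]
    exact mul_le_mul_of_nonneg_left h.le (by positivity)
  have h1 := hw.rpow_abs_le hp x a
  rw [hrow] at h1
  have hD : 0 ≤ (d : ℝ) ^ max 0 (p / 2 - 1) := by positivity
  have h2 : |y i| ^ p ≤ (d : ℝ) ^ max 0 (p / 2 - 1) * lewis.weights (rowsOf A l) a *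
      ((1 + cU) * |y i| ^ p) := by
    refine h1.trans (mul_le_mul (mul_le_mul_of_nonneg_left (hle a) hD) hsum
      (Finset.sum_nonneg fun _ _ => Real.rpow_nonneg (abs_nonneg _) _)
      (mul_nonneg hD (lewis.weights_nonneg _ _)))
  rw [div_le_iff₀ (by linarith)]
  refine le_of_mul_le_mul_right ?_ hpow
  linarith
namespace Prog
variable {n d : ℕ} {b : Fin n → ℝ} {p κ T : ℝ}
/-- `s'` arises from `s` by raising values on `S`, by a total of at most `x`. -/
structure Raises (S : List (Fin n)) (x : ℝ) (s s' : Fin n → ℝ) : Prop where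
  le : ∀ i, s i ≤ s' i
  eq : ∀ i, i ∉ S → s' i = s i
  sum_le : ∑ i, s' i ≤ ∑ i, s i + x
theorem Raises.refl (S : List (Fin n)) {x : ℝ} (hx : 0 ≤ x) (s : Fin n → ℝ) : Raises S x s s :=
  ⟨fun _ => le_rfl, fun _ _ => rfl, by linarith⟩
theorem Raises.trans {S : List (Fin n)} {x x' : ℝ} {s s' s'' : Fin n → ℝ} (h : Raises S x s s')
    (h' : Raises S x' s' s'') : Raises S (x + x') s s'' :=
  ⟨fun i => (h.le i).trans (h'.le i), fun i hi => (h'.eq i hi).trans (h.eq i hi), by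
    linarith [h.sum_le, h'.sum_le]⟩
theorem Raises.mono {S S' : List (Fin n)} {x x' : ℝ} {s s' : Fin n → ℝ} (h : Raises S x s s')
    (hS : ∀ i ∈ S, i ∈ S') (hx : x ≤ x') : Raises S' x' s s' :=
  ⟨h.le, fun i hi => h.eq i fun h' => hi (hS i h'), by linarith [h.sum_le]⟩
theorem raises_update {S : List (Fin n)} {s : Fin n → ℝ} {i : Fin n} (hi : i ∈ S) {v : ℝ}
    (hv : 0 ≤ v) (hs : 0 ≤ s i) : Raises S v s (Function.update s i (max v (s i))) := by
  refine ⟨fun j => ?_, fun j hj => ?_, ?_⟩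
  · rcases eq_or_ne j i with rfl | hj
    · simp
    · simp [hj]
  · rw [Function.update_of_ne (by rintro rfl; exact hj hi)]
  · have h : ∀ t : Fin n → ℝ, ∑ j, t j = t i + ∑ j ∈ Finset.univ.erase i, t j := fun t =>
      (Finset.add_sum_erase _ t (Finset.mem_univ i)).symm
    rw [h, h s, Function.update_self]
    have : ∑ j ∈ Finset.univ.erase i, Function.update s i (max v (s i)) j =
        ∑ j ∈ Finset.univ.erase i, s j :=
      Finset.sum_congr rfl fun j hj => by rw [Function.update_of_ne (Finset.ne_of_mem_erase hj)]
    rw [this]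
    rcases max_choice v (s i) with h | h <;> rw [h] <;> linarith
/-- Raise the values of the marked rows of one bucket to at least `v`. -/
noncomputable def markBucket (K : AlgConstants) (lewis : LewisRoutine n d p κ T)
    (A : Matrix (Fin n) (Fin d) ℝ) (D v : ℝ) (s : Fin n → ℝ) (l : List (Fin n)) :
    Prog n (Fin n → ℝ) := do
  let w ← callLewis lewis A l
  forEach (List.finRange l.length) s fun s a => do
    let i := l.get a
    let h ← prim (D * w a)
    let marked ← prim (decide (K.threshold ≤ h))
    if marked then do
      let x ← prim (max v (s i))
      prim (Function.update s i x)
    else pure s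
/-- One repetition of the hashing. -/
noncomputable def hashRound (K : AlgConstants) (lewis : LewisRoutine n d p κ T)
    (A : Matrix (Fin n) (Fin d) ℝ) (D v : ℝ) (k : ℕ+) (S : List (Fin n)) (s : Fin n → ℝ) :
    Prog n (Fin n → ℝ) := do
  let table ← hashRows S k
  forEach (List.finRange k) s fun s c => markBucket K lewis A D v s (table c)
/-- All repetitions of the hashing for one number of buckets. -/
noncomputable def hashLevel (K : AlgConstants) (lewis : LewisRoutine n d p κ T)
    (A : Matrix (Fin n) (Fin d) ℝ) (D : ℝ) (L : ℕ) (S : List (Fin n)) (s : Fin n → ℝ) (r₀ : ℕ) :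
    Prog n (Fin n → ℝ) := do
  let r := r₀ + 1
  let k : ℕ+ := 10 * 2 ^ r
  step 2
  let v ← prim ((2 : ℝ) / 2 ^ r)
  forEach (List.range L) s fun s _ => hashRound K lewis A D v k S s
/-- The number of bucket sizes for `len` rows. -/
noncomputable def levelCount (len : ℕ) (τ : ℝ) : ℕ := ⌈Real.logb 2 (len / τ)⌉₊
theorem sensitivityBounds_eq (K : AlgConstants) (lewis : LewisRoutine n d p κ T)
    (A : Matrix (Fin n) (Fin d) ℝ) (L : ℕ) (τ : ℝ) (S : List (Fin n)) :
    sensitivityBounds K lewis A L τ S = (do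
      let u ← prim (2 * τ)
      let s₀ ← prim (u / S.length)
      let s ← forEach S (fun _ => 0) fun s i => prim (Function.update s i s₀)
      let z ← prim (S.length / τ)
      let R ← prim ⌈Real.logb 2 z⌉₊
      let D ← prim ((d : ℝ) ^ max 0 (p / 2 - 1))
      forEach (List.range R) s (hashLevel K lewis A D L S)) := rfl
/-- The total by which marking the rows of one bucket raises the values, per unit of the value. -/
noncomputable def markTotal (K : AlgConstants) (κ : ℝ) (d : ℕ) (D : ℝ) : ℝ :=
  D * (κ * d) / K.threshold
theorem triple_callLewis (lewis : LewisRoutine n d p κ T)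
    (A : Matrix (Fin n) (Fin d) ℝ) {l : List (Fin n)} (hl : l.Nodup) :
    Triple b (callLewis lewis A l) 0
      ((1 + κ) * (l.map fun i => (rowNnz A i : ℝ)).sum + l.length + (1 + κ * T)) 0
      (fun w => w = lewis.weights (rowsOf A l)) := by
  refine Triple.step_bind (Triple.step_bind (Triple.pure ?_ le_rfl rfl))
  have h := lewis.time_le (rowsOf A l) hl.length_le
  push_cast
  rw [← nnz_rowsOf]
  linarith
theorem triple_markBucket (K : AlgConstants) (lewis : LewisRoutine n d p κ T)
    (A : Matrix (Fin n) (Fin d) ℝ) {D v : ℝ} (hD : 0 ≤ D) (hv : 0 ≤ v) {s : Fin n → ℝ}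
    (hs : ∀ i, 0 ≤ s i) {l : List (Fin n)} (hl : l.Nodup) :
    Triple b (markBucket K lewis A D v s l) 0
      ((1 + κ) * (l.map fun i => (rowNnz A i : ℝ)).sum + 6 * l.length + (1 + κ * T)) 0
      (fun s' => Raises l (v * markTotal K κ d D) s s' ∧
        ∀ a, K.threshold ≤ D * lewis.weights (rowsOf A l) a → v ≤ s' (l.get a)) := by
  set ω := lewis.weights (rowsOf A l) with hω
  have hω0 : ∀ a, 0 ≤ ω a := lewis.weights_nonneg _
  have hthr := K.threshold_pos
  refine ((triple_callLewis lewis A hl).bind (t' := 5 * l.length) (k' := 0) (φ' := 0)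
    (Q' := fun s' => Raises l (v * markTotal K κ d D) s s' ∧
        ∀ a, K.threshold ≤ D * ω a → v ≤ s' (l.get a)) ?_).mono (by simp)
    (by linarith) (by simp) fun _ h => h
  rintro _ rfl
  -- a marked row `a` raises the total by `v ≤ v * (D * ω a / K.threshold)`
  refine (Triple.forEach_sure (fun p' s' =>
    Raises l (v * (p'.map fun a => D * ω a / K.threshold).sum) s s' ∧
      ∀ a ∈ p', K.threshold ≤ D * ω a → v ≤ s' (l.get a)) (fun _ => 4) _ _ ?_ ?_).mono le_rfl ?_
      le_rfl ?_
  · exact ⟨Raises.refl _ (by simp) _, by simp⟩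
  · rintro p' a r s' hp ⟨h1, h2⟩
    refine Triple.prim_bind (Triple.prim_bind ?_)
    have hs' : ∀ i, 0 ≤ s' i := fun i => (hs i).trans (h1.le i)
    by_cases hm : K.threshold ≤ D * ω a
    · simp only [hω.symm, hm, decide_true, if_true]
      refine Triple.prim_bind (Triple.prim (by norm_num) le_rfl ⟨?_, ?_⟩)
      · have h3 := h1.trans (raises_update (List.get_mem l a) hv (hs' (l.get a)))
        refine h3.mono (fun _ h => h) ?_
        rw [List.map_append, List.sum_append, mul_add]
        simp only [List.map_cons, List.map_nil, List.sum_cons, List.sum_nil, add_zero]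
        have : 1 ≤ D * ω a / K.threshold := (one_le_div hthr).2 hm
        nlinarith
      · intro a' ha' hm'
        rcases eq_or_ne a' a with rfl | hne
        · rw [Function.update_self]; exact le_max_left _ _
        · have ha'' : a' ∈ p' := by simpa [hne] using ha'
          have hne' : l.get a' ≠ l.get a := fun h => hne (List.nodup_iff_injective_get.1 hl h)
          rw [Function.update_of_ne hne']
          exact h2 a' ha'' hm'
    · simp only [hω.symm, hm, decide_false]
      refine Triple.pure (by norm_num) le_rfl ⟨?_, ?_⟩
      · refine h1.mono (fun _ h => h) ?_
        rw [List.map_append, List.sum_append, mul_add]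
        have : 0 ≤ v * ([a].map fun a => D * ω a / K.threshold).sum := by
          simp only [List.map_cons, List.map_nil, List.sum_cons, List.sum_nil, add_zero]
          have := hω0 a
          positivity
        linarith
      · intro a' ha' hm'
        rcases eq_or_ne a' a with rfl | hne
        · exact absurd hm' hm
        · exact h2 a' (by simpa [hne] using ha') hm'
  · simp; linarith
  · rintro s' ⟨h1, h2⟩
    refine ⟨h1.mono (fun _ h => h) ?_, fun a => h2 a (List.mem_finRange a)⟩
    refine mul_le_mul_of_nonneg_left ?_ hv
    rw [← List.ofFn_eq_map, List.sum_ofFn, ← Finset.sum_div, ← Finset.mul_sum, markTotal]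
    have := lewis.total (rowsOf A l)
    gcongr
theorem triple_markBuckets (K : AlgConstants) (lewis : LewisRoutine n d p κ T)
    (A : Matrix (Fin n) (Fin d) ℝ) {D v : ℝ} (hD : 0 ≤ D) (hv : 0 ≤ v) {s : Fin n → ℝ}
    (hs : ∀ i, 0 ≤ s i) {S : List (Fin n)} {k : ℕ} {table : Fin k → List (Fin n)}
    (ht : IsHashTable S table) :
    Triple b (forEach (List.finRange k) s fun s c => markBucket K lewis A D v s (table c)) 0
      ((1 + κ) * (S.map fun i => (rowNnz A i : ℝ)).sum + 6 * S.length + k * (2 + κ * T)) 0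
      (fun s' => Raises S (k * (v * markTotal K κ d D)) s s' ∧
        ∀ c a, K.threshold ≤ D * lewis.weights (rowsOf A (table c)) a →
          v ≤ s' ((table c).get a)) := by
  have hthr := K.threshold_pos
  refine (Triple.forEach_sure (fun l s' =>
    Raises S (l.length * (v * markTotal K κ d D)) s s' ∧
      ∀ c ∈ l, ∀ a, K.threshold ≤ D * lewis.weights (rowsOf A (table c)) a →
          v ≤ s' ((table c).get a)) (fun c => (1 + κ) * ((table c).map fun i =>
            (rowNnz A i : ℝ)).sum + 6 * (table c).length + (1 + κ * T)) _ _ ?_ ?_).mono le_rfl ?_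
      le_rfl ?_
  · exact ⟨Raises.refl _ (by simp) _, by simp⟩
  · rintro l c r s' hl ⟨h1, h2⟩
    refine (triple_markBucket K lewis A hD hv (fun i => (hs i).trans (h1.le i))
      (ht.nodup c)).mono le_rfl le_rfl le_rfl ?_
    rintro s'' ⟨h3, h4⟩
    refine ⟨(h1.trans (h3.mono (ht.subset c) le_rfl)).mono (fun _ h => h) ?_, ?_⟩
    · simp only [List.length_append, List.length_cons, List.length_nil]
      push_cast
      linarith
    · intro c' hc' a ha
      rcases List.mem_append.1 hc' with hc' | hc'
      · exact (h2 c' hc' a ha).trans (h3.le _)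
      · rw [List.mem_singleton] at hc'
        subst hc'
        exact h4 a ha
  · rw [← List.ofFn_eq_map, List.sum_ofFn]
    have h1 := ht.sum_eq fun i => (rowNnz A i : ℝ)
    have h2 := ht.sum_eq fun _ => (1 : ℝ)
    simp only [List.map_const', List.sum_replicate, nsmul_eq_mul, mul_one] at h2
    simp only [Finset.sum_add_distrib, ← Finset.mul_sum, h1, h2, Finset.sum_const, Finset.card_univ,
      Fintype.card_fin, nsmul_eq_mul]
    linarith
  · rintro s' ⟨h1, h2⟩
    refine ⟨by simpa using h1, fun c => h2 c (List.mem_finRange c)⟩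
theorem triple_hashRound (K : AlgConstants) (lewis : LewisRoutine n d p κ T)
    (A : Matrix (Fin n) (Fin d) ℝ) {D v : ℝ} (hD : 0 ≤ D) (hv : 0 ≤ v) {s : Fin n → ℝ}
    (hs : ∀ i, 0 ≤ s i) {S : List (Fin n)} (hS : S.Nodup) (k : ℕ+) :
    Triple b (hashRound K lewis A D v k S s) 0
      ((1 + κ) * (S.map fun i => (rowNnz A i : ℝ)).sum + 9 * S.length + (k : ℕ) * (2 + κ * T)) 0
      (fun s' => Raises S ((k : ℕ) * (v * markTotal K κ d D)) s s') := by
  refine ((triple_hashRows (b := b) hS k).bind fun table ht =>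
    (triple_markBuckets K lewis A hD hv hs ht).mono le_rfl le_rfl le_rfl fun _ h => h.1).mono
    (by simp) (by linarith) (by simp) fun _ h => h
end Prog

namespace Prog
variable {n d : ℕ} {b : Fin n → ℝ} {p κ T : ℝ}
theorem triple_hashLevel (K : AlgConstants) (lewis : LewisRoutine n d p κ T)
    (A : Matrix (Fin n) (Fin d) ℝ) {D : ℝ} (hD : 0 ≤ D) (L : ℕ) {s : Fin n → ℝ}
    (hs : ∀ i, 0 ≤ s i) {S : List (Fin n)} (hS : S.Nodup) (r₀ : ℕ) :
    Triple b (hashLevel K lewis A D L S s r₀) 0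
      (3 + L * (1 + (1 + κ) * (S.map fun i => (rowNnz A i : ℝ)).sum + 9 * S.length) +
        L * (20 * (2 + κ * T)) * 2 ^ r₀) 0
      (fun s' => Raises S (L * (20 * markTotal K κ d D)) s s') := by
  refine Triple.step_bind (Triple.prim_bind ?_)
  have hk : (((10 * 2 ^ (r₀ + 1) : ℕ+) : ℕ) : ℝ) = 10 * 2 ^ (r₀ + 1) := by simp
  refine (Triple.forEach_sure (fun l s' => Raises S (l.length * (20 * markTotal K κ d D)) s s')
    (fun _ => (1 + κ) * (S.map fun i => (rowNnz A i : ℝ)).sum + 9 * S.length +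
      10 * 2 ^ (r₀ + 1) * (2 + κ * T)) _ _ ?_ ?_).mono le_rfl ?_ le_rfl ?_
  · exact Raises.refl _ (by simp) _
  · intro l a r s' hl h
    refine (triple_hashRound K lewis A hD (by positivity) (fun i => (hs i).trans (h.le i)) hS
      _).mono le_rfl (by rw [hk]) le_rfl fun s'' h' => (h.trans h').mono (fun _ h => h) ?_
    rw [hk]
    simp only [List.length_append, List.length_cons, List.length_nil]
    push_cast
    have : 10 * (2 : ℝ) ^ (r₀ + 1) * (2 / 2 ^ (r₀ + 1) * markTotal K κ d D) =
        20 * markTotal K κ d D := by field_simp; ring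
    linarith
  · simp only [List.map_const', List.sum_replicate, nsmul_eq_mul, List.length_range, pow_succ]
    push_cast
    linarith
  · intro s' h
    simpa using h
theorem two_pow_levelCount_le {len : ℕ} {τ : ℝ} (hτ : 0 < τ) :
    (2 : ℝ) ^ levelCount len τ - 1 ≤ 2 * (len / τ) := by
  have h0 : 0 ≤ len / τ := by positivity
  rcases Nat.eq_zero_or_pos (levelCount len τ) with h | h
  · rw [h]; simp; positivity
  · have h1 : 0 < Real.logb 2 (len / τ) := Nat.ceil_pos.1 h
    have h2 := Nat.ceil_lt_add_one h1.le
    have h3 : 0 < len / τ := by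
      rcases h0.eq_or_lt with h3 | h3
      · rw [← h3] at h1; simp at h1
      · exact h3
    have h4 : (2 : ℝ) ^ ((levelCount len τ : ℕ) : ℝ) ≤ 2 ^ (Real.logb 2 (len / τ) + 1) :=
      Real.rpow_le_rpow_of_exponent_le (by norm_num) h2.le
    rw [Real.rpow_natCast, Real.rpow_add_one (by norm_num),
      Real.rpow_logb (by norm_num) (by norm_num) h3] at h4
    linarith
theorem le_two_pow_levelCount (len : ℕ) {τ : ℝ} (hτ : 0 < τ) :
    (len : ℝ) / τ ≤ 2 ^ levelCount len τ := by
  rcases (Nat.cast_nonneg (α := ℝ) len).eq_or_lt with h | h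
  · rw [← h]; simp
  · rw [← Real.rpow_natCast, ← Real.logb_le_iff_le_rpow (by norm_num) (by positivity)]
    exact Nat.le_ceil _
/-- The time that `sensitivityBounds` takes for `len` rows with `nz` nonzero entries. -/
noncomputable def sensitivityTime (κ T : ℝ) (L R : ℕ) (τ nz len : ℝ) : ℝ :=
  5 + 2 * len + R * (4 + L * (1 + (1 + κ) * nz + 9 * len)) + 40 * L * (2 + κ * T) * (len / τ)
/-- The properties of the sensitivity bounds that hold with certainty. -/
structure IsBound (S : List (Fin n)) (τ x : ℝ) (s : Fin n → ℝ) : Prop where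
  le : ∀ i ∈ S, 2 * τ / S.length ≤ s i
  eq_zero : ∀ i, i ∉ S → s i = 0
  sum_le : ∑ i, s i ≤ 2 * τ + x
theorem IsBound.pos {S : List (Fin n)} {τ x : ℝ} {s : Fin n → ℝ} (h : IsBound S τ x s) (hτ : 0 < τ)
    {i : Fin n} (hi : i ∈ S) : 0 < s i := by
  refine lt_of_lt_of_le ?_ (h.le i hi)
  have : (0 : ℝ) < S.length := by exact_mod_cast List.length_pos_of_mem hi
  positivity
theorem IsBound.nonneg {S : List (Fin n)} {τ x : ℝ} {s : Fin n → ℝ} (h : IsBound S τ x s)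
    (hτ : 0 < τ) (i : Fin n) : 0 ≤ s i := by
  by_cases hi : i ∈ S
  · exact (h.pos hτ hi).le
  · exact (h.eq_zero i hi).ge
theorem triple_initBounds {S : List (Fin n)} (hS : S.Nodup) {τ : ℝ} (hτ : 0 < τ) :
    Triple b (forEach S (fun _ => (0 : ℝ)) fun s i =>
      prim (Function.update s i (2 * τ / S.length))) 0 (2 * S.length) 0 (IsBound S τ 0) := by
  classical
  refine (Triple.forEach_sure (fun l s => s = fun i => if i ∈ l then 2 * τ / S.length else 0)
    (fun _ => 1) _ _ (by simp) ?_).mono le_rfl (by simp; linarith) le_rfl ?_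
  · rintro l i r s - rfl
    refine Triple.prim le_rfl le_rfl ?_
    ext j
    rcases eq_or_ne j i with rfl | hj
    · simp
    · simp [hj]
  · rintro s rfl
    refine ⟨fun i hi => by simp [hi], fun i hi => by simp [hi], ?_⟩
    have h1 : ∑ i, (if i ∈ S then 2 * τ / (S.length : ℝ) else 0) = S.length * (2 * τ / S.length) := by
      rw [← Finset.sum_filter, Finset.sum_const, nsmul_eq_mul]
      congr 2
      rw [← List.toFinset_card_of_nodup hS]
      congr 1
      ext i; simp
    rw [h1, add_zero]
    rcases (Nat.cast_nonneg (α := ℝ) S.length).eq_or_lt with h | h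
    · rw [← h]; simp; positivity
    · rw [mul_div_cancel₀ _ h.ne']
theorem sum_range_geometric (R : ℕ) (c e : ℝ) :
    ((List.range R).map fun r => 1 + (3 + c + e * 2 ^ r)).sum = R * (4 + c) + e * (2 ^ R - 1) := by
  induction R with
  | zero => simp
  | succ R ih =>
    rw [List.range_succ, List.map_append, List.sum_append, ih]
    simp only [List.map_cons, List.map_nil, List.sum_cons, List.sum_nil, pow_succ]
    push_cast
    ring
theorem triple_sensitivityBounds (K : AlgConstants) (lewis : LewisRoutine n d p κ T)
    (hκT : 0 ≤ κ * T)
    (A : Matrix (Fin n) (Fin d) ℝ) (L : ℕ) {τ : ℝ} (hτ : 0 < τ) {S : List (Fin n)} (hS : S.Nodup) :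
    Triple b (sensitivityBounds K lewis A L τ S) 0
      (sensitivityTime κ T L (levelCount S.length τ) τ (S.map fun i => (rowNnz A i : ℝ)).sum
        S.length) 0
      (IsBound S τ (levelCount S.length τ *
        (L * (20 * markTotal K κ d ((d : ℝ) ^ max 0 (p / 2 - 1)))))) := by
  rw [sensitivityBounds_eq]
  set D := (d : ℝ) ^ max 0 (p / 2 - 1) with hD
  have hD0 : 0 ≤ D := by positivity
  set R := levelCount S.length τ with hR
  refine Triple.prim_bind (Triple.prim_bind ?_)
  refine ((triple_initBounds hS hτ).bind (φ' := 0)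
    (t' := 3 + R * (4 + L * (1 + (1 + κ) * (S.map fun i => (rowNnz A i : ℝ)).sum + 9 * S.length)) +
      40 * L * (2 + κ * T) * (S.length / τ)) (k' := 0)
    (Q' := IsBound S τ (R * (L * (20 * markTotal K κ d D)))) fun s hs => ?_).mono (by simp)
    (by rw [sensitivityTime]; linarith) (by simp) fun _ h => h
  refine Triple.prim_bind (Triple.prim_bind (Triple.prim_bind ?_))
  have hs0 := hs.nonneg hτ
  refine (Triple.forEach_sure (fun l s' => Raises S (l.length * (L * (20 * markTotal K κ d D))) s s')
    (fun r₀ => 3 + L * (1 + (1 + κ) * (S.map fun i => (rowNnz A i : ℝ)).sum + 9 * S.length) +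
        L * (20 * (2 + κ * T)) * 2 ^ r₀) _ _ ?_ ?_).mono le_rfl ?_ le_rfl ?_
  · exact Raises.refl _ (by simp) _
  · intro l r₀ l' s' hl h
    refine (triple_hashLevel K lewis A hD0 L (fun i => (hs0 i).trans (h.le i)) hS r₀).mono le_rfl
      le_rfl le_rfl fun s'' h' => (h.trans h').mono (fun _ h => h) ?_
    simp only [List.length_append, List.length_cons, List.length_nil]
    push_cast
    linarith
  · change ((List.range R).map _).sum ≤ _
    rw [sum_range_geometric]
    have h2 := two_pow_levelCount_le (len := S.length) hτ
    rw [← hR] at h2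
    have h3 : L * (20 * (2 + κ * T)) * (2 ^ R - 1) ≤
        L * (20 * (2 + κ * T)) * (2 * (S.length / τ)) :=
      mul_le_mul_of_nonneg_left h2 (by positivity)
    linarith
  · intro s' h
    rw [List.length_range] at h
    have h1 : Raises S (R * (L * (20 * markTotal K κ d D))) s s' := h
    exact ⟨fun i hi => (hs.le i hi).trans (h1.le i), fun i hi => (h1.eq i hi).trans (hs.eq_zero i hi),
      by linarith [h1.sum_le, hs.sum_le]⟩
open Classical in
/-- One repetition of the hashing with `10 * 2 ^ r` buckets multiplies the probability that a row
of sensitivity at least `1 / 2 ^ r` has not been marked yet by at most `1 / 10`. -/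
theorem ev_hashRound_le (K : AlgConstants) (lewis : LewisRoutine n d p κ T)
    (A : Matrix (Fin n) (Fin d) ℝ) {M : ℝ≥0 → ℝ≥0} {q cU cL : ℝ} (hM : IsAdmissibleLoss M p q cU cL)
    (hp : 0 < p) (hcU : 1 ≤ cU) (hcL : 0 < cL) (hK : K.threshold = 1 / (1 + cU)) {v : ℝ}
    (hv : 0 ≤ v) {S : List (Fin n)} (hS : S.Nodup) {i : Fin n} (hi : i ∈ S) (r : ℕ) (x : Fin d → ℝ)
    (hpos : 0 < loss M (A.mulVec x i))
    (hr : (S.map fun j => loss M (A.mulVec x j)).sum ≤ 2 ^ r * loss M (A.mulVec x i))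
    (s : Fin n → ℝ) (hs : ∀ i, 0 ≤ s i) :
    ev b (hashRound K lewis A ((d : ℝ) ^ max 0 (p / 2 - 1)) v (10 * 2 ^ r) S s)
      (fun s' => if v ≤ s' i then 0 else 1) ≤
        ENNReal.ofReal (1 / 10) * if v ≤ s i then 0 else 1 := by
  set D := (d : ℝ) ^ max 0 (p / 2 - 1) with hD
  have hD0 : 0 ≤ D := by positivity
  by_cases hvs : v ≤ s i
  · have h1 := (triple_hashRound (b := b) K lewis A hD0 hv hs hS (10 * 2 ^ r)).failProb_le
    refine (ev_mono_of_failProb (g' := fun _ => 0) h1 fun s' hs' => ?_).trans ?_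
    · rw [if_pos (hvs.trans (hs'.le i))]
    · rw [ev_const]; exact zero_le
  · rw [if_neg hvs, mul_one, hashRound, ev_bind]
    have h1 := failProb_hashRows_le (b := b) hS r hi (fun j => loss M (A.mulVec x j))
      (fun j => loss_nonneg _ _) hpos hr
    refine (ev_mono _ fun table => ?_).trans h1
    split_ifs with h
    · obtain ⟨ht, c, hc, hlt⟩ := h
      have h2 := (triple_markBuckets (b := b) K lewis A hD0 hv hs ht).failProb_le
      refine (ev_mono_of_failProb (g' := fun _ => 0) h2 ?_).trans (by rw [ev_const])
      rintro s' ⟨-, hs'⟩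
      obtain ⟨a, rfl⟩ := List.get_of_mem hc
      have h3 := threshold_le_of_heavy hM hp hcU hcL lewis A (ht.nodup c) a x (by convert hlt)
      rw [← hK] at h3
      rw [if_pos (hs' c a h3)]
    · refine (ev_mono (g' := fun _ => 1) _ fun s' => ?_).trans_eq (ev_const _ _)
      split_ifs <;> simp
open Classical in
/-- A row of sensitivity at least `1 / 2 ^ (r₀ + 1)` fails to be marked in all of the `L` independent
repetitions with probability at most `10 ^ (-L)`. -/
theorem failProb_sensitivityBounds_of_level (K : AlgConstants) (lewis : LewisRoutine n d p κ T)
    (A : Matrix (Fin n) (Fin d) ℝ) {M : ℝ≥0 → ℝ≥0} {q cU cL : ℝ} (hM : IsAdmissibleLoss M p q cU cL)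
    (hp : 0 < p) (hcU : 1 ≤ cU) (hcL : 0 < cL) (hK : K.threshold = 1 / (1 + cU)) (L : ℕ) {τ : ℝ}
    (hτ : 0 < τ) {S : List (Fin n)} (hS : S.Nodup) {i : Fin n} (hi : i ∈ S) {r₀ : ℕ}
    (hr₀ : r₀ < levelCount S.length τ) (x : Fin d → ℝ) (hpos : 0 < loss M (A.mulVec x i))
    (hr : (S.map fun j => loss M (A.mulVec x j)).sum ≤ 2 ^ (r₀ + 1) * loss M (A.mulVec x i)) :
    failProb b (sensitivityBounds K lewis A L τ S) (fun s => 2 / 2 ^ (r₀ + 1) ≤ s i) ≤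
      ENNReal.ofReal (1 / 10) ^ L := by
  rw [sensitivityBounds_eq]
  set D := (d : ℝ) ^ max 0 (p / 2 - 1) with hD
  have hD0 : 0 ≤ D := by positivity
  set g : (Fin n → ℝ) → ℝ≥0∞ := fun s => if 2 / 2 ^ (r₀ + 1) ≤ s i then 0 else 1 with hg
  have hg1 : ∀ s, g s ≤ 1 := fun s => by simp only [hg]; split_ifs <;> simp
  simp only [failProb, ev_bind, ev_prim]
  have h1 := (triple_initBounds (b := b) hS hτ).failProb_le
  refine (ev_mono_of_failProb (g' := fun _ => ENNReal.ofReal (1 / 10) ^ L) h1 fun s hs => ?_).trans_eq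
    (ev_const _ _)
  refine (ev_forEach_le (b := b) (fun s : Fin n → ℝ => ∀ i, 0 ≤ s i)
    (fun r => if r = r₀ then ENNReal.ofReal (1 / 10) ^ L else 1) g _ _ ?_ ?_ s
    (hs.nonneg hτ)).trans ?_
  · intro s hs r _
    exact (failProb_mono _ fun s' hs' j => (hs j).trans (hs'.le j)).trans
      (triple_hashLevel (b := b) K lewis A hD0 L hs hS r).failProb_le
  · intro s hs r _
    split_ifs with hrr
    · subst hrr
      simp only [hashLevel, ev_bind, ev_step, ev_prim]
      refine (ev_forEach_le (b := b) (fun s : Fin n → ℝ => ∀ i, 0 ≤ s i)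
        (fun _ => ENNReal.ofReal (1 / 10)) g _ _ ?_ ?_ s hs).trans (by simp)
      · intro s hs _ _
        exact (failProb_mono _ fun s' hs' j => (hs j).trans (hs'.le j)).trans
          (triple_hashRound (b := b) K lewis A hD0 (by positivity) hs hS _).failProb_le
      · intro s hs _ _
        exact ev_hashRound_le K lewis A hM hp hcU hcL hK (by positivity) hS hi (r + 1) x hpos hr s hs
    · rw [one_mul]
      by_cases hgs : 2 / 2 ^ (r₀ + 1) ≤ s i
      · refine (ev_mono_of_failProb (g' := fun _ => 0)
          (triple_hashLevel (b := b) K lewis A hD0 L hs hS r).failProb_le fun s' hs' => ?_).trans ?_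
        · simp only [hg]; rw [if_pos (hgs.trans (hs'.le i))]
        · rw [ev_const]; exact zero_le
      · simp only [hg]
        rw [if_neg hgs]
        exact (ev_mono _ hg1).trans_eq (ev_const _ _)
  · have h2 : ((List.range (levelCount S.length τ)).map fun r =>
        if r = r₀ then ENNReal.ofReal (1 / 10) ^ L else 1).prod = ENNReal.ofReal (1 / 10) ^ L := by
      rw [← List.prod_toFinset _ List.nodup_range, Finset.prod_ite_eq']
      simp [hr₀]
    change ((List.range (levelCount S.length τ)).map _).prod * _ ≤ _
    rw [h2]
    exact (mul_le_mul_right (hg1 s) _).trans_eq (mul_one _)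
/-- With high probability, the bounds dominate the sensitivities of all rows. For every row it
suffices that it is marked at one level, which one vector `x` of nearly maximal ratio guarantees; so
a union bound over the rows is enough, although the conclusion concerns all `x`. -/
theorem failProb_sensitivityBounds_le (K : AlgConstants) (lewis : LewisRoutine n d p κ T)
    (hκT : 0 ≤ κ * T)
    (A : Matrix (Fin n) (Fin d) ℝ) {M : ℝ≥0 → ℝ≥0} {q cU cL : ℝ} (hM : IsAdmissibleLoss M p q cU cL)
    (hp : 0 < p) (hcU : 1 ≤ cU) (hcL : 0 < cL) (hK : K.threshold = 1 / (1 + cU)) (L : ℕ) {τ : ℝ}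
    (hτ : 0 < τ) {S : List (Fin n)} (hS : S.Nodup) :
    failProb b (sensitivityBounds K lewis A L τ S) (fun s => ∀ i ∈ S, ∀ x,
      loss M (A.mulVec x i) ≤ s i * (S.map fun j => loss M (A.mulVec x j)).sum) ≤
        S.length * ENNReal.ofReal (1 / 10) ^ L := by
  classical
  have hF0 : ∀ x, 0 ≤ (S.map fun j => loss M (A.mulVec x j)).sum := fun x => List.sum_nonneg (by
    intro t ht
    obtain ⟨j, -, rfl⟩ := List.mem_map.1 ht
    exact loss_nonneg _ _)
  set R := levelCount S.length τ with hR
  have key : ∀ i ∈ S.toFinset, failProb b (sensitivityBounds K lewis A L τ S) (fun s => ∀ x,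
      loss M (A.mulVec x i) ≤ s i * (S.map fun j => loss M (A.mulVec x j)).sum) ≤
        ENNReal.ofReal (1 / 10) ^ L := by
    intro i hi
    rw [List.mem_toFinset] at hi
    have hlen : (0 : ℝ) < S.length := by exact_mod_cast List.length_pos_of_mem hi
    by_cases hex : ∃ r, r ≤ R ∧ ∃ x, (S.map fun j => loss M (A.mulVec x j)).sum <
        2 ^ r * loss M (A.mulVec x i)
    · -- the level of the row: the smallest `r` such that its sensitivity exceeds `1 / 2 ^ r`
      obtain ⟨hrR, x, hx⟩ := Nat.find_spec hex
      set r := Nat.find hex with hr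
      have hr0 : r ≠ 0 := by
        intro h0
        rw [h0, pow_zero, one_mul] at hx
        have : loss M (A.mulVec x i) ≤ (S.map fun j => loss M (A.mulVec x j)).sum :=
          List.single_le_sum (by
            intro t ht
            obtain ⟨j, -, rfl⟩ := List.mem_map.1 ht
            exact loss_nonneg _ _) _ (List.mem_map_of_mem hi)
        linarith
      obtain ⟨r₀, hr₀⟩ := Nat.exists_eq_succ_of_ne_zero hr0
      have hmin := Nat.find_min hex (m := r₀) (by rw [← hr, hr₀]; exact Nat.lt_succ_self _)
      push Not at hmin
      rw [hr₀] at hx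
      have hpos : 0 < loss M (A.mulVec x i) :=
        pos_of_mul_pos_right ((hF0 x).trans_lt hx) (by positivity)
      refine (failProb_mono _ fun s hs x' => ?_).trans
        (failProb_sensitivityBounds_of_level K lewis A hM hp hcU hcL hK L hτ hS hi (r₀ := r₀)
          (by rw [← hR]; omega) x hpos hx.le)
      have h1 := hmin (by omega) x'
      have h2 : loss M (A.mulVec x' i) ≤ 2 / 2 ^ (r₀ + 1) *
          (S.map fun j => loss M (A.mulVec x' j)).sum := by
        rw [pow_succ, div_mul_eq_mul_div, le_div_iff₀ (by positivity)]
        linarith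
      exact h2.trans (mul_le_mul_of_nonneg_right hs (hF0 x'))
    · push Not at hex
      have h1 := (triple_sensitivityBounds (b := b) K lewis hκT A L hτ hS).failProb_le
      refine ((failProb_mono _ fun s hs x => ?_).trans h1).trans zero_le
      have h2 := hex R le_rfl x
      have h3 := le_two_pow_levelCount S.length hτ
      rw [div_le_iff₀ hτ] at h3
      have h4 : loss M (A.mulVec x i) ≤ 2 * τ / S.length *
          (S.map fun j => loss M (A.mulVec x j)).sum := by
        rw [div_mul_eq_mul_div, le_div_iff₀ hlen]
        have h5 := mul_le_mul_of_nonneg_left h3 (loss_nonneg M (A.mulVec x i))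
        have h6 := mul_le_mul_of_nonneg_left h2 hτ.le
        have h7 := mul_nonneg hτ.le (hF0 x)
        rw [← hR] at h5
        nlinarith
      exact h4.trans (mul_le_mul_of_nonneg_right (hs.le i hi) (hF0 x))
  refine (failProb_mono _ (Q := fun s : Fin n → ℝ => ∀ i ∈ S.toFinset, ∀ x, loss M (A.mulVec x i) ≤
    s i * (S.map fun j => loss M (A.mulVec x j)).sum) fun s hs i hi =>
      hs i (List.mem_toFinset.2 hi)).trans ((failProb_forall_le _ _ _).trans
      ((Finset.sum_le_sum key).trans ?_))
  rw [Finset.sum_const, nsmul_eq_mul, List.toFinset_card_of_nodup hS]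
end Prog

/-! ### Weighted sensitivity bounds -/
namespace Prog
variable {n d : ℕ} {b : Fin n → ℝ} {p κ T : ℝ}
theorem levelCount_le {len : ℕ} {τ : ℝ} (hτ : 1 ≤ τ) (h : len ≤ n) :
    levelCount len τ ≤ ⌈Real.logb 2 n⌉₊ := by
  rcases Nat.eq_zero_or_pos len with h0 | h0
  · subst h0; simp [levelCount]
  · refine Nat.ceil_le_ceil (Real.logb_le_logb_of_le (by norm_num) (by positivity) ?_)
    have h1 : (len : ℝ) ≤ n := by exact_mod_cast h
    exact (div_le_self (Nat.cast_nonneg _) hτ).trans h1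
/-- The index of the level set of the weight `x`. -/
noncomputable def levelOf (x : ℝ) : ℕ := ⌊Real.logb 2 x⌋₊
theorem two_pow_levelOf_le {x : ℝ} (hx : 1 ≤ x) : 2 ^ levelOf x ≤ x := by
  have h0 : 0 ≤ Real.logb 2 x := Real.logb_nonneg (by norm_num) hx
  rw [← Real.rpow_natCast, ← Real.le_logb_iff_rpow_le (by norm_num) (by linarith)]
  exact Nat.floor_le h0
theorem lt_two_pow_levelOf {x : ℝ} (hx : 1 ≤ x) : x < 2 ^ (levelOf x + 1) := by
  rw [← Real.rpow_natCast, ← Real.logb_lt_iff_lt_rpow (by norm_num) (by linarith)]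
  push_cast
  exact Nat.lt_floor_add_one _
theorem levelOf_lt {x y : ℝ} (hx : 1 ≤ x) (hxy : x ≤ y) : levelOf x < ⌈Real.logb 2 (1 + y)⌉₊ := by
  have h0 : 0 ≤ Real.logb 2 x := Real.logb_nonneg (by norm_num) hx
  have h1 : Real.logb 2 x < Real.logb 2 (1 + y) :=
    Real.logb_lt_logb (by norm_num) (by linarith) (by linarith)
  have h2 := Nat.floor_le h0
  have h3 := Nat.le_ceil (Real.logb 2 (1 + y))
  have : ((levelOf x : ℕ) : ℝ) < (⌈Real.logb 2 (1 + y)⌉₊ : ℝ) := by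
    rw [levelOf]; linarith
  exact_mod_cast this
/-- `level j` lists the rows of `S` whose weight lies in the `j`-th dyadic interval. -/
structure IsLevels (S : List (Fin n)) (w : Fin n → ℝ) (level : ℕ → List (Fin n)) : Prop where
  nodup : ∀ j, (level j).Nodup
  mem_iff : ∀ j i, i ∈ level j ↔ i ∈ S ∧ levelOf (w i) = j
theorem IsLevels.sum_le {S : List (Fin n)} {w : Fin n → ℝ} {level : ℕ → List (Fin n)}
    (h : IsLevels S w level) (hS : S.Nodup) (N : ℕ) {f : Fin n → ℝ} (hf : ∀ i, 0 ≤ f i) :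
    ∑ j ∈ Finset.range N, ((level j).map f).sum ≤ (S.map f).sum := by
  have h1 : ∀ j, ((level j).map f).sum =
      ∑ i ∈ S.toFinset, if levelOf (w i) = j then f i else 0 := by
    intro j
    rw [← List.sum_toFinset _ (h.nodup j), ← Finset.sum_filter]
    refine Finset.sum_congr ?_ fun _ _ => rfl
    ext i
    simp [h.mem_iff]
  simp only [h1]
  rw [Finset.sum_comm, ← List.sum_toFinset _ hS]
  refine Finset.sum_le_sum fun i _ => ?_
  rw [Finset.sum_ite_eq]
  split_ifs
  · exact le_rfl
  · exact hf i
theorem IsLevels.sum_length_le {S : List (Fin n)} {w : Fin n → ℝ} {level : ℕ → List (Fin n)}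
    (h : IsLevels S w level) (hS : S.Nodup) (N : ℕ) :
    ∑ j ∈ Finset.range N, ((level j).length : ℝ) ≤ S.length := by
  simpa using h.sum_le hS N (f := fun _ => 1) fun _ => zero_le_one
theorem triple_levels {S : List (Fin n)} (hS : S.Nodup) (w : Fin n → ℝ) :
    Triple b (forEach S (fun _ => ([] : List (Fin n))) fun (level : ℕ → List (Fin n)) i => do
      let j ← prim ⌊Real.logb 2 (w i)⌋₊
      prim (Function.update level j (i :: level j))) 0 (3 * S.length) 0 (IsLevels S w) := by
  refine (Triple.forEach_sure (fun l level => IsLevels l w level) (fun _ => 2) _ _ ?_ ?_).mono le_rfl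
    (by simp; linarith) le_rfl fun _ h => h
  · exact ⟨by simp, by simp⟩
  · rintro l i r level rfl ⟨h1, h2⟩
    have hi : ∀ j, i ∉ level j := fun j h => by
      have := ((h2 j i).1 h).1
      rw [List.nodup_append] at hS
      exact hS.2.2 i this i (by simp) rfl
    refine Triple.prim_bind (Triple.prim (by norm_num) le_rfl ?_)
    change IsLevels _ w (Function.update level (levelOf (w i)) (i :: level (levelOf (w i))))
    constructor
    · intro j
      rcases eq_or_ne j (levelOf (w i)) with rfl | hj
      · rw [Function.update_self]; exact List.nodup_cons.2 ⟨hi _, h1 _⟩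
      · rw [Function.update_of_ne hj]; exact h1 _
    · intro j i'
      rcases eq_or_ne j (levelOf (w i)) with rfl | hj
      · rw [Function.update_self, List.mem_cons, h2, List.mem_append, List.mem_singleton]
        constructor
        · rintro (rfl | h)
          · exact ⟨Or.inr rfl, rfl⟩
          · exact ⟨Or.inl h.1, h.2⟩
        · rintro ⟨h | rfl, h'⟩
          · exact Or.inr ⟨h, h'⟩
          · exact Or.inl rfl
      · rw [Function.update_of_ne hj, h2, List.mem_append, List.mem_singleton]
        constructor
        · rintro ⟨h, h'⟩; exact ⟨Or.inl h, h'⟩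
        · rintro ⟨h | rfl, h'⟩
          · exact ⟨h, h'⟩
          · exact absurd h'.symm hj
/-- The state of the values after the level sets in `l` have been processed. -/
structure LevelInv (M : ℝ≥0 → ℝ≥0) (A : Matrix (Fin n) (Fin d) ℝ) (level : ℕ → List (Fin n))
    (x : ℝ) (l : List ℕ) (acc : Fin n → ℝ) : Prop where
  pos : ∀ j ∈ l, ∀ i ∈ level j, 0 < acc i
  valid : ∀ j ∈ l, ∀ i ∈ level j, ∀ y, 2 * loss M (A.mulVec y i) ≤
    acc i * ((level j).map fun i => loss M (A.mulVec y i)).sum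
  eq_zero : ∀ i, (∀ j ∈ l, i ∉ level j) → acc i = 0
  sum_le : ∑ i, acc i ≤ l.length * x
theorem triple_double {l : List (Fin n)} (acc s : Fin n → ℝ) :
    Triple b (forEach l acc fun acc i => do
      let x ← prim (2 * s i)
      prim (Function.update acc i x)) 0 (3 * l.length) 0
      (fun acc' => ∀ i, acc' i = if i ∈ l then 2 * s i else acc i) := by
  classical
  refine (Triple.forEach_sure (fun l acc' => ∀ i, acc' i = if i ∈ l then 2 * s i else acc i)
    (fun _ => 2) _ _ (by simp) ?_).mono le_rfl (by simp; linarith) le_rfl fun _ h => by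
      intro i; convert h i
  intro l i r acc' _ h
  refine Triple.prim_bind (Triple.prim (by norm_num) le_rfl fun j => ?_)
  rcases eq_or_ne j i with rfl | hj
  · simp
  · rw [Function.update_of_ne hj, h j]
    simp [hj]
/-- The properties of weighted sensitivity bounds. -/
structure IsWeightedBound (M : ℝ≥0 → ℝ≥0) (A : Matrix (Fin n) (Fin d) ℝ) (S : List (Fin n))
    (w : Fin n → ℝ) (x : ℝ) (t : Fin n → ℝ) : Prop where
  pos : ∀ i ∈ S, 0 < t i
  valid : ∀ i ∈ S, ∀ y, w i * loss M (A.mulVec y i) ≤ t i * energy M w (A.mulVec y)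
  eq_zero : ∀ i, i ∉ S → t i = 0
  sum_le : ∑ i, t i ≤ x
/-- The time that `weightedSensitivityBounds` takes for `len` rows with `nz` nonzero entries, for at
most `N` level sets and at most `R` bucket sizes for each of them. -/
noncomputable def weightedTime (κ T : ℝ) (L R N : ℕ) (τ nz len : ℝ) : ℝ :=
  1 + 10 * len + N * (6 + 4 * R + L * R) + L * R * ((1 + κ) * nz + 9 * len) +
    40 * L * (2 + κ * T) * (len / τ)
theorem IsLevels.mul_loss_le {M : ℝ≥0 → ℝ≥0} {S : List (Fin n)} {w : Fin n → ℝ}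
    {level : ℕ → List (Fin n)} (h : IsLevels S w level) (hw : ∀ i ∈ S, 1 ≤ w i)
    (hwS : ∀ i, i ∉ S → w i = 0) {i : Fin n} (hi : i ∈ S) {t : ℝ} (ht : 0 ≤ t) (z : Fin n → ℝ)
    (hz : 2 * loss M (z i) ≤ t * ((level (levelOf (w i))).map fun i => loss M (z i)).sum) :
    w i * loss M (z i) ≤ t * energy M w z := by
  set j := levelOf (w i) with hj
  have hw0 : ∀ i, 0 ≤ w i := fun i => by
    by_cases hi : i ∈ S
    · linarith [hw i hi]
    · exact (hwS i hi).ge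
  have h1 : 2 ^ j * ((level j).map fun i => loss M (z i)).sum ≤ energy M w z := by
    rw [← List.sum_toFinset _ (h.nodup j), Finset.mul_sum]
    refine (Finset.sum_le_sum (g := fun i => w i * loss M (z i)) fun i' hi' => ?_).trans
      (Finset.sum_le_sum_of_subset_of_nonneg (Finset.subset_univ _) fun i _ _ =>
        mul_nonneg (hw0 i) (loss_nonneg _ _))
    obtain ⟨h2, h3⟩ := (h.mem_iff j i').1 (List.mem_toFinset.1 hi')
    rw [← h3]
    exact mul_le_mul_of_nonneg_right (two_pow_levelOf_le (hw i' h2)) (loss_nonneg _ _)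
  have h2 := (lt_two_pow_levelOf (hw i hi)).le
  rw [← hj, pow_succ] at h2
  calc w i * loss M (z i) ≤ 2 ^ j * 2 * loss M (z i) :=
        mul_le_mul_of_nonneg_right h2 (loss_nonneg _ _)
    _ = 2 ^ j * (2 * loss M (z i)) := by ring
    _ ≤ 2 ^ j * (t * ((level j).map fun i => loss M (z i)).sum) :=
        mul_le_mul_of_nonneg_left hz (by positivity)
    _ = t * (2 ^ j * ((level j).map fun i => loss M (z i)).sum) := by ring
    _ ≤ _ := mul_le_mul_of_nonneg_left h1 ht
theorem sensitivityTime_le {L R R' : ℕ} (hR : R ≤ R') (hκ : 0 ≤ κ) {τ nz len : ℝ} (hnz : 0 ≤ nz)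
    (hlen : 0 ≤ len) :
    sensitivityTime κ T L R τ nz len ≤ sensitivityTime κ T L R' τ nz len := by
  have : (R : ℝ) ≤ R' := by exact_mod_cast hR
  unfold sensitivityTime
  gcongr
theorem triple_levelStep (K : AlgConstants) (lewis : LewisRoutine n d p κ T) (hκ : 0 ≤ κ)
    (hT : 0 ≤ T) (A : Matrix (Fin n) (Fin d) ℝ) {M : ℝ≥0 → ℝ≥0} {q cU cL : ℝ}
    (hM : IsAdmissibleLoss M p q cU cL)
    (hp : 0 < p) (hcU : 1 ≤ cU) (hcL : 0 < cL) (hK : K.threshold = 1 / (1 + cU)) (L : ℕ) {τ : ℝ}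
    (hτ : 1 ≤ τ) {S : List (Fin n)} {w : Fin n → ℝ} {level : ℕ → List (Fin n)}
    (hlev : IsLevels S w level) {x : ℝ}
    (hx : 2 * (2 * τ + ⌈Real.logb 2 n⌉₊ *
      (L * (20 * markTotal K κ d ((d : ℝ) ^ max 0 (p / 2 - 1))))) ≤ x)
    {l : List ℕ} {j : ℕ} (hj : j ∉ l) {acc : Fin n → ℝ} (hacc : LevelInv M A level x l acc) :
    Triple b (do
      let s ← sensitivityBounds K lewis A L τ (level j)
      forEach (level j) acc fun acc i => do
        let x ← prim (2 * s i)
        prim (Function.update acc i x)) ((level j).length * ENNReal.ofReal (1 / 10) ^ L)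
      (sensitivityTime κ T L ⌈Real.logb 2 n⌉₊ τ ((level j).map fun i => (rowNnz A i : ℝ)).sum
        (level j).length + 3 * (level j).length) 0
      (LevelInv M A level x (l ++ [j])) := by
  have hκT : 0 ≤ κ * T := by positivity
  have hτ0 : 0 < τ := by linarith
  have hlen := (hlev.nodup j).length_le
  have hR := levelCount_le hτ hlen
  have hdisj : ∀ i ∈ level j, ∀ j' ∈ l, i ∉ level j' := by
    intro i hi j' hj' hi'
    have h1 := ((hlev.mem_iff j i).1 hi).2
    have h2 := ((hlev.mem_iff j' i).1 hi').2
    rw [h1] at h2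
    exact hj (h2 ▸ hj')
  have h1 := (triple_sensitivityBounds (b := b) K lewis hκT A L hτ0 (hlev.nodup j)).and
    (failProb_sensitivityBounds_le (b := b) K lewis hκT A hM hp hcU hcL hK L hτ0 (hlev.nodup j))
  refine (h1.bind fun s hs => triple_double (b := b) (l := level j) acc s |>.mono le_rfl le_rfl le_rfl
    (Q' := LevelInv M A level x (l ++ [j])) ?_).mono (by simp) ?_ (by simp) fun _ h => h
  · intro acc' hacc'
    have hpos : ∀ i ∈ level j, 0 < s i := fun i hi => hs.1.pos hτ0 hi
    constructor
    · intro j' hj' i hi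
      rw [hacc']
      split_ifs with h
      · linarith [hpos i h]
      · rcases List.mem_append.1 hj' with hj' | hj'
        · exact hacc.pos j' hj' i hi
        · rw [List.mem_singleton.1 hj'] at hi; exact absurd hi h
    · intro j' hj' i hi y
      rw [hacc']
      split_ifs with h
      · have : j' = j := by
          rw [← ((hlev.mem_iff j i).1 h).2, ← ((hlev.mem_iff j' i).1 hi).2]
        subst this
        linarith [hs.2 i hi y]
      · rcases List.mem_append.1 hj' with hj' | hj'
        · exact hacc.valid j' hj' i hi y
        · rw [List.mem_singleton.1 hj'] at hi; exact absurd hi h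
    · intro i hi
      rw [hacc', if_neg (hi j (by simp))]
      exact hacc.eq_zero i fun j' hj' => hi j' (by simp [hj'])
    · have h2 : ∀ i, acc' i = acc i + 2 * s i := by
        intro i
        rw [hacc']
        split_ifs with h
        · rw [hacc.eq_zero i (hdisj i h), zero_add]
        · rw [hs.1.eq_zero i h]; ring
      simp only [h2, Finset.sum_add_distrib, ← Finset.mul_sum, List.length_append, List.length_cons,
        List.length_nil]
      have hR' : (levelCount (level j).length τ : ℝ) ≤ ⌈Real.logb 2 n⌉₊ := by exact_mod_cast hR
      have hmt : 0 ≤ (L : ℝ) * (20 * markTotal K κ d ((d : ℝ) ^ max 0 (p / 2 - 1))) := by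
        have := K.threshold_pos
        unfold markTotal
        positivity
      have h3 := mul_le_mul_of_nonneg_right hR' hmt
      push_cast
      linarith [hs.1.sum_le, hacc.sum_le]
  · have := sensitivityTime_le (κ := κ) (T := T) (L := L) (τ := τ) hR hκ
      (sum_rowNnz_nonneg A (level j)) (Nat.cast_nonneg (α := ℝ) (level j).length)
    linarith
theorem triple_weightedSensitivityBounds (K : AlgConstants) (lewis : LewisRoutine n d p κ T)
    (hκ : 0 ≤ κ) (hT : 0 ≤ T) (A : Matrix (Fin n) (Fin d) ℝ) {M : ℝ≥0 → ℝ≥0} {q cU cL : ℝ}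
    (hM : IsAdmissibleLoss M p q cU cL)
    (hp : 0 < p) (hcU : 1 ≤ cU) (hcL : 0 < cL) (hK : K.threshold = 1 / (1 + cU)) (L : ℕ) {τ : ℝ}
    (hτ : 1 ≤ τ) {S : List (Fin n)} (hS : S.Nodup) {w : Fin n → ℝ} (hw : ∀ i ∈ S, 1 ≤ w i)
    (hwS : ∀ i, i ∉ S → w i = 0) {W : ℝ} (hW0 : 0 ≤ W) (hW : ∀ i ∈ S, w i ≤ W) :
    Triple b (weightedSensitivityBounds K lewis A L τ S w)
      (S.length * ENNReal.ofReal (1 / 10) ^ L)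
      (weightedTime κ T L ⌈Real.logb 2 n⌉₊ ⌈Real.logb 2 (1 + W)⌉₊ τ
        (S.map fun i => (rowNnz A i : ℝ)).sum S.length) 0
      (IsWeightedBound M A S w (⌈Real.logb 2 (1 + W)⌉₊ * (2 * (2 * τ + ⌈Real.logb 2 n⌉₊ *
        (L * (20 * markTotal K κ d ((d : ℝ) ^ max 0 (p / 2 - 1)))))))) := by
  set R := ⌈Real.logb 2 n⌉₊ with hR
  set Y := 2 * (2 * τ + R * (L * (20 * markTotal K κ d ((d : ℝ) ^ max 0 (p / 2 - 1))))) with hY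
  have hY0 : 0 ≤ Y := by
    have := K.threshold_pos
    rw [hY]; unfold markTotal
    positivity
  have hwmax : Triple b (forEach S 0 fun t i => prim (max t (w i))) 0 (2 * S.length) 0
      (fun t => (∀ i ∈ S, w i ≤ t) ∧ 0 ≤ t ∧ t ≤ W) := by
    refine (Triple.forEach_sure (fun l t => (∀ i ∈ l, w i ≤ t) ∧ 0 ≤ t ∧ t ≤ W) (fun _ => 1) _ _
      ⟨by simp, le_rfl, hW0⟩ ?_).mono le_rfl (by simp; linarith) le_rfl fun _ h => h
    rintro l i r t hl ⟨h1, h2, h3⟩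
    refine Triple.prim le_rfl le_rfl ⟨fun i' hi' => ?_, h2.trans (le_max_left _ _),
      max_le h3 (hW i (by simp [hl]))⟩
    rcases List.mem_append.1 hi' with hi' | hi'
    · exact (h1 i' hi').trans (le_max_left _ _)
    · rw [List.mem_singleton.1 hi']; exact le_max_right _ _
  set N := ⌈Real.logb 2 (1 + W)⌉₊ with hN
  set nz := (S.map fun i => (rowNnz A i : ℝ)).sum with hnz
  refine (hwmax.bind (φ' := S.length * ENNReal.ofReal (1 / 10) ^ L)
    (t' := weightedTime κ T L R N τ nz S.length - 2 * S.length) (k' := 0)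
    (Q' := IsWeightedBound M A S w (N * Y)) ?_).mono (by simp) (by linarith) (by simp) fun _ h => h
  rintro wmax ⟨hwm, hwm0, hwmW⟩
  refine Triple.prim_bind ?_
  set N' := ⌈Real.logb 2 (1 + wmax)⌉₊ with hN'
  have hNN : N' ≤ N := Nat.ceil_le_ceil (Real.logb_le_logb_of_le (by norm_num) (by linarith)
    (by linarith))
  have hNN' : (N' : ℝ) ≤ N := by exact_mod_cast hNN
  refine ((triple_levels (b := b) hS w).bind (φ' := S.length * ENNReal.ofReal (1 / 10) ^ L)
    (t' := weightedTime κ T L R N τ nz S.length - 5 * S.length - 1) (k' := 0)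
    (Q' := IsWeightedBound M A S w (N * Y)) fun level hlev => ?_).mono (by simp) (by linarith)
    (by simp) fun _ h => h
  refine (Triple.forEach (fun l acc => LevelInv M A level Y l acc)
    (fun j => (level j).length * ENNReal.ofReal (1 / 10) ^ L)
    (fun j => sensitivityTime κ T L R τ ((level j).map fun i => (rowNnz A i : ℝ)).sum
        (level j).length + 3 * (level j).length) (fun _ => 0) _ _ ?_ ?_).mono ?_ ?_ (by simp) ?_
  · exact ⟨by simp, by simp, fun _ _ => rfl, by simp⟩
  · intro l j r acc hl hacc
    refine triple_levelStep K lewis hκ hT A hM hp hcU hcL hK L hτ hlev hY.ge ?_ hacc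
    have : (l ++ j :: r).Nodup := hl ▸ List.nodup_range
    rw [List.nodup_append] at this
    exact fun h => this.2.2 j h j (by simp) rfl
  · rw [← List.sum_toFinset _ List.nodup_range, List.toFinset_range, ← Finset.sum_mul]
    refine mul_le_mul_left ?_ _
    rw [← Nat.cast_sum]
    have h1 := hlev.sum_length_le hS N'
    exact_mod_cast h1
  · rw [← List.sum_toFinset _ List.nodup_range, List.toFinset_range]
    have h1 := hlev.sum_length_le hS N'
    have h2 := hlev.sum_le hS N' (f := fun i => (rowNnz A i : ℝ)) fun _ => Nat.cast_nonneg _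
    set nzs := ∑ j ∈ Finset.range N', ((level j).map fun i => (rowNnz A i : ℝ)).sum
    set lens := ∑ j ∈ Finset.range N', ((level j).length : ℝ)
    have h3 : ∑ j ∈ Finset.range N', (1 + (sensitivityTime κ T L R τ
        ((level j).map fun i => (rowNnz A i : ℝ)).sum (level j).length + 3 * (level j).length)) =
        N' * (6 + 4 * R + L * R) + 5 * lens + L * R * ((1 + κ) * nzs + 9 * lens) +
          40 * L * (2 + κ * T) * (lens / τ) := by
      have e : ∀ j, 1 + (sensitivityTime κ T L R τ
        ((level j).map fun i => (rowNnz A i : ℝ)).sum (level j).length + 3 * (level j).length) =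
          (6 + 4 * R + L * R) + (5 + L * R * 9 + 40 * L * (2 + κ * T) / τ) * (level j).length +
            (L * R * (1 + κ)) * ((level j).map fun i => (rowNnz A i : ℝ)).sum := by
        intro j; unfold sensitivityTime; ring
      rw [Finset.sum_congr rfl fun j _ => e j, Finset.sum_add_distrib, Finset.sum_add_distrib,
        ← Finset.mul_sum, ← Finset.mul_sum, Finset.sum_const, Finset.card_range, nsmul_eq_mul]
      ring
    refine h3.trans_le ?_
    have h4 : N' * (6 + 4 * R + L * R) + 5 * lens + L * R * ((1 + κ) * nzs + 9 * lens) +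
          40 * L * (2 + κ * T) * (lens / τ) ≤ N * (6 + 4 * R + L * R) + 5 * S.length +
          L * R * ((1 + κ) * nz + 9 * S.length) + 40 * L * (2 + κ * T) * (S.length / τ) := by
      gcongr
    unfold weightedTime
    linarith
  · intro acc hacc
    have hlt : ∀ i ∈ S, levelOf (w i) ∈ List.range N' := fun i hi =>
      List.mem_range.2 (levelOf_lt (hw i hi) (hwm i hi))
    have hmem : ∀ i ∈ S, i ∈ level (levelOf (w i)) := fun i hi => (hlev.mem_iff _ _).2 ⟨hi, rfl⟩
    have hpos : ∀ i ∈ S, 0 < acc i := fun i hi => hacc.pos _ (hlt i hi) i (hmem i hi)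
    refine ⟨hpos, fun i hi y => ?_, fun i hi => ?_, ?_⟩
    · exact hlev.mul_loss_le hw hwS hi (hpos i hi).le (A.mulVec y)
        (hacc.valid _ (hlt i hi) i (hmem i hi) y)
    · exact hacc.eq_zero i fun j _ h => hi ((hlev.mem_iff j i).1 h).1
    · refine hacc.sum_le.trans ?_
      rw [List.length_range]
      exact mul_le_mul_of_nonneg_right hNN' hY0
end Prog

/-! ### Two rounds of sampling -/
section
variable {M : ℝ≥0 → ℝ≥0} {ι : Type} [Fintype ι]
/-- Two rounds of reweighting compose; the second one has to work at a scale that is larger by the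
factor `H`, as the energy of `z` may have grown in the first one. -/
theorem Preserves.trans {V : Submodule ℝ (ι → ℝ)} {w w₁ w₂ z : ι → ℝ} {β ρ e H : ℝ}
    (hρ : 0 ≤ ρ) (he : e ≤ 1) (hH : 2 ≤ H) (h₁ : Preserves M V w w₁ z β ρ e H)
    (h₂ : Preserves M V w₁ w₂ z (H * β) (H * ρ) e H) :
    Preserves M V w w₂ z β ρ ((1 + H) * e) (H * H) := by
  have hy' : ∀ y ∈ V, energy M w y ≤ ρ → energy M w₁ y ≤ H * ρ := fun y hyV hy => by
    have h := (abs_le.1 (h₁.embed y hyV hy)).2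
    nlinarith
  obtain ⟨ζ₁, hζ₁⟩ := h₁.residual
  obtain ⟨ζ₂, hζ₂⟩ := h₂.residual
  refine ⟨fun y hyV hy => ?_, ⟨ζ₁ + ζ₂, fun y hyV hy => ?_⟩, ?_⟩
  · have h3 := abs_le.1 (h₁.embed y hyV hy)
    have h4 := abs_le.1 (h₂.embed y hyV (hy' y hyV hy))
    exact abs_le.2 ⟨by linarith, by linarith⟩
  · have h3 := abs_le.1 (hζ₁ y hyV hy)
    have h4 := abs_le.1 (hζ₂ y hyV (hy' y hyV hy))
    exact abs_le.2 ⟨by linarith, by linarith⟩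
  · exact h₂.target.trans_eq (by ring)
end
namespace Prog
variable {n d : ℕ} {b : Fin n → ℝ} {p κ T : ℝ}
/-- The outcome `out` of a sampling procedure, a list of at most `x` rows and weights for them, can
replace all rows with weight one in the regression problem `min ‖y - z‖` over `y ∈ V`. -/
structure IsReduction (M : ℝ≥0 → ℝ≥0) (V : Submodule ℝ (Fin n → ℝ)) (z : Fin n → ℝ)
    (β ρ e H x : ℝ) (out : List (Fin n) × (Fin n → ℝ)) : Prop where
  nodup : out.1.Nodup
  one_le : ∀ i ∈ out.1, 1 ≤ out.2 i
  eq_zero : ∀ i, i ∉ out.1 → out.2 i = 0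
  length_le : (out.1.length : ℝ) ≤ x
  preserves : Preserves M V (fun _ => 1) out.2 z β ρ e H
theorem IsSample.one_le {m : ℝ} {S : List (Fin n)} {w s : Fin n → ℝ}
    {out : List (Fin n) × (Fin n → ℝ)} (h : IsSample m S w s out) (hs : ∀ i ∈ S, 0 < m * s i)
    (hw : ∀ i ∈ S, 1 ≤ w i) {i : Fin n} (hi : i ∈ out.1) : 1 ≤ out.2 i := by
  have hiS := h.subset i hi
  rw [h.weight i hi, one_le_div (keepProb_pos (hs i hiS))]
  exact (keepProb_le_one m s i).trans (hw i hiS)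
theorem natCast_mul_pow_le {L : ℕ} (hn : 2 ≤ n) (hL : 12 * Real.log n ≤ L) :
    (n : ℝ≥0∞) * ENNReal.ofReal (1 / 10) ^ L ≤ ENNReal.ofReal (1 / 1000) := by
  have hn0 : (0 : ℝ) < n := by positivity
  have hn2 : (2 : ℝ) ≤ n := by exact_mod_cast hn
  rw [← ENNReal.ofReal_pow (by norm_num), ← ENNReal.ofReal_natCast, ← ENNReal.ofReal_mul hn0.le]
  refine ENNReal.ofReal_le_ofReal ?_
  have h1 : (1 / 10 : ℝ) ≤ Real.exp (-1) := by
    rw [Real.exp_neg, one_div]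
    exact inv_anti₀ (Real.exp_pos 1) (by linarith [Real.exp_one_lt_d9])
  have h2 : (1 / 10 : ℝ) ^ L ≤ ((n : ℝ) ^ 12)⁻¹ := by
    calc (1 / 10 : ℝ) ^ L ≤ Real.exp (-1) ^ L := pow_le_pow_left₀ (by norm_num) h1 L
      _ = Real.exp (-L) := by rw [← Real.exp_nat_mul]; congr 1; ring
      _ ≤ Real.exp (-(12 * Real.log n)) := Real.exp_le_exp.2 (by linarith)
      _ = ((n : ℝ) ^ 12)⁻¹ := by
        rw [Real.exp_neg]
        congr 1
        rw [show (12 : ℝ) * Real.log n = ((12 : ℕ) : ℝ) * Real.log n by norm_num,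
          Real.exp_nat_mul, Real.exp_log hn0]
  calc (n : ℝ) * (1 / 10) ^ L ≤ n * ((n : ℝ) ^ 12)⁻¹ := mul_le_mul_of_nonneg_left h2 hn0.le
    _ = ((n : ℝ) ^ 11)⁻¹ := by field_simp
    _ ≤ ((2 : ℝ) ^ 11)⁻¹ := inv_anti₀ (by positivity) (pow_le_pow_left₀ (by norm_num) hn2 11)
    _ ≤ 1 / 1000 := by norm_num
/-- A bound for the sum of the values that the marked rows contribute to sensitivity bounds. -/
noncomputable def hashTotal (K : AlgConstants) (p κ : ℝ) (d L R : ℕ) : ℝ :=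
  R * (L * (20 * markTotal K κ d ((d : ℝ) ^ max 0 (p / 2 - 1))))
/-- The time that `twoRoundSampling` takes for a matrix with `nz` nonzero entries, if the first
round keeps at most `x` rows. -/
noncomputable def twoRoundTime (κ T : ℝ) (n d L R N : ℕ) (nz x : ℝ) : ℝ :=
  1 + sensitivityTime κ T L R T nz n + 7 * n +
    (1 + 10 * n + N * (6 + 4 * R + L * R) + L * R * ((1 + κ) * nz + 9 * n) +
      40 * L * (2 + κ * T) * (x / d)) + 7 * n
theorem hashTotal_nonneg (K : AlgConstants) (hκ : 0 ≤ κ) (L R : ℕ) :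
    0 ≤ hashTotal K p κ d L R := by
  have := K.threshold_pos
  unfold hashTotal markTotal
  positivity
theorem finrank_range_mulVecLin_le (A : Matrix (Fin n) (Fin d) ℝ) :
    Module.finrank ℝ (LinearMap.range A.mulVecLin) ≤ d := by
  simpa using LinearMap.finrank_range_le A.mulVecLin
/-- Two rounds of sampling with a sufficiently large oversampling parameter reduce the regression
problem, whatever the target `z` is. -/
theorem exists_triple_twoRoundSampling (p q cL : ℝ) (hp : 0 < p) (hq : 0 < q) (hcL : 0 < cL) :
    ∃ K₁ : ℝ, 0 < K₁ ∧ ∀ (cU : ℝ), 1 ≤ cU → ∀ (M : ℝ≥0 → ℝ≥0), IsAdmissibleLoss M p q cU cL →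
      ∀ (K : AlgConstants), K.threshold = 1 / (1 + cU) → K.reps = 12 →
      ∀ (κ T : ℝ), 0 ≤ κ → 1 ≤ T → ∀ (n d : ℕ), 2 ≤ n → 1 ≤ d → ∀ (lewis : LewisRoutine n d p κ T)
        (A : Matrix (Fin n) (Fin d) ℝ) (b : Fin n → ℝ) (ε m : ℝ), 0 < ε → ε ≤ 1 / 2 → 1 / 2 ≤ m →
      K₁ * d * Real.log (1 / ε) / ε ^ (2 + p) ≤ m → 2 * roundConst p 4000 * ε ≤ 1 →
      ∀ (L R N : ℕ), L = ⌈12 * Real.log n⌉₊ → R = ⌈Real.logb 2 n⌉₊ → N = ⌈Real.logb 2 (1 + n)⌉₊ →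
      ∀ (z : Fin n → ℝ) (β ρ : ℝ), 0 < β → β ≤ ρ → energy M (fun _ => 1) z ≤ β →
        Triple b (twoRoundSampling K lewis A m) (ENNReal.ofReal (9 / 2000))
          (twoRoundTime κ T n d L R N (nnz A) (4000 * (m * (2 * T + hashTotal K p κ d L R)))) 0
          (IsReduction M (LinearMap.range A.mulVecLin) z β ρ
            ((1 + 4000) * (2 * roundConst p 4000 * ε)) (4000 * 4000)
            (4000 * (m * (N * (2 * (2 * d + hashTotal K p κ d L R)))))) := by
  obtain ⟨K₁, hK₁, hround⟩ := exists_failProb_preserves p q cL hp hq hcL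
  refine ⟨K₁, hK₁, ?_⟩
  intro cU hcU M hM K hthr hreps κ T hκ hT n d hn hd lewis A b ε m hε0 hε hm0 hm hε1 L R N hL hR hN
    z β ρ hβ hβρ hz
  have hκT : 0 ≤ κ * T := by positivity
  have hT0 : 0 < T := by linarith
  have hm0' : 0 < m := by linarith
  have hd1 : (1 : ℝ) ≤ d := by exact_mod_cast hd
  have hn0 : (0 : ℝ) < n := by positivity
  set V := LinearMap.range A.mulVecLin with hV
  have hVd : Module.finrank ℝ V ≤ d := finrank_range_mulVecLin_le A
  set X := hashTotal K p κ d L R with hX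
  have hX0 : 0 ≤ X := hashTotal_nonneg K hκ L R
  set e := 2 * roundConst p 4000 * ε with he
  have hsmall : ∀ {len : ℕ}, len ≤ n →
      (len : ℝ≥0∞) * ENNReal.ofReal (1 / 10) ^ L ≤ ENNReal.ofReal (1 / 1000) := fun h =>
    (mul_le_mul_left (by exact_mod_cast h) _).trans
      (natCast_mul_pow_le hn (by rw [hL]; exact Nat.le_ceil _))
  have hS : (List.finRange n).Nodup := List.nodup_finRange n
  have hmem : ∀ i : Fin n, i ∈ List.finRange n := List.mem_finRange
  have hnz : ((List.finRange n).map fun i => (rowNnz A i : ℝ)).sum ≤ nnz A := sum_rowNnz_le A hS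
  have hnz0 : 0 ≤ (nnz A : ℝ) := Nat.cast_nonneg _
  -- the first sensitivity bounds
  have t1 : Triple b (sensitivityBounds K lewis A L T (List.finRange n))
      (0 + ENNReal.ofReal (1 / 1000)) (sensitivityTime κ T L R T (nnz A) n) 0
      (fun s => IsBound (List.finRange n) T X s ∧ ∀ i ∈ List.finRange n, ∀ x,
        loss M (A.mulVec x i) ≤
          s i * ((List.finRange n).map fun j => loss M (A.mulVec x j)).sum) := by
    have hlc : levelCount (List.finRange n).length T ≤ R := hR ▸ levelCount_le hT (by simp)
    refine ((triple_sensitivityBounds (b := b) K lewis hκT A L hT0 hS).and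
      ((failProb_sensitivityBounds_le K lewis hκT A hM hp hcU hcL hthr L hT0 hS).trans
        (hsmall (by simp)))).mono le_rfl ?_ le_rfl ?_
    · refine (sensitivityTime_le hlc hκ (sum_rowNnz_nonneg A _) (Nat.cast_nonneg _)).trans ?_
      rw [List.length_finRange]
      unfold sensitivityTime
      gcongr
    · rintro s ⟨h1, h2⟩
      refine ⟨⟨h1.le, h1.eq_zero, h1.sum_le.trans ?_⟩, h2⟩
      have hlc' : (levelCount (List.finRange n).length T : ℝ) ≤ R := by exact_mod_cast hlc
      have := K.threshold_pos
      rw [hX, hashTotal]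
      unfold markTotal
      gcongr
  have hsumS : ∀ x, ((List.finRange n).map fun j => loss M (A.mulVec x j)).sum =
      energy M (fun _ => 1) (A.mulVec x) := fun x => by
    rw [← List.sum_toFinset _ hS, List.toFinset_finRange]
    simp [energy]
  have hsum : ∀ {S : List (Fin n)} {s : Fin n → ℝ} {y : ℝ}, S.Nodup → (∀ i, i ∉ S → s i = 0) →
      ∑ i, s i ≤ y → (S.map fun i => m * s i).sum ≤ m * y := fun {S s y} hS hs0 hy => by
    rw [← List.sum_toFinset _ hS, ← Finset.mul_sum,
      Finset.sum_subset (Finset.subset_univ _) (fun i _ hi => hs0 i (by simpa using hi))]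
    exact mul_le_mul_of_nonneg_left hy hm0'.le
  -- the first round
  have t2 : ∀ s, (IsBound (List.finRange n) T X s ∧ ∀ i ∈ List.finRange n, ∀ x,
        loss M (A.mulVec x i) ≤
          s i * ((List.finRange n).map fun j => loss M (A.mulVec x j)).sum) →
      Triple b (sampleRows m (List.finRange n) (fun _ => 1) s)
        (0 + ENNReal.ofReal (1 / 1000) + ENNReal.ofReal (1 / 4000)) (7 * n) 0
        (fun out => (IsSample m (List.finRange n) (fun _ => 1) s out ∧
          Preserves M V (fun _ => 1) out.2 z β ρ e 4000) ∧
          (out.1.length : ℝ) ≤ 4000 * (m * (2 * T + X))) := by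
    rintro s ⟨h1, h2⟩
    have hpos : ∀ i ∈ List.finRange n, 0 < m * s i := fun i hi => mul_pos hm0' (h1.pos hT0 hi)
    refine (((triple_sampleRows (b := b) m hS (fun _ => 1) s).and (hround cU M hM n d hd b _ hS
      (fun _ => 1) s (fun _ => zero_le_one) (fun i hi => absurd (hmem i) hi)
      (fun i hi => h1.pos hT0 hi) V hVd ?_ ε m hε0 hε hm z β ρ hβ hβρ hz)).and
      (failProb_length_le (H := 4000) (Q := m * (2 * T + X)) hpos (by positivity) (by norm_num)
        (hsum hS h1.eq_zero h1.sum_le))).mono le_rfl (by simp) le_rfl fun _ h => h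
    rintro i hi _ ⟨x, rfl⟩
    have := h2 i hi x
    rw [hsumS] at this
    simpa using this
  -- the second sensitivity bounds
  have t3 : ∀ s, IsBound (List.finRange n) T X s → ∀ first,
      IsSample m (List.finRange n) (fun _ => 1) s first →
      (first.1.length : ℝ) ≤ 4000 * (m * (2 * T + X)) →
      Triple b (weightedSensitivityBounds K lewis A L d first.1 first.2)
        (ENNReal.ofReal (1 / 1000))
        (1 + 10 * n + N * (6 + 4 * R + L * R) + L * R * ((1 + κ) * nnz A + 9 * n) +
          40 * L * (2 + κ * T) * (4000 * (m * (2 * T + X)) / d)) 0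
        (IsWeightedBound M A first.1 first.2 (N * (2 * (2 * d + X)))) := by
    intro s h1 first hf hlen
    have hpos : ∀ i ∈ List.finRange n, 0 < m * s i := fun i hi => mul_pos hm0' (h1.pos hT0 hi)
    have hw1 : ∀ i ∈ first.1, 1 ≤ first.2 i := fun i hi => hf.one_le hpos (fun _ _ => le_rfl) hi
    -- no row gets a weight above `n`, because the initial value of the bounds is `2 T / n`
    have hwn : ∀ i ∈ first.1, first.2 i ≤ n := fun i hi => by
      have h3 := h1.le i (hmem i)
      rw [List.length_finRange] at h3
      rw [hf.weight i hi, div_le_iff₀ (keepProb_pos (hpos i (hmem i))), keepProb]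
      have hn1 : (1 : ℝ) ≤ n := by exact_mod_cast (by omega : 1 ≤ n)
      have h4 : 1 ≤ n * (m * s i) := by
        calc (1 : ℝ) = n * (1 / 2 * (2 * 1 / n)) := by field_simp
          _ ≤ n * (m * s i) := by
            refine mul_le_mul_of_nonneg_left (mul_le_mul hm0 (le_trans ?_ h3) (by positivity)
              hm0'.le) hn0.le
            gcongr
      rcases le_total 1 (m * s i) with h | h
      · rw [min_eq_left h]; linarith
      · rwa [min_eq_right h]
    refine (triple_weightedSensitivityBounds (b := b) K lewis hκ hT0.le A hM hp hcU hcL hthr L hd1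
      hf.nodup hw1 hf.weight_zero hn0.le hwn).mono (hsmall hf.nodup.length_le) ?_ le_rfl ?_
    · rw [← hR, ← hN]
      have h3 : (first.1.length : ℝ) ≤ n := by exact_mod_cast hf.nodup.length_le
      have h4 := sum_rowNnz_le A hf.nodup
      unfold weightedTime
      gcongr
    · rw [← hR, ← hN, hX]
      exact fun _ h => h
  -- the second round
  have t4 : ∀ s, IsBound (List.finRange n) T X s → ∀ first,
      IsSample m (List.finRange n) (fun _ => 1) s first →
      Preserves M V (fun _ => 1) first.2 z β ρ e 4000 → ∀ t,
      IsWeightedBound M A first.1 first.2 (N * (2 * (2 * d + X))) t →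
      Triple b (sampleRows m first.1 first.2 t)
        (0 + ENNReal.ofReal (1 / 1000) + ENNReal.ofReal (1 / 4000)) (7 * n) 0
        (IsReduction M V z β ρ ((1 + 4000) * e) (4000 * 4000)
          (4000 * (m * (N * (2 * (2 * d + X)))))) := by
    intro s h1 first hf hpre t ht
    have hpos1 : ∀ i ∈ List.finRange n, 0 < m * s i := fun i hi => mul_pos hm0' (h1.pos hT0 hi)
    have hw1 : ∀ i ∈ first.1, 1 ≤ first.2 i := fun i hi => hf.one_le hpos1 (fun _ _ => le_rfl) hi
    have hw0 : ∀ i, 0 ≤ first.2 i := fun i => by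
      by_cases hi : i ∈ first.1
      · linarith [hw1 i hi]
      · exact (hf.weight_zero i hi).ge
    have hpos : ∀ i ∈ first.1, 0 < m * t i := fun i hi => mul_pos hm0' (ht.pos i hi)
    have hlen : (first.1.length : ℝ) ≤ n := by exact_mod_cast hf.nodup.length_le
    have hN0 : (0 : ℝ) < N := by
      rw [hN]
      refine Nat.cast_pos.2 (Nat.ceil_pos.2 (Real.logb_pos (by norm_num) (by linarith)))
    refine (((triple_sampleRows (b := b) m hf.nodup first.2 t).and (hround cU M hM n d hd b _
      hf.nodup first.2 t hw0 hf.weight_zero ht.pos V hVd ?_ ε m hε0 hε hm z (4000 * β) (4000 * ρ)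
      (by positivity) (by linarith) hpre.target)).and
      (failProb_length_le (H := 4000) (Q := m * (N * (2 * (2 * d + X)))) hpos (by positivity)
        (by norm_num) (hsum hf.nodup ht.eq_zero ht.sum_le))).mono le_rfl (by linarith) le_rfl ?_
    · rintro i hi _ ⟨x, rfl⟩
      exact ht.valid i hi x
    · rintro out ⟨⟨h3, h4⟩, h5⟩
      exact ⟨h3.nodup, fun i hi => h3.one_le hpos hw1 hi, h3.weight_zero, h5,
        hpre.trans (hβ.le.trans hβρ) hε1 (by norm_num) h4⟩
  unfold twoRoundSampling
  refine Triple.prim_bind ?_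
  rw [hreps, ← hL]
  refine (t1.bind fun s hs => (t2 s hs).bind fun first hf =>
    (t3 s hs.1 first hf.1.1 hf.2).bind fun t ht => t4 s hs.1 first hf.1.1 hf.1.2 t ht).mono
    ?_ ?_ (by simp) fun _ h => h
  · simp only [zero_add]
    repeat rw [← ENNReal.ofReal_add (by norm_num) (by norm_num)]
    exact ENNReal.ofReal_le_ofReal (by norm_num)
  · unfold twoRoundTime
    linarith
end Prog

/-! ### From reduced problems to the regression problem -/
section
variable {M : ℝ≥0 → ℝ≥0} {p q cU cL : ℝ} {ι : Type} [Fintype ι]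
/-- `y` solves the problem of minimizing `‖y - z‖_{M,w}` over `y ∈ V` within the factor `f`. -/
def IsApproxMin (M : ℝ≥0 → ℝ≥0) (p : ℝ) (V : Submodule ℝ (ι → ℝ)) (w z : ι → ℝ) (f : ℝ)
    (y : ι → ℝ) : Prop :=
  y ∈ V ∧ ∀ y' ∈ V, energy M w (y - z) ≤ f ^ p * energy M w (y' - z)
/-- The factor by which the energy may shrink when a vector is halved is at least the inverse of
this constant. -/
noncomputable def halvingConst (p cU : ℝ) : ℝ := cU * 2 ^ p
theorem one_le_halvingConst (hp : 0 < p) (hcU : 1 ≤ cU) : 1 ≤ halvingConst p cU := by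
  have := Real.one_le_rpow (by norm_num : (1 : ℝ) ≤ 2) hp.le
  unfold halvingConst
  nlinarith
namespace IsAdmissibleLoss
variable (hM : IsAdmissibleLoss M p q cU cL)
include hM
theorem energy_one_eq_zero (hcL : 0 < cL) {z : ι → ℝ} (h : energy M (fun _ => 1) z = 0) :
    z = 0 := by
  funext i
  by_contra hi
  have h1 := mul_loss_le_energy (M := M) (w := fun _ => 1) (fun _ => zero_le_one) z i
  have h2 := hM.loss_pos hcL hi
  linarith
/-- A lower bound for the new energies of all vectors follows from their approximation in an energy
ball: halve a vector outside of the ball until it enters the ball; then its old energy is still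
comparable to the radius, and its new energy has not increased. -/
theorem energy_le_of_embed (hp : 0 < p) (hq : 0 < q) (hcU : 1 ≤ cU) (hcL : 0 < cL) {w w' : ι → ℝ}
    (hw : ∀ i, 0 ≤ w i) (hw' : ∀ i, 0 ≤ w' i) {V : Submodule ℝ (ι → ℝ)} {ρ e : ℝ} (hρ : 0 < ρ)
    (he : e ≤ 1 / (2 * halvingConst p cU))
    (h : ∀ y ∈ V, energy M w y ≤ ρ → |energy M w' y - energy M w y| ≤ e * ρ) {y : ι → ℝ}
    (hy : y ∈ V) (hyρ : energy M w' y < ρ / (2 * halvingConst p cU)) : energy M w y ≤ ρ := by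
  by_contra! hlt
  have hc := one_le_halvingConst hp hcU
  set c := halvingConst p cU
  have hc0 : 0 < c := by linarith
  have hex : ∃ k : ℕ, energy M w ((1 / 2 : ℝ) ^ k • y) ≤ ρ := by
    have hlim : Filter.Tendsto (fun k : ℕ => ((1 / 2 : ℝ) ^ q) ^ k / cL * energy M w y)
        Filter.atTop (nhds (0 / cL * energy M w y)) :=
      ((tendsto_pow_atTop_nhds_zero_of_lt_one (by positivity)
        (Real.rpow_lt_one (by norm_num) (by norm_num) hq)).div_const _).mul_const _
    rw [zero_div, zero_mul] at hlim
    obtain ⟨k, hk, hk1⟩ := ((hlim.eventually_le_const hρ).and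
      (Filter.eventually_ge_atTop 1)).exists
    refine ⟨k, le_trans (hM.energy_smul_le hw hcL (by positivity)
      (pow_lt_one₀ (by norm_num) (by norm_num) (by omega)) y) ?_⟩
    rwa [← Real.rpow_natCast, ← Real.rpow_mul (by norm_num), mul_comm (k : ℝ),
      Real.rpow_mul (by norm_num), Real.rpow_natCast]
  classical
  obtain ⟨k, hk⟩ : ∃ k, Nat.find hex = k + 1 := by
    refine Nat.exists_eq_succ_of_ne_zero fun h0 => ?_
    have := Nat.find_spec hex
    rw [h0, pow_zero, one_smul] at this
    linarith
  have h1 : energy M w ((1 / 2 : ℝ) ^ (k + 1) • y) ≤ ρ := hk ▸ Nat.find_spec hex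
  have h2 : ρ < energy M w ((1 / 2 : ℝ) ^ k • y) := by
    have := Nat.find_min hex (m := k) (by omega)
    push Not at this
    exact this
  have h3 := hM.energy_le_half hw hp hcU hcL ((1 / 2 : ℝ) ^ k • y)
  rw [smul_smul, ← pow_succ'] at h3
  have h4 := abs_le.1 (h _ (V.smul_mem _ hy) h1)
  have h5 : energy M w' ((1 / 2 : ℝ) ^ (k + 1) • y) ≤ energy M w' y :=
    hM.energy_mono hw' fun i => by
      rw [Pi.smul_apply, smul_eq_mul, abs_mul, abs_of_nonneg (by positivity)]
      exact mul_le_of_le_one_left (abs_nonneg _) (pow_le_one₀ (by norm_num) (by norm_num))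
  change _ ≤ c * _ at h3
  have h6 : ρ / c ≤ energy M w ((1 / 2 : ℝ) ^ (k + 1) • y) := by
    rw [div_le_iff₀' hc0]; linarith
  have h7 : e * ρ ≤ 1 / (2 * c) * ρ := mul_le_mul_of_nonneg_right he hρ.le
  have h8 : ρ / c = 2 * (ρ / (2 * c)) := by field_simp
  have h9 : 1 / (2 * c) * ρ = ρ / (2 * c) := by ring
  linarith [h4.1]
/-- The new energies separate points, because every multiple of a vector whose new energy vanishes
lies in the energy ball. -/
theorem energy_eq_zero_of_embed (hp : 0 < p) (hq : 0 < q) (hcU : 1 ≤ cU) (hcL : 0 < cL)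
    {w w' : ι → ℝ}
    (hw : ∀ i, 0 ≤ w i) (hw' : ∀ i, 0 ≤ w' i) {V : Submodule ℝ (ι → ℝ)} {ρ e : ℝ} (hρ : 0 < ρ)
    (he : e ≤ 1 / (2 * halvingConst p cU))
    (h : ∀ y ∈ V, energy M w y ≤ ρ → |energy M w' y - energy M w y| ≤ e * ρ) {y : ι → ℝ}
    (hy : y ∈ V) (hy0 : energy M w' y = 0) : energy M w y = 0 := by
  have hc := one_le_halvingConst hp hcU
  have h1 : ∀ k : ℕ, energy M w ((2 : ℝ) ^ k • y) ≤ ρ := fun k => by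
    refine hM.energy_le_of_embed hp hq hcU hcL hw hw' hρ he h (V.smul_mem _ hy) ?_
    have h2 : energy M w' ((2 : ℝ) ^ k • y) = 0 := by
      have h3 := (Finset.sum_eq_zero_iff_of_nonneg
        (fun i _ => mul_nonneg (hw' i) (loss_nonneg M (y i)))).1 hy0
      refine Finset.sum_eq_zero fun i hi => ?_
      rcases mul_eq_zero.1 (h3 i hi) with h4 | h4
      · rw [h4, zero_mul]
      · have h5 : y i = 0 := by
          by_contra h5
          exact (hM.loss_pos hcL h5).ne' h4
        simp [h5, hM.loss_zero]
    rw [h2]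
    positivity
  have hlim : Filter.Tendsto (fun k : ℕ => ((1 / 2 : ℝ) ^ q) ^ k / cL * ρ)
      Filter.atTop (nhds (0 / cL * ρ)) :=
    ((tendsto_pow_atTop_nhds_zero_of_lt_one (by positivity)
      (Real.rpow_lt_one (by norm_num) (by norm_num) hq)).div_const _).mul_const _
  rw [zero_div, zero_mul] at hlim
  refine le_antisymm (ge_of_tendsto hlim ?_) (energy_nonneg hw y)
  filter_upwards [Filter.eventually_ge_atTop 1] with k hk
  have h2 := hM.energy_smul_le hw hcL (η := (1 / 2 : ℝ) ^ k) (by positivity)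
    (pow_lt_one₀ (by norm_num) (by norm_num) (by omega)) ((2 : ℝ) ^ k • y)
  rw [smul_smul, ← mul_pow, one_div_mul_cancel (by norm_num), one_pow, one_smul] at h2
  refine h2.trans ?_
  rw [← Real.rpow_natCast, ← Real.rpow_mul (by norm_num), mul_comm (k : ℝ),
    Real.rpow_mul (by norm_num), Real.rpow_natCast]
  exact mul_le_mul_of_nonneg_left (h1 k) (by positivity)
/-- Near-minimizers exist. If the infimum vanishes, then `b` lies in the closure of `V`, hence
in `V`, so that it is attained. -/
theorem exists_near_minimizer (hcL : 0 < cL) (V : Submodule ℝ (ι → ℝ)) (b : ι → ℝ)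
    {η : ℝ} (hη : 0 < η) :
    ∃ y ∈ V, ∀ y' ∈ V, energy M (fun _ => 1) (y - b) ≤ (1 + η) * energy M (fun _ => 1) (y' - b) := by
  have hF0 : ∀ z : ι → ℝ, 0 ≤ energy M (fun _ => 1) z := energy_nonneg fun _ => zero_le_one
  by_cases hb : b ∈ V
  · refine ⟨b, hb, fun y' _ => ?_⟩
    rw [sub_self, hM.energy_zero]
    have := hF0 (y' - b)
    positivity
  have hpos : ∃ δ > 0, ∀ y ∈ V, δ ≤ energy M (fun _ => 1) (y - b) := by
    by_contra! hcon
    refine hb ?_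
    have hcl : IsClosed (V : Set (ι → ℝ)) := V.closed_of_finiteDimensional
    rw [← SetLike.mem_coe, ← hcl.closure_eq, Metric.mem_closure_iff]
    intro r hr
    obtain ⟨y, hy, hlt⟩ := hcon (loss M r) (hM.loss_pos hcL hr.ne')
    refine ⟨y, hy, (dist_pi_lt_iff hr).2 fun i => ?_⟩
    by_contra! hri
    rw [dist_comm, Real.dist_eq] at hri
    have h1 := hM.loss_mono (s := r) (t := y i - b i) (by rwa [abs_of_pos hr])
    have h2 := mul_loss_le_energy (M := M) (w := fun _ => 1) (fun _ => zero_le_one) (y - b) i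
    simp only [one_mul, Pi.sub_apply] at h2
    linarith
  obtain ⟨δ, hδ, hδle⟩ := hpos
  set s := (fun y => energy M (fun _ => 1) (y - b)) '' (V : Set (ι → ℝ)) with hs
  have hne : s.Nonempty := ⟨_, 0, V.zero_mem, rfl⟩
  have hbdd : BddBelow s := ⟨0, by rintro _ ⟨y, -, rfl⟩; exact hF0 _⟩
  have hI : δ ≤ sInf s := le_csInf hne (by rintro _ ⟨y, hy, rfl⟩; exact hδle y hy)
  obtain ⟨_, ⟨y, hy, rfl⟩, hlt⟩ := exists_lt_of_csInf_lt hne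
    (show sInf s < (1 + η) * sInf s by nlinarith)
  refine ⟨y, hy, fun y' hy' => hlt.le.trans ?_⟩
  exact mul_le_mul_of_nonneg_left (csInf_le hbdd ⟨y', hy', rfl⟩) (by positivity)
/-- The energy of an approximate minimizer of a reduced problem, relative to the energy `β` of the
residual of the comparison vector `0`. -/
theorem energy_le_of_isApproxMin (hp : 0 < p) (hq : 0 < q) (hcU : 1 ≤ cU) (hcL : 0 < cL)
    {w' : ι → ℝ} (hw' : ∀ i, 0 ≤ w' i) {V : Submodule ℝ (ι → ℝ)} {z y : ι → ℝ} {β ρ e H f : ℝ}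
    (hβ : 0 < β) (hf : 1 ≤ f) (hH : 1 ≤ H) (he : e ≤ 1 / (2 * halvingConst p cU))
    (hρ : 4 * halvingConst p cU * 2 ^ max 1 p * f ^ p * H * β ≤ ρ)
    (h : Preserves M V (fun _ => 1) w' z β ρ e H) (hy : IsApproxMin M p V w' z f y) :
    energy M (fun _ => 1) y ≤ ρ := by
  have hc := one_le_halvingConst hp hcU
  set c := halvingConst p cU
  have hc0 : 0 < c := by linarith
  have hfp : 1 ≤ f ^ p := Real.one_le_rpow hf hp.le
  have h1 : energy M w' (y - z) ≤ f ^ p * (H * β) := by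
    have h2 := hy.2 0 V.zero_mem
    rw [zero_sub, energy_neg] at h2
    exact h2.trans (mul_le_mul_of_nonneg_left h.target (by positivity))
  have h3 : energy M w' z ≤ f ^ p * (H * β) :=
    h.target.trans (le_mul_of_one_le_left (by positivity) hfp)
  have h4 := hM.energy_add_le hw' hp (y - z) z h1 h3
  rw [sub_add_cancel] at h4
  have hX : 0 < 2 ^ max 1 p * (f ^ p * (H * β)) := by positivity
  have hρ' : 4 * c * (2 ^ max 1 p * (f ^ p * (H * β))) ≤ ρ := le_trans (le_of_eq (by ring)) hρ
  have hρ0 : 0 < ρ := lt_of_lt_of_le (by positivity) hρ'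
  refine hM.energy_le_of_embed hp hq hcU hcL (fun _ => zero_le_one) hw' hρ0 he h.embed hy.1
    (h4.trans_lt ?_)
  rw [lt_div_iff₀ (by positivity)]
  nlinarith
/-- If the problem has an exact solution, then the reduced problem has no other ones. -/
theorem eq_zero_of_isApproxMin (hp : 0 < p) (hq : 0 < q) (hcU : 1 ≤ cU) (hcL : 0 < cL)
    {w' : ι → ℝ} (hw' : ∀ i, 0 ≤ w' i) {V : Submodule ℝ (ι → ℝ)} {y : ι → ℝ} {β ρ e H f : ℝ}
    (hρ : 0 < ρ) (he : e ≤ 1 / (2 * halvingConst p cU))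
    (h : Preserves M V (fun _ => 1) w' 0 β ρ e H) (hy : IsApproxMin M p V w' 0 f y) : y = 0 := by
  have h1 := hy.2 0 V.zero_mem
  rw [sub_zero, sub_zero, hM.energy_zero, mul_zero] at h1
  exact hM.energy_one_eq_zero hcL (hM.energy_eq_zero_of_embed hp hq hcU hcL (fun _ => zero_le_one)
    hw' hρ he h.embed hy.1 (le_antisymm h1 (energy_nonneg hw' y)))
/-- The comparison of an approximate minimizer `y` of a reduced problem with any other vector `y'` of
the energy ball: the common shift of the residual energies cancels. -/
theorem energy_sub_le_of_isApproxMin (hp : 0 < p) {w' : ι → ℝ} (hw' : ∀ i, 0 ≤ w' i)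
    {V : Submodule ℝ (ι → ℝ)} {z y y' : ι → ℝ} {β ρ e H δ : ℝ}
    (hδ0 : 0 ≤ δ) (hδ1 : δ ≤ 1) (he : e ≤ 1) (hH : H * β ≤ 2 * ρ) (hρ : 0 ≤ ρ)
    (h : Preserves M V (fun _ => 1) w' z β ρ e H) (hy : IsApproxMin M p V w' z (1 + δ) y)
    (hyρ : energy M (fun _ => 1) y ≤ ρ) (hy'V : y' ∈ V) (hy' : energy M (fun _ => 1) y' ≤ ρ) :
    energy M (fun _ => 1) (y - z) ≤ energy M (fun _ => 1) (y' - z) +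
      (2 * e + p * Real.exp p * 2 ^ (max 1 p + 1) * δ) * ρ := by
  obtain ⟨ζ, hζ⟩ := h.residual
  have h1 := abs_le.1 (hζ y hy.1 hyρ)
  have h2 := abs_le.1 (hζ y' hy'V hy')
  have h3 := hy.2 y' hy'V
  have h4 := abs_le.1 (h.embed y' hy'V hy')
  have h5 : energy M w' (y' - z) ≤ 2 ^ max 1 p * (2 * ρ) :=
    hM.energy_sub_le hw' hp y' z (by nlinarith) (h.target.trans hH)
  have h6 : (1 + δ) ^ p ≤ 1 + p * Real.exp p * δ := by
    have h7 : (1 + δ) ^ p ≤ Real.exp (δ * p) := by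
      rw [Real.exp_mul]
      exact Real.rpow_le_rpow (by linarith) (by linarith [Real.add_one_le_exp δ]) hp.le
    have h8 : Real.exp (δ * p) ≤ 1 + δ * p * Real.exp (δ * p) := by
      have h9 := Real.add_one_le_exp (-(δ * p))
      rw [Real.exp_neg] at h9
      have h10 := Real.exp_pos (δ * p)
      have h11 := mul_le_mul_of_nonneg_left h9 h10.le
      rw [mul_inv_cancel₀ h10.ne'] at h11
      linarith
    have h9 : Real.exp (δ * p) ≤ Real.exp p := Real.exp_le_exp.2 (by nlinarith)
    have h10 : δ * p * Real.exp (δ * p) ≤ δ * p * Real.exp p :=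
      mul_le_mul_of_nonneg_left h9 (by positivity)
    linarith
  have h7 : (1 + δ) ^ p * energy M w' (y' - z) ≤
      energy M w' (y' - z) + p * Real.exp p * δ * (2 ^ max 1 p * (2 * ρ)) := by
    have h8 := mul_le_mul_of_nonneg_right h6 (energy_nonneg (M := M) hw' (y' - z))
    have h9 := mul_le_mul_of_nonneg_left h5 (by positivity : 0 ≤ p * Real.exp p * δ)
    linarith
  have h8 : p * Real.exp p * δ * ((2 : ℝ) ^ max 1 p * (2 * ρ)) =
      p * Real.exp p * 2 ^ (max 1 p + 1) * δ * ρ := by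
    rw [Real.rpow_add_one (by norm_num)]; ring
  linarith [h1.1, h1.2, h2.1, h2.2]
end IsAdmissibleLoss
end

/-! ### The regression programs -/
namespace Prog
variable {n d : ℕ} {b : Fin n → ℝ} {p κ T f : ℝ} {M : ℝ≥0 → ℝ≥0}
theorem sum_get_eq_energy {S : List (Fin n)} (hS : S.Nodup) {w : Fin n → ℝ}
    (hwS : ∀ i, i ∉ S → w i = 0) (z : Fin n → ℝ) :
    ∑ a : Fin S.length, w (S.get a) * loss M (z (S.get a)) = energy M w z := by
  have h := Fin.sum_univ_fun_getElem S fun i => w i * loss M (z i)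
  simp only [List.get_eq_getElem]
  rw [h, ← List.sum_toFinset _ hS, energy]
  exact Finset.sum_subset (Finset.subset_univ _) fun i _ hi => by
    rw [hwS i (by simpa using hi), zero_mul]
theorem triple_callSolver (hp : 0 < p) (hf : 0 ≤ f) (solver : RegressionRoutine M p d f)
    (A : Matrix (Fin n) (Fin d) ℝ) {S : List (Fin n)} (hS : S.Nodup) {w y z : Fin n → ℝ}
    (hw : ∀ i ∈ S, 1 ≤ w i) (hwS : ∀ i, i ∉ S → w i = 0) (hy : ∀ i ∈ S, y i = z i) :
    Triple b (callSolver solver A S w y) 0 (nnz A + 2 * n + d + 1) 0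
      (fun x => IsApproxMin M p (LinearMap.range A.mulVecLin) w z f (A.mulVec x)) := by
  have h1 : (nnz (rowsOf A S) : ℝ) ≤ nnz A := (nnz_rowsOf A S).trans_le (sum_rowNnz_le A hS)
  have h2 : (S.length : ℝ) ≤ n := by exact_mod_cast hS.length_le
  refine Triple.step_bind (Triple.charge_bind (t' := 0) ⟨by simp, by simp⟩
    (Triple.pure ?_ le_rfl ⟨⟨_, rfl⟩, ?_⟩))
  · push_cast; linarith
  rintro _ ⟨x, rfl⟩
  have hw0 : ∀ i, 0 ≤ w i := fun i => by
    by_cases hi : i ∈ S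
    · linarith [hw i hi]
    · exact (hwS i hi).ge
  have key : ∀ x, mNorm M p (fun a => w (S.get a)) ((rowsOf A S).mulVec x - fun a => y (S.get a)) =
      energy M w (A.mulVec x - z) ^ (1 / p) := fun x => by
    rw [← sum_get_eq_energy hS hwS]
    change (∑ a, _ * loss M _) ^ (1 / p) = _
    congr 1
    refine Finset.sum_congr rfl fun a _ => ?_
    rw [Pi.sub_apply, Pi.sub_apply, hy _ (S.get_mem a)]
    rfl
  have h3 := solver.correct (rowsOf A S) (fun a => w (S.get a)) (fun a => y (S.get a))
    (fun a => hw _ (S.get_mem a)) x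
  rw [key, key] at h3
  have h4 := Real.rpow_le_rpow (Real.rpow_nonneg (energy_nonneg hw0 _) _) h3 hp.le
  rwa [Real.mul_rpow hf (Real.rpow_nonneg (energy_nonneg hw0 _) _),
    ← Real.rpow_mul (energy_nonneg hw0 _), ← Real.rpow_mul (energy_nonneg hw0 _),
    one_div_mul_cancel hp.ne', Real.rpow_one, Real.rpow_one] at h4
theorem triple_readEntries (S : List (Fin n)) :
    Triple b (forEach S (fun _ : Fin n => (0 : ℝ)) fun y i => do
        let t ← ask i
        prim (Function.update y i t)) 0 (3 * S.length) S.length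
      (fun y => ∀ i ∈ S, y i = b i) := by
  refine (Triple.forEach (fun l y => ∀ i ∈ l, y i = b i) (fun _ => 0) (fun _ => 2) (fun _ => 1) S _
    (by simp) ?_).mono (by simp) (by simp; linarith) (by simp) fun _ h => h
  intro l i r y hl hy
  refine Triple.ask_bind (Triple.prim (by norm_num) (by norm_num) fun i' hi' => ?_)
  rcases eq_or_ne i' i with rfl | hne
  · simp
  · rw [Function.update_of_ne hne]
    refine hy i' ?_
    simpa [hne] using hi'
theorem triple_readResiduals (A : Matrix (Fin n) (Fin d) ℝ) (x : Fin d → ℝ) {S : List (Fin n)}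
    (hS : S.Nodup) :
    Triple b (forEach S (fun _ : Fin n => (0 : ℝ)) fun y i => do
        let t ← ask i
        step (2 * rowNnz A i)
        let z ← prim (t - (A.mulVec x) i)
        prim (Function.update y i z)) 0 (4 * S.length + 2 * nnz A) S.length
      (fun y => ∀ i ∈ S, y i = (b - A.mulVec x) i) := by
  refine (Triple.forEach (fun l y => ∀ i ∈ l, y i = (b - A.mulVec x) i) (fun _ => 0)
    (fun i => 3 + 2 * rowNnz A i) (fun _ => 1) S _
    (by simp) ?_).mono (by simp) ?_ (by simp) fun _ h => h
  · intro l i r y hl hy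
    refine Triple.ask_bind (Triple.step_bind (Triple.prim_bind
      (Triple.prim (by push_cast; linarith) (by norm_num) fun i' hi' => ?_)))
    rcases eq_or_ne i' i with rfl | hne
    · simp
    · rw [Function.update_of_ne hne]
      refine hy i' ?_
      simpa [hne] using hi'
  · have h : (S.map fun i => 1 + (3 + 2 * (rowNnz A i : ℝ))).sum =
        4 * S.length + 2 * (S.map fun i => (rowNnz A i : ℝ)).sum := by
      rw [← List.sum_toFinset _ hS, ← List.sum_toFinset _ hS, Finset.mul_sum,
        ← List.toFinset_card_of_nodup hS, Finset.card_eq_sum_ones]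
      push_cast
      rw [Finset.mul_sum, ← Finset.sum_add_distrib]
      exact Finset.sum_congr rfl fun i _ => by ring
    rw [h]
    linarith [sum_rowNnz_le A hS]
/-- For some weights that preserve the energies of `V` and of the residuals for the target `z`, the
vector `y` solves the reweighted problem within the factor `f`. -/
def SolvesReduction (M : ℝ≥0 → ℝ≥0) (p : ℝ) (V : Submodule ℝ (Fin n → ℝ)) (z : Fin n → ℝ)
    (β ρ e H f : ℝ) (y : Fin n → ℝ) : Prop :=
  ∃ w' : Fin n → ℝ, (∀ i, 0 ≤ w' i) ∧ Preserves M V (fun _ => 1) w' z β ρ e H ∧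
    IsApproxMin M p V w' z f y
theorem IsReduction.nonneg {V : Submodule ℝ (Fin n → ℝ)} {z : Fin n → ℝ} {β ρ e H x : ℝ}
    {out : List (Fin n) × (Fin n → ℝ)} (h : IsReduction M V z β ρ e H x out) (i : Fin n) :
    0 ≤ out.2 i := by
  by_cases hi : i ∈ out.1
  · linarith [h.one_le i hi]
  · exact (h.eq_zero i hi).ge
/-- The reduction is analysed after a translation by a vector `y₀` of the subspace, which the
algorithm does not know. -/
theorem triple_constantFactorRegression (hp : 0 < p) (hκ : 0 ≤ κ) (K : AlgConstants)
    (lewis : LewisRoutine n d p κ T) (coarse : RegressionRoutine M p d κ)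
    (A : Matrix (Fin n) (Fin d) ℝ) {φ : ℝ≥0∞} {t β ρ e H x : ℝ} {y₀ : Fin n → ℝ}
    (hy₀ : y₀ ∈ LinearMap.range A.mulVecLin)
    (h : Triple b (twoRoundSampling K lewis A (K.oversample * d)) φ t 0
      (IsReduction M (LinearMap.range A.mulVecLin) (b - y₀) β ρ e H x)) :
    Triple b (constantFactorRegression K lewis coarse A) φ (t + nnz A + 5 * n + d + 2) x
      (fun xc => SolvesReduction M p (LinearMap.range A.mulVecLin) (b - y₀) β ρ e H κ
        (A.mulVec xc - y₀)) := by
  unfold constantFactorRegression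
  refine Triple.prim_bind ((h.bind (φ' := 0) (t' := nnz A + 5 * n + d + 1) (k' := x)
    fun rows hrows => ?_).mono (by simp) (by linarith) (by simp) fun _ h => h)
  have hlen : (rows.1.length : ℝ) ≤ n := by exact_mod_cast hrows.nodup.length_le
  refine ((triple_readEntries rows.1).bind fun y hy => triple_callSolver hp hκ coarse A
    hrows.nodup hrows.one_le hrows.eq_zero hy).mono (by simp) (by linarith)
    (by simpa using hrows.length_le) ?_
  rintro xc ⟨h1, h2⟩
  refine ⟨rows.2, hrows.nonneg, hrows.preserves, Submodule.sub_mem _ h1 hy₀, fun y' hy' => ?_⟩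
  have h3 := h2 (y' + y₀) (Submodule.add_mem _ hy' hy₀)
  rwa [show y' + y₀ - b = y' - (b - y₀) by abel,
    show A.mulVec xc - b = A.mulVec xc - y₀ - (b - y₀) by abel] at h3
/-- The second stage of `relativeErrorRegression`, which improves the solution `xc`. -/
noncomputable def residualRegression (K : AlgConstants) (δ : ℝ) (lewis : LewisRoutine n d p κ T)
    (fine : RegressionRoutine M p d (1 + δ)) (A : Matrix (Fin n) (Fin d) ℝ) (xc : Fin d → ℝ) :
    Prog n (Fin d → ℝ) := do
  step 10
  let rows ← twoRoundSampling K lewis A (K.oversample * d / δ ^ (2 + p) * Real.log (1 / δ))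
  let y ← forEach rows.1 (fun _ : Fin n => (0 : ℝ)) fun y i => do
    let t ← ask i
    step (2 * rowNnz A i)
    let z ← prim (t - (A.mulVec xc) i)
    prim (Function.update y i z)
  let xbar ← callSolver fine A rows.1 rows.2 y
  step d
  pure (xc + xbar)
theorem relativeErrorRegression_eq (K : AlgConstants) (δ : ℝ) (lewis : LewisRoutine n d p κ T)
    (coarse : RegressionRoutine M p d κ) (fine : RegressionRoutine M p d (1 + δ))
    (A : Matrix (Fin n) (Fin d) ℝ) :
    relativeErrorRegression K δ lewis coarse fine A =
      constantFactorRegression K lewis coarse A >>= residualRegression K δ lewis fine A := rfl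
theorem triple_residualRegression (hp : 0 < p) {δ : ℝ} (hδ : 0 ≤ 1 + δ) (K : AlgConstants)
    (lewis : LewisRoutine n d p κ T) (fine : RegressionRoutine M p d (1 + δ))
    (A : Matrix (Fin n) (Fin d) ℝ) (xc : Fin d → ℝ) {φ : ℝ≥0∞} {t β ρ e H x : ℝ}
    (h : Triple b (twoRoundSampling K lewis A
        (K.oversample * d / δ ^ (2 + p) * Real.log (1 / δ))) φ t 0
      (IsReduction M (LinearMap.range A.mulVecLin) (b - A.mulVec xc) β ρ e H x)) :
    Triple b (residualRegression K δ lewis fine A xc) φ (t + 3 * nnz A + 6 * n + 2 * d + 11) x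
      (fun x => SolvesReduction M p (LinearMap.range A.mulVecLin) (b - A.mulVec xc) β ρ e H (1 + δ)
        (A.mulVec x - A.mulVec xc)) := by
  unfold residualRegression
  refine Triple.step_bind ((h.bind (φ' := 0) (t' := 3 * nnz A + 6 * n + 2 * d + 1) (k' := x)
    fun rows hrows => ?_).mono (by simp) (by push_cast; linarith) (by simp) fun _ h => h)
  have hlen : (rows.1.length : ℝ) ≤ n := by exact_mod_cast hrows.nodup.length_le
  refine ((triple_readResiduals A xc hrows.nodup).bind fun y hy => (triple_callSolver hp hδ fine A
    hrows.nodup hrows.one_le hrows.eq_zero hy).bind (φ' := 0) (t' := d) (k' := 0)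
    (Q' := fun x => SolvesReduction M p (LinearMap.range A.mulVecLin) (b - A.mulVec xc) β ρ e H
      (1 + δ) (A.mulVec x - A.mulVec xc)) fun xbar hxbar => ?_).mono
    (by simp) (by linarith) (by simpa using hrows.length_le) fun _ h => h
  refine Triple.step_bind (Triple.pure (by simp) le_rfl ⟨rows.2, hrows.nonneg, hrows.preserves, ?_⟩)
  rwa [Matrix.mulVec_add, add_sub_cancel_left]
end Prog

/-! ### Bounds for the costs -/
namespace Prog
variable {n d : ℕ} {p κ T : ℝ}
theorem half_le_log {n : ℕ} (hn : 2 ≤ n) : 1 / 2 ≤ Real.log n := by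
  have h := Real.log_le_log (by norm_num) (show (2 : ℝ) ≤ n by exact_mod_cast hn)
  linarith [Real.log_two_gt_d9]
theorem ceil_logb_le {x y : ℝ} (hx : 1 ≤ x) (hxy : Real.log x ≤ y) (hy : 0 ≤ y) :
    (⌈Real.logb 2 x⌉₊ : ℝ) ≤ 2 * y + 1 := by
  have h0 : 0 ≤ Real.logb 2 x := Real.logb_nonneg (by norm_num) hx
  refine (Nat.ceil_lt_add_one h0).le.trans ?_
  have h1 : Real.logb 2 x ≤ 2 * y := by
    rw [Real.logb, div_le_iff₀ (Real.log_pos (by norm_num))]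
    nlinarith [Real.log_two_gt_d9]
  linarith
theorem ceil_reps_le (hn : 2 ≤ n) : (⌈12 * Real.log n⌉₊ : ℝ) ≤ 20 * Real.log n := by
  have h := half_le_log hn
  refine (Nat.ceil_lt_add_one (by linarith)).le.trans ?_
  linarith
theorem ceil_logb_natCast_le (hn : 2 ≤ n) : (⌈Real.logb 2 n⌉₊ : ℝ) ≤ 20 * Real.log n := by
  have h := half_le_log hn
  have hn1 : (1 : ℝ) ≤ n := by exact_mod_cast (by omega : 1 ≤ n)
  linarith [ceil_logb_le hn1 le_rfl (by linarith)]
theorem ceil_logb_one_add_le (hn : 2 ≤ n) : (⌈Real.logb 2 (1 + n)⌉₊ : ℝ) ≤ 20 * Real.log n := by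
  have h := half_le_log hn
  have hn1 : (2 : ℝ) ≤ n := by exact_mod_cast hn
  have h1 : Real.log (1 + n) ≤ 2 * Real.log n := by
    rw [show (2 : ℝ) * Real.log n = ((2 : ℕ) : ℝ) * Real.log n by norm_num, ← Real.log_pow]
    exact Real.log_le_log (by positivity) (by nlinarith)
  linarith [ceil_logb_le (show (1 : ℝ) ≤ 1 + n by linarith) h1 (by linarith)]
theorem rpow_max_mul_self (hd : 1 ≤ d) :
    (d : ℝ) ^ max 0 (p / 2 - 1) * d = (d : ℝ) ^ max 1 (p / 2) := by
  have hd0 : (0 : ℝ) < d := by exact_mod_cast hd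
  rw [← Real.rpow_add_one hd0.ne', ← max_add_add_right]
  congr 2 <;> ring
theorem self_le_rpow_max (hd : 1 ≤ d) : (d : ℝ) ≤ (d : ℝ) ^ max 1 (p / 2) := by
  have hd1 : (1 : ℝ) ≤ d := by exact_mod_cast hd
  simpa using Real.rpow_le_rpow_of_exponent_le hd1 (le_max_left 1 (p / 2))
variable {K : AlgConstants} {L R N : ℕ} {x : ℝ}
theorem hashTotal_le (hκ : 0 ≤ κ) (hd : 1 ≤ d) (hL : (L : ℝ) ≤ x) (hR : (R : ℝ) ≤ x) :
    hashTotal K p κ d L R ≤ 20 * κ / K.threshold * (d : ℝ) ^ max 1 (p / 2) * x ^ 2 := by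
  have hthr := K.threshold_pos
  have hx : 0 ≤ x := (Nat.cast_nonneg _).trans hL
  calc hashTotal K p κ d L R
      = 20 * κ / K.threshold * (d : ℝ) ^ max 1 (p / 2) * (R * L) := by
        rw [hashTotal, markTotal, ← rpow_max_mul_self hd]; ring
    _ ≤ 20 * κ / K.threshold * (d : ℝ) ^ max 1 (p / 2) * (x * x) := by gcongr
    _ = _ := by ring
theorem sampleSize_le (hκ : 0 ≤ κ) (hd : 1 ≤ d) (hx : 1 ≤ x) (hL : (L : ℝ) ≤ x) (hR : (R : ℝ) ≤ x)
    (hN : (N : ℝ) ≤ x) :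
    N * (2 * (2 * d + hashTotal K p κ d L R)) ≤
      (4 + 40 * κ / K.threshold) * (d : ℝ) ^ max 1 (p / 2) * x ^ 3 := by
  have hthr := K.threshold_pos
  have h1 := hashTotal_le (K := K) (p := p) hκ hd hL hR
  have h2 : (d : ℝ) ≤ (d : ℝ) ^ max 1 (p / 2) * x ^ 2 :=
    (self_le_rpow_max hd).trans (le_mul_of_one_le_right (by positivity) (one_le_pow₀ hx))
  have h3 := hashTotal_nonneg (p := p) (d := d) K hκ L R
  calc N * (2 * (2 * d + hashTotal K p κ d L R))
      ≤ x * (2 * (2 * ((d : ℝ) ^ max 1 (p / 2) * x ^ 2) +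
          20 * κ / K.threshold * (d : ℝ) ^ max 1 (p / 2) * x ^ 2)) := by gcongr
    _ = _ := by ring
/-- The constant in the bound for the time that the sampling takes. -/
noncomputable def timeConst (K : AlgConstants) (κ : ℝ) : ℝ :=
  200 * (1 + κ) + 160000 * (2 + κ) * (2 + 20 * κ / K.threshold)
theorem twoRoundTime_le (hκ : 0 ≤ κ) (hT : 1 ≤ T) (hn : 2 ≤ n) (hd : 1 ≤ d) (hx : 1 ≤ x)
    (hL : (L : ℝ) ≤ x) (hR : (R : ℝ) ≤ x) (hN : (N : ℝ) ≤ x) {nz m B : ℝ} (hnz : 0 ≤ nz)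
    (hm : 0 ≤ m) (hmB : m ≤ B * d) :
    twoRoundTime κ T n d L R N nz (4000 * (m * (2 * T + hashTotal K p κ d L R))) ≤
      timeConst K κ * ((nz + n) * x ^ 3 +
        B * (T * (d : ℝ) ^ max 1 (p / 2) + T ^ 2) * x ^ 4) := by
  have hthr := K.threshold_pos
  have hd0 : (0 : ℝ) < d := by exact_mod_cast hd
  have hn1 : (1 : ℝ) ≤ n := by exact_mod_cast (by omega : 1 ≤ n)
  have hT0 : 0 < T := by linarith
  have hx0 : 0 < x := by linarith
  have hB : 0 ≤ B := nonneg_of_mul_nonneg_left (hm.trans hmB) hd0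
  set E := (d : ℝ) ^ max 1 (p / 2) with hE
  have hE0 : 0 ≤ E := by positivity
  have h1 := hashTotal_le (K := K) (p := p) hκ hd hL hR
  have h0 := hashTotal_nonneg (p := p) (d := d) K hκ L R
  rw [← hE] at h1
  set G := 20 * κ / K.threshold with hG
  have hG0 : 0 ≤ G := by positivity
  have hκT : 2 + κ * T ≤ (2 + κ) * T := by nlinarith
  -- the part that depends on the size of the sample
  have hsample : 40 * L * (2 + κ * T) * (4000 * (m * (2 * T + hashTotal K p κ d L R)) / d) ≤
      160000 * (2 + κ) * (2 + G) * (B * (T * E + T ^ 2) * x ^ 4) := by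
    have h2 : 4000 * (m * (2 * T + hashTotal K p κ d L R)) / d ≤
        4000 * (B * (2 * T + G * E * x ^ 2)) := by
      rw [div_le_iff₀ hd0]
      calc 4000 * (m * (2 * T + hashTotal K p κ d L R))
          ≤ 4000 * (B * d * (2 * T + G * E * x ^ 2)) := by gcongr
        _ = _ := by ring
    have h3 : x * T * (2 * T + G * E * x ^ 2) ≤ (2 + G) * ((T * E + T ^ 2) * x ^ 4) := by
      have e1 : x ≤ x ^ 4 := le_self_pow₀ hx (by norm_num)
      have e2 : x ^ 3 ≤ x ^ 4 := pow_le_pow_right₀ hx (by norm_num)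
      have e3 : 2 * (T ^ 2 * x) ≤ (2 + G) * (T ^ 2 * x ^ 4) :=
        mul_le_mul (by linarith) (mul_le_mul_of_nonneg_left e1 (by positivity)) (by positivity)
          (by positivity)
      have e4 : G * (T * E * x ^ 3) ≤ (2 + G) * (T * E * x ^ 4) :=
        mul_le_mul (by linarith) (mul_le_mul_of_nonneg_left e2 (by positivity)) (by positivity)
          (by positivity)
      linarith
    calc 40 * L * (2 + κ * T) * (4000 * (m * (2 * T + hashTotal K p κ d L R)) / d)
        ≤ 40 * x * ((2 + κ) * T) * (4000 * (B * (2 * T + G * E * x ^ 2))) := by gcongr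
      _ = 160000 * (2 + κ) * B * (x * T * (2 * T + G * E * x ^ 2)) := by ring
      _ ≤ 160000 * (2 + κ) * B * ((2 + G) * ((T * E + T ^ 2) * x ^ 4)) := by gcongr
      _ = _ := by ring
  -- the remaining terms are at most multiples of `(nz + n) x³`
  have hrest : 40 * L * (2 + κ * T) * (n / T) ≤ 40 * (2 + κ) * (n * x ^ 3) := by
    have e1 : x ≤ x ^ 3 := le_self_pow₀ hx (by norm_num)
    calc 40 * L * (2 + κ * T) * (n / T) ≤ 40 * x ^ 3 * ((2 + κ) * T) * (n / T) := by
          gcongr; exact hL.trans e1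
      _ = _ := by field_simp
  have hRL : (L : ℝ) * R ≤ x ^ 2 := by nlinarith [Nat.cast_nonneg (α := ℝ) L]
  have hNRL : (N : ℝ) * (L * R) ≤ x ^ 3 := by
    calc (N : ℝ) * (L * R) ≤ x * x ^ 2 := by gcongr
      _ = x ^ 3 := by ring
  have hNR : (N : ℝ) * R ≤ x ^ 2 := by nlinarith [Nat.cast_nonneg (α := ℝ) N]
  have x3 : 1 ≤ x ^ 3 := one_le_pow₀ hx
  have x13 : x ≤ x ^ 3 := le_self_pow₀ hx (by norm_num)
  have x23 : x ^ 2 ≤ x ^ 3 := pow_le_pow_right₀ hx (by norm_num)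
  have hx3n : x ^ 3 ≤ n * x ^ 3 := le_mul_of_one_le_left (by positivity) hn1
  have hnx : (n : ℝ) ≤ n * x ^ 3 := le_mul_of_one_le_right (by positivity) x3
  have hRLn : (L : ℝ) * R * n ≤ n * x ^ 3 := by
    calc (L : ℝ) * R * n ≤ x ^ 3 * n := by gcongr; linarith
      _ = _ := by ring
  have hRLz : (1 + κ) * (L * R * nz) ≤ (1 + κ) * (nz * x ^ 3) := by
    refine mul_le_mul_of_nonneg_left ?_ (by linarith)
    calc (L : ℝ) * R * nz ≤ x ^ 3 * nz := by gcongr; linarith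
      _ = _ := by ring
  have hκs : 0 ≤ κ * (n * x ^ 3) := by positivity
  have hκz : 0 ≤ κ * (nz * x ^ 3) := by positivity
  have hz : 0 ≤ nz * x ^ 3 := by positivity
  unfold twoRoundTime sensitivityTime timeConst
  rw [← hG]
  have hmul : 0 ≤ 160000 * (2 + κ) * (2 + G) * ((nz + n) * x ^ 3) := by positivity
  have hmul' : 0 ≤ 200 * (1 + κ) * (B * (T * E + T ^ 2) * x ^ 4) := by positivity
  have hmain : 1 + (5 + 2 * n + R * (4 + L * (1 + (1 + κ) * nz + 9 * n)) +
      40 * L * (2 + κ * T) * (n / T)) + 7 * n +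
      (1 + 10 * n + N * (6 + 4 * R + L * R) + L * R * ((1 + κ) * nz + 9 * n)) + 7 * n ≤
        200 * (1 + κ) * ((nz + n) * x ^ 3) := by
    linarith
  linarith
end Prog

/-! ### The accuracy of the two stages -/
section
variable {M : ℝ≥0 → ℝ≥0} {p q cU cL κ : ℝ}
/-- The first stage finds a solution whose distance from a near-minimizer has at most this multiple
of the optimal energy. -/
noncomputable def coarseRadius (p cU κ : ℝ) : ℝ :=
  4 * halvingConst p cU * 2 ^ max 1 p * κ ^ p * (4000 * 4000)
/-- The energy of the solution of the residual problem is at most this multiple of the optimal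
energy. -/
noncomputable def fineRadius (p cU κ : ℝ) : ℝ :=
  4 * halvingConst p cU * 2 ^ max 1 p * 2 ^ p * (4000 * 4000) *
    (2 ^ max 1 p * coarseRadius p cU κ)
theorem one_le_coarseRadius (hp : 0 < p) (hcU : 1 ≤ cU) (hκ : 1 ≤ κ) : 1 ≤ coarseRadius p cU κ := by
  have h1 := one_le_halvingConst hp hcU
  have h2 : (1 : ℝ) ≤ 2 ^ max 1 p := Real.one_le_rpow (by norm_num) (by positivity)
  have h3 : 1 ≤ κ ^ p := Real.one_le_rpow hκ hp.le
  have h4 := one_le_mul_of_one_le_of_one_le h1 h2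
  have h5 := one_le_mul_of_one_le_of_one_le h4 h3
  unfold coarseRadius
  linarith
theorem le_fineRadius (hp : 0 < p) (hcU : 1 ≤ cU) (hκ : 1 ≤ κ) :
    4000 * 4000 * (2 ^ max 1 p * coarseRadius p cU κ) ≤ fineRadius p cU κ := by
  have h1 := one_le_halvingConst hp hcU
  have h2 : (1 : ℝ) ≤ 2 ^ max 1 p := Real.one_le_rpow (by norm_num) (by positivity)
  have h3 : (1 : ℝ) ≤ 2 ^ p := Real.one_le_rpow (by norm_num) hp.le
  have h4 := one_le_mul_of_one_le_of_one_le h1 h2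
  have h5 := one_le_mul_of_one_le_of_one_le h4 h3
  have h6 := one_le_coarseRadius hp hcU hκ
  have h7 : 0 ≤ 4000 * 4000 * (2 ^ max 1 p * coarseRadius p cU κ) := by positivity
  have h8 : 1 ≤ 4 * (halvingConst p cU * 2 ^ max 1 p * 2 ^ p) := by linarith
  calc _ ≤ 4 * (halvingConst p cU * 2 ^ max 1 p * 2 ^ p) *
        (4000 * 4000 * (2 ^ max 1 p * coarseRadius p cU κ)) := le_mul_of_one_le_left h7 h8
    _ = _ := by unfold fineRadius; ring
variable {n : ℕ} {V : Submodule ℝ (Fin n → ℝ)} {b y₀ yc y : Fin n → ℝ} {ρ₀ e δ : ℝ}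
open Prog
theorem IsAdmissibleLoss.coarse_accuracy (hM : IsAdmissibleLoss M p q cU cL) (hp : 0 < p)
    (hq : 0 < q) (hcU : 1 ≤ cU) (hcL : 0 < cL) (hκ : 1 ≤ κ) (hρ₀ : 0 < ρ₀)
    (he : e ≤ 1 / (2 * halvingConst p cU)) (hb : energy M (fun _ => 1) (b - y₀) ≤ ρ₀)
    (h : SolvesReduction M p V (b - y₀) ρ₀ (coarseRadius p cU κ * ρ₀) e (4000 * 4000) κ (yc - y₀)) :
    energy M (fun _ => 1) (y₀ - yc) ≤ coarseRadius p cU κ * ρ₀ ∧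
      energy M (fun _ => 1) (b - yc) ≤ 2 ^ max 1 p * coarseRadius p cU κ * ρ₀ ∧
      (b = y₀ → yc = b) := by
  obtain ⟨w', hw', hpre, hmin⟩ := h
  have hR := one_le_coarseRadius hp hcU hκ
  have h1 : energy M (fun _ => 1) (y₀ - yc) ≤ coarseRadius p cU κ * ρ₀ := by
    rw [energy_sub_comm]
    exact hM.energy_le_of_isApproxMin hp hq hcU hcL hw' hρ₀ hκ (by norm_num) he
      (le_of_eq (by unfold coarseRadius; ring)) hpre hmin
  refine ⟨h1, ?_, ?_⟩
  · have h2 := hM.energy_add_le (fun _ => zero_le_one) hp (b - y₀) (y₀ - yc)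
      (hb.trans (le_mul_of_one_le_left hρ₀.le hR)) h1
    rwa [sub_add_sub_cancel, ← mul_assoc] at h2
  · rintro rfl
    rw [sub_self] at hpre hmin
    exact sub_eq_zero.1 (hM.eq_zero_of_isApproxMin hp hq hcU hcL hw' (by positivity) he hpre hmin)
theorem IsAdmissibleLoss.fine_accuracy (hM : IsAdmissibleLoss M p q cU cL) (hp : 0 < p)
    (hq : 0 < q) (hcU : 1 ≤ cU) (hcL : 0 < cL) (hκ : 1 ≤ κ) (hρ₀ : 0 < ρ₀) (hδ0 : 0 ≤ δ)
    (hδ1 : δ ≤ 1) (he : e ≤ 1 / (2 * halvingConst p cU)) (hy₀ : y₀ ∈ V) (hyc : yc ∈ V)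
    (hdist : energy M (fun _ => 1) (y₀ - yc) ≤ coarseRadius p cU κ * ρ₀)
    (h : SolvesReduction M p V (b - yc) (2 ^ max 1 p * coarseRadius p cU κ * ρ₀)
      (fineRadius p cU κ * ρ₀) e (4000 * 4000) (1 + δ) (y - yc)) :
    energy M (fun _ => 1) (y - b) ≤ energy M (fun _ => 1) (y₀ - b) +
      (2 * e + p * Real.exp p * 2 ^ (max 1 p + 1) * δ) * (fineRadius p cU κ * ρ₀) ∧
      (yc = b → y = b) := by
  obtain ⟨w', hw', hpre, hmin⟩ := h
  have hc := one_le_halvingConst hp hcU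
  have hR := one_le_coarseRadius hp hcU hκ
  have hR' := le_fineRadius hp hcU hκ
  have h2P : (1 : ℝ) ≤ 2 ^ max 1 p := Real.one_le_rpow (by norm_num) (by positivity)
  have h1 : 1 ≤ 2 ^ max 1 p * coarseRadius p cU κ := one_le_mul_of_one_le_of_one_le h2P hR
  have h2 : coarseRadius p cU κ ≤ 2 ^ max 1 p * coarseRadius p cU κ :=
    le_mul_of_one_le_left (by linarith) h2P
  have hF : 0 < fineRadius p cU κ := by linarith
  have he1 : e ≤ 1 := he.trans (by rw [div_le_one (by positivity)]; linarith)
  constructor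
  · have h3 : energy M (fun _ => 1) (y - yc) ≤ fineRadius p cU κ * ρ₀ := by
      refine hM.energy_le_of_isApproxMin hp hq hcU hcL hw' (by positivity)
        (show 1 ≤ 1 + δ by linarith) (by norm_num) he ?_ hpre hmin
      have h4 : (1 + δ) ^ p ≤ 2 ^ p := Real.rpow_le_rpow (by linarith) (by linarith) hp.le
      calc _ ≤ 4 * halvingConst p cU * 2 ^ max 1 p * 2 ^ p * (4000 * 4000) *
            (2 ^ max 1 p * coarseRadius p cU κ * ρ₀) := by gcongr
        _ = _ := by unfold fineRadius; ring
    have h5 := hM.energy_sub_le_of_isApproxMin hp hw' hδ0 hδ1 he1 (by nlinarith) (by positivity) hpre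
      hmin h3 (V.sub_mem hy₀ hyc) (hdist.trans (mul_le_mul_of_nonneg_right (by linarith) hρ₀.le))
    rwa [sub_sub_sub_cancel_right, sub_sub_sub_cancel_right] at h5
  · rintro rfl
    rw [sub_self] at hpre hmin
    exact sub_eq_zero.1 (hM.eq_zero_of_isApproxMin hp hq hcU hcL hw' (by positivity) he hpre hmin)
/-- A relative error of the energy, which is the `p`-th power of the norm, becomes a relative error
of the norm. -/
theorem mNorm_le_of_energy_le (hp : 0 < p) {ι : Type} [Fintype ι] {w y z : ι → ℝ}
    (hw : ∀ i, 0 ≤ w i) {u ε : ℝ} (hu : 0 ≤ u) (hε : ε ≤ 1) (huε : 2 * (u / p) ≤ ε)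
    (h : energy M w y ≤ (1 + u) * energy M w z) : mNorm M p w y ≤ (1 + ε) * mNorm M p w z := by
  rw [mNorm_eq, mNorm_eq]
  refine (Real.rpow_le_rpow (energy_nonneg hw y) h (by positivity)).trans ?_
  rw [Real.mul_rpow (by positivity) (energy_nonneg hw z)]
  refine mul_le_mul_of_nonneg_right ?_ (Real.rpow_nonneg (energy_nonneg hw z) _)
  have h0 : 0 ≤ u / p := by positivity
  have h1 : (1 + u) ^ (1 / p) ≤ Real.exp (u / p) := by
    rw [show u / p = u * (1 / p) by ring, Real.exp_mul]
    exact Real.rpow_le_rpow (by positivity) (by linarith [Real.add_one_le_exp u]) (by positivity)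
  have h2 := (abs_le.1 (Real.abs_exp_sub_one_sub_id_le (x := u / p)
    (by rw [abs_of_nonneg h0]; linarith))).2
  nlinarith
end

/-! ### Correctness and costs of the algorithm -/
namespace Prog
theorem Triple.le_toOuterMeasure_run {n : ℕ} {α : Type} {b : Fin n → ℝ} {P : Prog n α} {φ t k : ℝ}
    {Q : α → Prop} (hφ : 0 ≤ φ) (h : Triple b P (ENNReal.ofReal φ) t k Q) :
    ENNReal.ofReal (1 - φ) ≤ (run b P).toOuterMeasure {r | Q r.1 ∧ r.2.Within t k} := by
  classical
  rw [ENNReal.ofReal_sub _ hφ, ENNReal.ofReal_one, tsub_le_iff_right]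
  refine le_trans ?_ (add_le_add_right h _)
  rw [toOuterMeasure_run, ← expect_add]
  refine (expect_const P 1).symm.trans_le (expect_mono P fun a c => ?_)
  by_cases h1 : Q a ∧ c.Within t k
  · rw [Set.indicator_of_mem (by exact h1)]
    exact le_self_add
  · rw [if_neg h1]
    exact le_add_self
/-- The factor by which the oversampling parameters exceed `d log(1/ε) / ε ^ (2 + p)`. -/
noncomputable def sampleConst (K : AlgConstants) (p : ℝ) : ℝ :=
  2 * K.oversample * K.scale ^ (2 + p) * (1 + 2 * Real.log K.scale)
variable {p ε : ℝ} {K : AlgConstants}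
theorem half_le_log_inv (hε0 : 0 < ε) (hε : ε ≤ 1 / 2) : 1 / 2 ≤ Real.log (1 / ε) := by
  have h1 : (2 : ℝ) ≤ 1 / ε := by rw [le_div_iff₀ hε0]; linarith
  linarith [Real.log_le_log (by norm_num) h1, Real.log_two_gt_d9]
theorem half_le_inv_rpow_mul_log (hp : 0 < p) (hε0 : 0 < ε) (hε : ε ≤ 1 / 2) :
    1 / 2 ≤ 1 / ε ^ (2 + p) * Real.log (1 / ε) := by
  have h1 := half_le_log_inv hε0 hε
  have h2 : 1 ≤ 1 / ε ^ (2 + p) := by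
    rw [one_le_div (by positivity)]
    exact Real.rpow_le_one hε0.le (by linarith) (by linarith)
  nlinarith
theorem sampleConst_nonneg (K : AlgConstants) (p : ℝ) : 0 ≤ sampleConst K p := by
  have h1 := K.oversample_pos
  have h2 := K.one_le_scale
  have h3 := Real.log_nonneg h2
  unfold sampleConst
  positivity
theorem coarse_oversampling_le (hp : 0 < p) (hε0 : 0 < ε) (hε : ε ≤ 1 / 2) (d : ℕ) :
    K.oversample * d ≤ sampleConst K p * (1 / ε ^ (2 + p) * Real.log (1 / ε)) * d := by
  have h0 := K.oversample_pos
  have h1 := half_le_inv_rpow_mul_log hp hε0 hε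
  have h2 : 1 ≤ K.scale ^ (2 + p) := Real.one_le_rpow K.one_le_scale (by linarith)
  have h3 := Real.log_nonneg K.one_le_scale
  have h4 : 1 ≤ K.scale ^ (2 + p) * (1 + 2 * Real.log K.scale) :=
    one_le_mul_of_one_le_of_one_le h2 (by linarith)
  have h5 := one_le_mul_of_one_le_of_one_le h4
    (show 1 ≤ 2 * (1 / ε ^ (2 + p) * Real.log (1 / ε)) by linarith)
  refine mul_le_mul_of_nonneg_right ?_ (Nat.cast_nonneg d)
  calc K.oversample ≤ K.oversample * (K.scale ^ (2 + p) * (1 + 2 * Real.log K.scale) *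
        (2 * (1 / ε ^ (2 + p) * Real.log (1 / ε)))) := le_mul_of_one_le_right h0.le h5
    _ = _ := by unfold sampleConst; ring
theorem fine_oversampling_le (hε0 : 0 < ε) (hε : ε ≤ 1 / 2) (d : ℕ) :
    K.oversample * d / (ε / K.scale) ^ (2 + p) * Real.log (1 / (ε / K.scale)) ≤
      sampleConst K p * (1 / ε ^ (2 + p) * Real.log (1 / ε)) * d := by
  have h0 := K.oversample_pos
  have hs : 0 < K.scale := by linarith [K.one_le_scale]
  have h1 := half_le_log_inv hε0 hε
  have h3 := Real.log_nonneg K.one_le_scale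
  have h4 : Real.log (1 / (ε / K.scale)) ≤ (1 + 2 * Real.log K.scale) * Real.log (1 / ε) := by
    rw [show 1 / (ε / K.scale) = 1 / ε * K.scale by field_simp,
      Real.log_mul (by positivity) hs.ne']
    nlinarith
  rw [Real.div_rpow hε0.le hs.le]
  calc K.oversample * d / (ε ^ (2 + p) / K.scale ^ (2 + p)) * Real.log (1 / (ε / K.scale))
      ≤ K.oversample * d / (ε ^ (2 + p) / K.scale ^ (2 + p)) *
        ((1 + 2 * Real.log K.scale) * Real.log (1 / ε)) := by gcongr
    _ = 1 / 2 * (sampleConst K p * (1 / ε ^ (2 + p) * Real.log (1 / ε)) * d) := by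
      unfold sampleConst; field_simp
    _ ≤ _ := by
      have := sampleConst_nonneg K p
      have : 0 ≤ sampleConst K p * (1 / ε ^ (2 + p) * Real.log (1 / ε)) * d := by positivity
      linarith
/-- The constant in the bounds for the costs. -/
noncomputable def costConst (K : AlgConstants) (p κ : ℝ) : ℝ :=
  160000 * (2 * timeConst K κ + 18 + 2 * timeConst K κ * sampleConst K p + 6) +
    64000000 * sampleConst K p * (4 + 40 * κ / K.threshold)
variable {n d L R N : ℕ} {κ T : ℝ}
theorem timeConst_nonneg (hκ : 0 ≤ κ) : 0 ≤ timeConst K κ := by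
  have := K.threshold_pos
  unfold timeConst
  positivity
theorem costConst_pos (hκ : 0 ≤ κ) : 0 < costConst K p κ := by
  have := K.threshold_pos
  have := timeConst_nonneg (K := K) hκ
  have := sampleConst_nonneg K p
  unfold costConst
  positivity
theorem queries_le (hκ : 0 ≤ κ) (hn : 2 ≤ n) (hd : 1 ≤ d) (hε0 : 0 < ε) (hε : ε ≤ 1 / 2)
    (hL : (L : ℝ) ≤ 20 * Real.log n) (hR : (R : ℝ) ≤ 20 * Real.log n)
    (hN : (N : ℝ) ≤ 20 * Real.log n) {m m' : ℝ}
    (hm : m ≤ sampleConst K p * (1 / ε ^ (2 + p) * Real.log (1 / ε)) * d)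
    (hm' : m' ≤ sampleConst K p * (1 / ε ^ (2 + p) * Real.log (1 / ε)) * d) :
    4000 * (m * (N * (2 * (2 * d + hashTotal K p κ d L R)))) +
      4000 * (m' * (N * (2 * (2 * d + hashTotal K p κ d L R)))) ≤
        costConst K p κ * queryBound n d p ε := by
  have hlog := half_le_log hn
  have h1 := half_le_log_inv hε0 hε
  have hthr := K.threshold_pos
  have hsc := sampleConst_nonneg K p
  have htc := timeConst_nonneg (K := K) hκ
  have hd0 : (0 : ℝ) < d := by exact_mod_cast hd
  have hsize := sampleSize_le (K := K) (p := p) hκ hd (by linarith) hL hR hN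
  set E := (d : ℝ) ^ max 1 (p / 2) with hE
  set B := 1 / ε ^ (2 + p) * Real.log (1 / ε) with hB
  have hB0 : 0 ≤ B := by positivity
  set Z := (N : ℝ) * (2 * (2 * d + hashTotal K p κ d L R)) with hZ
  have hZ0 : 0 ≤ Z := by
    have := hashTotal_nonneg (p := p) (d := d) K hκ L R
    positivity
  have hQ : queryBound n d p ε = E * d * Real.log n ^ 3 * B := by
    rw [queryBound, show max 2 (p / 2 + 1) = max 1 (p / 2) + 1 by
      rw [← max_add_add_right]; norm_num, Real.rpow_add_one hd0.ne']
    ring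
  have hQ0 : 0 ≤ queryBound n d p ε := by rw [hQ]; positivity
  calc 4000 * (m * Z) + 4000 * (m' * Z)
      ≤ 4000 * (sampleConst K p * B * d * ((4 + 40 * κ / K.threshold) * E *
          (20 * Real.log n) ^ 3)) + 4000 * (sampleConst K p * B * d *
          ((4 + 40 * κ / K.threshold) * E * (20 * Real.log n) ^ 3)) := by gcongr
    _ = 64000000 * sampleConst K p * (4 + 40 * κ / K.threshold) * queryBound n d p ε := by
      rw [hQ]; ring
    _ ≤ _ := by
      refine mul_le_mul_of_nonneg_right ?_ hQ0
      unfold costConst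
      have : 0 ≤ 160000 * (2 * timeConst K κ + 18 + 2 * timeConst K κ * sampleConst K p + 6) := by
        positivity
      linarith
theorem time_le (hκ : 0 ≤ κ) (hT : 1 ≤ T) (hp : 0 < p) (hn : 2 ≤ n) (hd : 1 ≤ d) (hε0 : 0 < ε)
    (hε : ε ≤ 1 / 2) (A : Matrix (Fin n) (Fin d) ℝ)
    (hL : (L : ℝ) ≤ 20 * Real.log n) (hR : (R : ℝ) ≤ 20 * Real.log n)
    (hN : (N : ℝ) ≤ 20 * Real.log n) {m m' : ℝ} (hm0 : 0 ≤ m) (hm0' : 0 ≤ m')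
    (hm : m ≤ sampleConst K p * (1 / ε ^ (2 + p) * Real.log (1 / ε)) * d)
    (hm' : m' ≤ sampleConst K p * (1 / ε ^ (2 + p) * Real.log (1 / ε)) * d) :
    twoRoundTime κ T n d L R N (nnz A) (4000 * (m * (2 * T + hashTotal K p κ d L R))) +
        nnz A + 5 * n + d + 2 +
      (twoRoundTime κ T n d L R N (nnz A) (4000 * (m' * (2 * T + hashTotal K p κ d L R))) +
        3 * nnz A + 6 * n + 2 * d + 11) ≤ costConst K p κ * timeBound A p ε T := by
  have hlog := half_le_log hn
  have hthr := K.threshold_pos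
  have hsc := sampleConst_nonneg K p
  have htc := timeConst_nonneg (K := K) hκ
  have hnz : (0 : ℝ) ≤ nnz A := Nat.cast_nonneg _
  have hn2 : (2 : ℝ) ≤ n := by exact_mod_cast hn
  have hx : 1 ≤ 20 * Real.log n := by linarith
  have t1 := twoRoundTime_le (K := K) (p := p) hκ hT hn hd hx hL hR hN hnz hm0 hm
  have t2 := twoRoundTime_le (K := K) (p := p) hκ hT hn hd hx hL hR hN hnz hm0' hm'
  have hB := half_le_inv_rpow_mul_log hp hε0 hε
  have hdE := self_le_rpow_max (p := p) hd
  set E := (d : ℝ) ^ max 1 (p / 2) with hE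
  set B := 1 / ε ^ (2 + p) * Real.log (1 / ε) with hBdef
  set x := 20 * Real.log n with hxdef
  set s := ((nnz A : ℝ) + n) * x ^ 3 with hs
  set r := B * (T * E + T ^ 2) * x ^ 4 with hr
  have hE0 : 0 ≤ E := by positivity
  have hbound : s + r ≤ 160000 * timeBound A p ε T := by
    have e1 : 160000 * timeBound A p ε T = 160000 * (((nnz A : ℝ) + n) * Real.log n ^ 3) + r := by
      rw [hr, hBdef, hxdef, timeBound]; ring
    have e2 : s = 8000 * (((nnz A : ℝ) + n) * Real.log n ^ 3) := by rw [hs, hxdef]; ring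
    have e3 : 0 ≤ ((nnz A : ℝ) + n) * Real.log n ^ 3 := by positivity
    linarith
  have hsn : (nnz A : ℝ) + n ≤ s := le_mul_of_one_le_right (by positivity) (one_le_pow₀ hx)
  have hdr : (d : ℝ) ≤ 2 * r := by
    have e1 : E ≤ T * E + T ^ 2 := by nlinarith
    have e2 : 1 ≤ 2 * B * x ^ 4 := one_le_mul_of_one_le_of_one_le (by linarith) (one_le_pow₀ hx)
    calc (d : ℝ) ≤ T * E + T ^ 2 := hdE.trans e1
      _ ≤ (T * E + T ^ 2) * (2 * B * x ^ 4) := le_mul_of_one_le_right (by positivity) e2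
      _ = 2 * r := by rw [hr]; ring
  have hs0 : 0 ≤ s := by positivity
  have hr0 : 0 ≤ r := by positivity
  have hsr : sampleConst K p * B * (T * E + T ^ 2) * x ^ 4 = sampleConst K p * r := by
    rw [hr]; ring
  rw [hsr] at t1 t2
  set c := timeConst K κ with hc
  set C := sampleConst K p with hC
  have p1 : 0 ≤ c * s := by positivity
  have p2 : 0 ≤ c * r := by positivity
  have p3 : 0 ≤ c * C * s := by positivity
  have p4 : 0 ≤ c * C * r := by positivity
  calc _ ≤ (2 * c + 18 + 2 * c * C + 6) * (s + r) := by linarith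
    _ ≤ (2 * c + 18 + 2 * c * C + 6) * (160000 * timeBound A p ε T) :=
      mul_le_mul_of_nonneg_left hbound (by positivity)
    _ = 160000 * (2 * c + 18 + 2 * c * C + 6) * timeBound A p ε T := by ring
    _ ≤ _ := by
      refine mul_le_mul_of_nonneg_right ?_ (by linarith)
      rw [costConst, ← hc, ← hC]
      have : 0 ≤ 64000000 * C * (4 + 40 * κ / K.threshold) := by positivity
      linarith
end Prog

theorem one_le_roundConst {p H : ℝ} (hp : 0 < p) (hH : 0 ≤ H) : 1 ≤ roundConst p H := by
  have h1 : (0 : ℝ) < max 1 p := by positivity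
  unfold roundConst
  have h2 : 0 ≤ max 1 p * 2 ^ max 1 p + max 1 p * (2 ^ max 1 p * (2 ^ (max 1 p + 1) + H)) +
    2 * p * Real.exp p * (1 + H) := by positivity
  linarith
/-- The error of the two-stage algorithm is at most this multiple of the internal accuracy. -/
noncomputable def errorConst (p cU κ : ℝ) : ℝ :=
  (2 * ((1 + 4000) * (2 * roundConst p 4000)) + p * Real.exp p * 2 ^ (max 1 p + 1)) *
    fineRadius p cU κ
/-- The ratio of the accuracy of the algorithm and the internal accuracy. -/
noncomputable def scaleConst (p cU κ : ℝ) : ℝ :=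
  2 + 2 * halvingConst p cU * ((1 + 4000) * (2 * roundConst p 4000)) +
    2 * (2 * errorConst p cU κ + 1) / p
section
variable {p cU κ : ℝ}
theorem errorConst_nonneg (hp : 0 < p) (hcU : 1 ≤ cU) (hκ : 1 ≤ κ) : 0 ≤ errorConst p cU κ := by
  have h1 := one_le_roundConst (H := 4000) hp (by norm_num)
  have h2 := le_fineRadius hp hcU hκ
  have h3 := one_le_coarseRadius hp hcU hκ
  have h4 : 0 ≤ fineRadius p cU κ := le_trans (by positivity) h2
  unfold errorConst
  positivity
theorem two_le_scaleConst (hp : 0 < p) (hcU : 1 ≤ cU) (hκ : 1 ≤ κ) : 2 ≤ scaleConst p cU κ := by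
  have h1 := one_le_roundConst (H := 4000) hp (by norm_num)
  have h2 := errorConst_nonneg hp hcU hκ
  have h3 := one_le_halvingConst hp hcU
  unfold scaleConst
  have h4 : 0 ≤ 2 * halvingConst p cU * ((1 + 4000) * (2 * roundConst p 4000)) := by positivity
  have h5 : 0 ≤ 2 * (2 * errorConst p cU κ + 1) / p := by positivity
  linarith
theorem roundError_le (hp : 0 < p) (hcU : 1 ≤ cU) (hκ : 1 ≤ κ) {δ : ℝ}
    (hδ : δ ≤ 1 / scaleConst p cU κ) :
    (1 + 4000) * (2 * roundConst p 4000 * δ) ≤ 1 / (2 * halvingConst p cU) := by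
  have h1 := one_le_roundConst (H := 4000) hp (by norm_num)
  have h2 := errorConst_nonneg hp hcU hκ
  have h3 := one_le_halvingConst hp hcU
  have hs := two_le_scaleConst hp hcU hκ
  have h4 : 2 * halvingConst p cU * ((1 + 4000) * (2 * roundConst p 4000)) ≤
      scaleConst p cU κ := by
    unfold scaleConst
    have h5 : 0 ≤ 2 * (2 * errorConst p cU κ + 1) / p := by positivity
    linarith
  calc (1 + 4000) * (2 * roundConst p 4000 * δ)
      ≤ (1 + 4000) * (2 * roundConst p 4000 * (1 / scaleConst p cU κ)) := by gcongr
    _ ≤ _ := by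
      rw [le_div_iff₀ (by positivity), show (1 + 4000) * (2 * roundConst p 4000 *
        (1 / scaleConst p cU κ)) * (2 * halvingConst p cU) = 2 * halvingConst p cU *
        ((1 + 4000) * (2 * roundConst p 4000)) / scaleConst p cU κ by ring,
        div_le_one (by linarith)]
      exact h4
/-- A solution `y` whose energy exceeds that of a near-minimizer `y₀` by the error of the two-stage
algorithm is accurate. -/
theorem finalError_le (hp : 0 < p) (hcU : 1 ≤ cU) (hκ : 1 ≤ κ) {ε : ℝ} (hε0 : 0 < ε)
    (hε : ε ≤ 1 / 2) :
    0 ≤ (1 + errorConst p cU κ * (ε / scaleConst p cU κ)) * (1 + ε / scaleConst p cU κ) - 1 ∧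
    2 * (((1 + errorConst p cU κ * (ε / scaleConst p cU κ)) * (1 + ε / scaleConst p cU κ) - 1) / p) ≤
      ε := by
  have h2 := errorConst_nonneg hp hcU hκ
  have h1 := one_le_roundConst (H := 4000) hp (by norm_num)
  have h3 := one_le_halvingConst hp hcU
  have hs := two_le_scaleConst hp hcU hκ
  have h4 : 2 * (2 * errorConst p cU κ + 1) / p ≤ scaleConst p cU κ := by
    have : 0 ≤ 2 * halvingConst p cU * ((1 + 4000) * (2 * roundConst p 4000)) := by positivity
    conv_rhs => unfold scaleConst
    linarith
  set s := scaleConst p cU κ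
  set E := errorConst p cU κ
  set δ := ε / s with hδ
  have hs0 : 0 < s := by linarith
  have hδ0 : 0 < δ := by positivity
  have hδ1 : δ ≤ 1 := by rw [hδ, div_le_one hs0]; linarith
  have h5 : (1 + E * δ) * (1 + δ) - 1 ≤ (2 * E + 1) * δ := by
    have : E * δ * δ ≤ E * δ := mul_le_of_le_one_right (by positivity) hδ1
    linarith
  constructor
  · have : 0 ≤ E * δ := by positivity
    nlinarith
  · rw [div_le_iff₀ hp] at h4
    have h6 : 2 * ((2 * E + 1) * δ) ≤ ε * p := by
      calc 2 * ((2 * E + 1) * δ) = 2 * (2 * E + 1) * δ := by ring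
        _ ≤ s * p * δ := by gcongr
        _ = ε * p := by rw [hδ]; field_simp
    rw [← mul_div_assoc, div_le_iff₀ hp]
    linarith
open Prog
theorem coarse_oversampling_ge {K : AlgConstants} {K₁ : ℝ} (hK₁ : 0 < K₁)
    (h₁ : 1 + K₁ ≤ K.oversample)
    (h₂ : K₁ * Real.log K.scale * K.scale ^ (2 + p) ≤ K.oversample) {d : ℕ} (hd : 1 ≤ d) :
    1 / 2 ≤ K.oversample * d ∧ K₁ * d * Real.log (1 / (1 / K.scale)) / (1 / K.scale) ^ (2 + p) ≤
      K.oversample * d := by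
  have hs0 : 0 < K.scale := by linarith [K.one_le_scale]
  have hd1 : (1 : ℝ) ≤ d := by exact_mod_cast hd
  constructor
  · have : 1 * 1 ≤ K.oversample * d := mul_le_mul (by linarith) hd1 (by norm_num) (by linarith)
    linarith
  · rw [one_div_one_div, one_div, Real.inv_rpow hs0.le, div_inv_eq_mul]
    calc K₁ * d * Real.log K.scale * K.scale ^ (2 + p) =
          K₁ * Real.log K.scale * K.scale ^ (2 + p) * d := by ring
      _ ≤ _ := by gcongr
theorem fine_oversampling_ge (hp : 0 < p) {K : AlgConstants} {K₁ : ℝ} (hK₁ : 0 < K₁)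
    (h₁ : 1 + K₁ ≤ K.oversample) {d : ℕ} (hd : 1 ≤ d) {δ : ℝ} (hδ0 : 0 < δ) (hδ : δ ≤ 1 / 2) :
    1 / 2 ≤ K.oversample * d / δ ^ (2 + p) * Real.log (1 / δ) ∧
      K₁ * d * Real.log (1 / δ) / δ ^ (2 + p) ≤
        K.oversample * d / δ ^ (2 + p) * Real.log (1 / δ) := by
  have hd1 : (1 : ℝ) ≤ d := by exact_mod_cast hd
  have hBδ := half_le_inv_rpow_mul_log hp hδ0 hδ
  rw [show K.oversample * d / δ ^ (2 + p) * Real.log (1 / δ) =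
    K.oversample * d * (1 / δ ^ (2 + p) * Real.log (1 / δ)) by ring,
    show K₁ * d * Real.log (1 / δ) / δ ^ (2 + p) =
      K₁ * d * (1 / δ ^ (2 + p) * Real.log (1 / δ)) by ring]
  constructor
  · have : 1 * 1 ≤ K.oversample * d := mul_le_mul (by linarith) hd1 (by norm_num) (by linarith)
    nlinarith
  · refine mul_le_mul_of_nonneg_right ?_ (by linarith)
    gcongr; linarith
end
open Prog in
/-- The guarantee of the algorithm, for suitable constants. -/
theorem exists_triple_relativeErrorRegression (p q cL : ℝ) (hp : 0 < p) (hq : 0 < q)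
    (hcL : 0 < cL) :
    ∃ K₁ : ℝ, 0 < K₁ ∧ ∀ (cU κ : ℝ), 1 ≤ cU → 1 ≤ κ → ∀ (K : AlgConstants),
      K.threshold = 1 / (1 + cU) → K.reps = 12 → K.scale = scaleConst p cU κ →
      1 + K₁ ≤ K.oversample → K₁ * Real.log K.scale * K.scale ^ (2 + p) ≤ K.oversample →
      ∀ (M : ℝ≥0 → ℝ≥0), IsAdmissibleLoss M p q cU cL → ∀ (n d : ℕ), 2 ≤ n → 1 ≤ d →
      ∀ (A : Matrix (Fin n) (Fin d) ℝ) (b : Fin n → ℝ) (ε δ : ℝ), 0 < ε → ε < 1 / 2 →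
      δ = ε / K.scale → ∀ (T : ℝ), 1 ≤ T →
      ∀ (lewis : LewisRoutine n d p κ T) (coarse : RegressionRoutine M p d κ)
        (fine : RegressionRoutine M p d (1 + δ)),
        Triple b (relativeErrorRegression K δ lewis coarse fine A)
          (ENNReal.ofReal (1 / 100)) (costConst K p κ * timeBound A p ε T)
          (costConst K p κ * queryBound n d p ε)
          (fun x => ∀ x', mNorm M p (fun _ => 1) (A.mulVec x - b) ≤
            (1 + ε) * mNorm M p (fun _ => 1) (A.mulVec x' - b)) := by
  obtain ⟨K₁, hK₁, hround⟩ := exists_triple_twoRoundSampling p q cL hp hq hcL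
  refine ⟨K₁, hK₁, ?_⟩
  intro cU κ hcU hκ K hthr hreps hscale hO₁ hO₂ M hM n d hn hd A b ε δ hε0 hε hδ T hT lewis coarse
    fine
  have hs := two_le_scaleConst hp hcU hκ
  rw [← hscale] at hs
  have hs0 : 0 < K.scale := by linarith
  have hκ0 : 0 ≤ κ := by linarith
  have hδ0 : 0 < δ := by rw [hδ]; positivity
  have hδs : δ ≤ 1 / K.scale := by rw [hδ]; gcongr; linarith
  have hs2 : 1 / K.scale ≤ 1 / 2 := one_div_le_one_div_of_le (by norm_num) hs
  have herr : ∀ {δ' : ℝ}, δ' ≤ 1 / K.scale →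
      (1 + 4000) * (2 * roundConst p 4000 * δ') ≤ 1 / (2 * halvingConst p cU) := fun h =>
    roundError_le hp hcU hκ (hscale ▸ h)
  have herr' : ∀ {δ' : ℝ}, 0 ≤ δ' → δ' ≤ 1 / K.scale → 2 * roundConst p 4000 * δ' ≤ 1 := by
    intro δ' h0 h
    have hc := one_le_halvingConst hp hcU
    have hrc := one_le_roundConst (p := p) (H := 4000) hp (by norm_num)
    have h2 : 1 / (2 * halvingConst p cU) ≤ 1 := by rw [div_le_one (by positivity)]; linarith
    have h3 : 0 ≤ 2 * roundConst p 4000 * δ' := by positivity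
    linarith [herr h]
  obtain ⟨hmc0, hmc1⟩ := coarse_oversampling_ge (p := p) hK₁ hO₁ hO₂ hd
  obtain ⟨hmf0, hmf1⟩ := fine_oversampling_ge hp hK₁ hO₁ hd hδ0 (hδs.trans hs2)
  have hmcB := coarse_oversampling_le (K := K) hp hε0 hε.le d
  have hmfB := fine_oversampling_le (p := p) (K := K) hε0 hε.le d
  rw [← hδ] at hmfB
  -- a near-minimizer, and the scale of the problem
  have hy := hM.exists_near_minimizer hcL (LinearMap.range A.mulVecLin) b hδ0
  obtain ⟨y₀, hy₀, hmin⟩ := hy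
  have hF0 : ∀ z : Fin n → ℝ, 0 ≤ energy M (fun _ => 1) z := energy_nonneg fun _ => zero_le_one
  obtain ⟨ρ₀, hρ₀, hbρ, hbρ'⟩ : ∃ ρ₀ : ℝ, 0 < ρ₀ ∧ energy M (fun _ => 1) (b - y₀) ≤ ρ₀ ∧
      (b = y₀ ∨ energy M (fun _ => 1) (y₀ - b) = ρ₀) := by
    by_cases h : b = y₀
    · exact ⟨1, one_pos, by rw [h, sub_self, hM.energy_zero]; exact zero_le_one, Or.inl h⟩
    · refine ⟨_, lt_of_le_of_ne (hF0 (b - y₀)) fun h0 => h ?_, le_rfl,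
        Or.inr (energy_sub_comm _ _)⟩
      exact sub_eq_zero.1 (hM.energy_one_eq_zero hcL h0.symm)
  have hR := one_le_coarseRadius hp hcU hκ
  have hR' := le_fineRadius hp hcU hκ
  have h2P : (1 : ℝ) ≤ 2 ^ max 1 p := Real.one_le_rpow (by norm_num) (by positivity)
  have hR1 : 1 ≤ 2 ^ max 1 p * coarseRadius p cU κ := one_le_mul_of_one_le_of_one_le h2P hR
  have sampling := fun m ε' hε0 hε' hm0 hm herr => hround cU hcU M hM K hthr hreps κ T hκ0 hT n d hn
    hd lewis A b ε' m hε0 hε' hm0 hm herr _ _ _ rfl rfl rfl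
  have stage₁ := (triple_constantFactorRegression hp hκ0 K lewis coarse A hy₀
    (sampling (K.oversample * d) (1 / K.scale) (by positivity) hs2 hmc0 hmc1
      (herr' (by positivity) le_rfl) (b - y₀) ρ₀ (coarseRadius p cU κ * ρ₀) hρ₀
      (le_mul_of_one_le_left hρ₀.le hR) hbρ)).mono le_rfl le_rfl le_rfl
    fun xc hxc => hM.coarse_accuracy hp hq hcU hcL hκ hρ₀ (herr le_rfl) hbρ hxc
  have total := stage₁.bind fun xc hxc => (triple_residualRegression hp (by linarith) K lewis fine A
    xc (sampling _ δ hδ0 (hδs.trans hs2) hmf0 hmf1 (herr' hδ0.le hδs) (b - A.mulVec xc)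
      (2 ^ max 1 p * coarseRadius p cU κ * ρ₀) (fineRadius p cU κ * ρ₀) (by positivity)
      (mul_le_mul_of_nonneg_right (by linarith) hρ₀.le) hxc.2.1)).mono le_rfl le_rfl le_rfl
    fun x hx => (hM.fine_accuracy hp hq hcU hcL hκ hρ₀ hδ0.le (by linarith) (herr hδs) hy₀ ⟨xc, rfl⟩
      hxc.1 hx).imp_right fun h h' => h (hxc.2.2 h')
  rw [relativeErrorRegression_eq]
  refine total.mono ?_
    (time_le hκ0 hT hp hn hd hε0 hε.le A (ceil_reps_le hn) (ceil_logb_natCast_le hn)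
      (ceil_logb_one_add_le hn) (by linarith) (by linarith) hmcB hmfB)
    (queries_le hκ0 hn hd hε0 hε.le (ceil_reps_le hn) (ceil_logb_natCast_le hn)
      (ceil_logb_one_add_le hn) hmcB hmfB) fun x hx x' => ?_
  · rw [← ENNReal.ofReal_add (by norm_num) (by norm_num)]
    exact ENNReal.ofReal_le_ofReal (by norm_num)
  obtain ⟨h3, h4⟩ := finalError_le hp hcU hκ hε0 hε.le
  rw [← hscale, ← hδ] at h3 h4
  refine mNorm_le_of_energy_le hp (fun _ => zero_le_one) h3 (by linarith) h4 ?_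
  rw [add_sub_cancel]
  have hE := errorConst_nonneg hp hcU hκ
  rcases hbρ' with h5 | h5
  · rw [hx.2 h5, sub_self, hM.energy_zero]
    have := hF0 (A.mulVec x' - b)
    positivity
  · have h6 : energy M (fun _ => 1) (A.mulVec x - b) ≤
        (1 + errorConst p cU κ * δ) * energy M (fun _ => 1) (y₀ - b) := by
      refine hx.1.trans_eq ?_
      rw [h5, errorConst]; ring
    refine h6.trans ?_
    rw [mul_assoc]
    exact mul_le_mul_of_nonneg_left (hmin _ ⟨x', rfl⟩) (by positivity)
theorem mainTheorem4 (p q cU cL κ : ℝ) (hp : 0 < p) (hq : 0 < q) (hcU : 1 ≤ cU) (hcL : 0 < cL)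
    (hκ : 1 ≤ κ) :
    ∃ (K : AlgConstants) (C : ℝ), 0 < C ∧
      ∀ (M : ℝ≥0 → ℝ≥0), IsAdmissibleLoss M p q cU cL →
      ∀ (n d : ℕ), 2 ≤ n → 1 ≤ d →
      ∀ (A : Matrix (Fin n) (Fin d) ℝ) (b : Fin n → ℝ) (ε : ℝ), 0 < ε → ε < 1 / 2 →
      ∀ (T : ℝ), 1 ≤ T →
      ∀ (lewis : LewisRoutine n d p κ T) (coarse : RegressionRoutine M p d κ)
        (fine : RegressionRoutine M p d (1 + ε / K.scale)),
        (99 / 100 : ℝ≥0∞) ≤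
          ((relativeErrorRegression K (ε / K.scale) lewis coarse fine A).run b).toOuterMeasure
            {r : (Fin d → ℝ) × Cost |
              (∀ x : Fin d → ℝ,
                mNorm M p (fun _ => 1) (A.mulVec r.1 - b) ≤
                  (1 + ε) * mNorm M p (fun _ => 1) (A.mulVec x - b)) ∧
              (r.2.time : ℝ) ≤ C * timeBound A p ε T + r.2.solverTime ∧
              (r.2.queries : ℝ) ≤ C * queryBound n d p ε} := by
  obtain ⟨K₁, hK₁, hmain⟩ := exists_triple_relativeErrorRegression p q cL hp hq hcL
  have hs := two_le_scaleConst hp hcU hκ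
  have hlogs : 0 ≤ Real.log (scaleConst p cU κ) := Real.log_nonneg (by linarith)
  have hX : 0 ≤ K₁ * Real.log (scaleConst p cU κ) * scaleConst p cU κ ^ (2 + p) := by positivity
  let K : AlgConstants :=
    { reps := 12
      threshold := 1 / (1 + cU)
      oversample := 1 + K₁ + K₁ * Real.log (scaleConst p cU κ) * scaleConst p cU κ ^ (2 + p)
      scale := scaleConst p cU κ
      reps_pos := by norm_num
      threshold_pos := by positivity
      oversample_pos := by positivity
      one_le_scale := by linarith }
  refine ⟨K, Prog.costConst K p κ, Prog.costConst_pos (by linarith), ?_⟩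
  intro M hM n d hn hd A b ε hε0 hε T hT lewis coarse fine
  have h := hmain cU κ hcU hκ K rfl rfl rfl (le_add_of_nonneg_right hX)
    (le_add_of_nonneg_left (by linarith)) M hM n d hn hd A b ε _ hε0 hε rfl T hT lewis coarse fine
  refine le_trans (le_of_eq ?_) (h.le_toOuterMeasure_run (by norm_num))
  rw [show (1 : ℝ) - 1 / 100 = 99 / 100 by norm_num, ENNReal.ofReal_div_of_pos (by norm_num)]
  norm_num
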